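/- Let $\alpha\ge 0$ be real and let $s_1,s_3\in\mathbb{C}$ satisfy $s_1+s_3=-2\sin(\pi\alpha)$. Take $\arg\eta\in[-\tfrac{7\pi}{6},\tfrac{5\pi}{6})$, and let $\Gamma_1,\Gamma_2,\Gamma_3,\Gamma_4$ be the rays $\arg\eta=\tfrac{\pi}{6},-\tfrac{7\pi}{6},-\tfrac{5\pi}{6},-\tfrac{\pi}{6}$, oriented to infinity. Let $\Sigma_M$ be the union of these rays and their endpoint $0$, and let $\tilde\Omega_1,\tilde\Omega_2,\tilde\Omega_3,\tilde\Omega_4$ be the sectors $(-\tfrac{\pi}{6},\tfrac{\pi}{6})$, $(\tfrac{\pi}{6},\tfrac{5\pi}{6})$, $(-\tfrac{7\pi}{6},-\tfrac{5\pi}{6})$, $(-\tfrac{5\pi}{6},-\tfrac{\pi}{6})$ of values of $\arg\eta$. Powers and $\log\eta$ use this branch of $\arg\eta$ (cut along $\Gamma_2$); $\sigma_3=\mathrm{diag}(1,-1)$. Model Riemann–Hilbert problem: find a $2\times2$ matrix-valued function $M$ such that (a) $M$ is analytic on $\mathbb{C}\setminus\Sigma_M$; (b) at every point of $\Gamma_k$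 the limits $M_+$ (from the left side of $\Gamma_k$) and $M_-$ (from the right side) exist and $M_+=M_-J_k$, where $$J_1=\begin{pmatrix}1&-s_3\\0&1\end{pmatrix},\quad J_2=\begin{pmatrix}1&-s_1\\0&1\end{pmatrix},\quad J_3=\begin{pmatrix}1&0\\s_3&1\end{pmatrix},\quad J_4=\begin{pmatrix}1&0\\s_1&1\end{pmatrix};$$ (c) $M(\eta)=(I+O(1/\eta))e^{i\eta\sigma_3}$ as $\eta\to\infty$ in $\mathbb{C}\setminus\Sigma_M$; (d) as $\eta\to0$, entrywise, with $c=s_3+ie^{-\pi i\alpha}$, $$M(\eta)=O\begin{pmatrix}|\eta|^{-\alpha}&|\eta|^{-\alpha}\\|\eta|^{-\alpha}&|\eta|^{-\alpha}\end{pmatrix}\ (\eta\in\tilde\Omega_1\text{ and }\eta\in\tilde\Omega_3),$$ $$M(\eta)\begin{pmatrix}1&c\\0&1\end{pmatrix}=O\begin{pmatrix}|\eta|^{-\alpha}&|\eta|^{\alpha}\\|\eta|^{-\alpha}&|\eta|^{\alpha}\end{pmatrix}\ (\eta\in\tilde\Omega_2),\qquad M(\eta)\begin{pmatrix}1&0\\-c&1\end{pmatrix}=O\begin{pmatrix}|\eta|^{\alpha}&|\eta|^{-\alpha}\\|\eta|^{\alpha}&|\eta|^{-\alpha}\end{pmatrix}\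 (\eta\in\tilde\Omega_4).$$ Then this problem has a unique solution on $\mathbb{C}\setminus\Sigma_M$, namely $$M=M_1\text{ in }\tilde\Omega_1,\quad M=M_1\begin{pmatrix}1&-s_3\\0&1\end{pmatrix}\text{ in }\tilde\Omega_2,\quad M=M_2\text{ in }\tilde\Omega_3,\quad M=M_2\begin{pmatrix}1&0\\s_3&1\end{pmatrix}\text{ in }\tilde\Omega_4,$$ where $$M_1(\eta)=\frac{\sqrt\pi}{2\sqrt2}\begin{pmatrix}1&i\\i&1\end{pmatrix}\begin{pmatrix}i\eta^{1/2}H^{(1)}_{\alpha+1/2}(\eta)&-\eta^{1/2}H^{(2)}_{\alpha+1/2}(\eta)\\-i\eta^{1/2}H^{(1)}_{\alpha-1/2}(\eta)&\eta^{1/2}H^{(2)}_{\alpha-1/2}(\eta)\end{pmatrix}e^{\frac{\alpha}{2}\pi i\sigma_3},$$ $$M_2(\eta)=\frac{\sqrt\pi}{2\sqrt2}\begin{pmatrix}1&i\\i&1\end{pmatrix}\begin{pmatrix}i\eta^{1/2}H^{(2)}_{\alpha+1/2}(e^{\pi i}\eta)&\eta^{1/2}H^{(1)}_{\alpha+1/2}(e^{\pi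 i}\eta)\\i\eta^{1/2}H^{(2)}_{\alpha-1/2}(e^{\pi i}\eta)&\eta^{1/2}H^{(1)}_{\alpha-1/2}(e^{\pi i}\eta)\end{pmatrix}e^{-\frac{\alpha+1}{2}\pi i\sigma_3},$$ and $H^{(1)}_\nu=J_\nu+iY_\nu$, $H^{(2)}_\nu=J_\nu-iY_\nu$ are the principal branches of the Hankel functions (the point $e^{\pi i}\eta=-\eta$ in $M_2$ being given the argument $\arg\eta+\pi\in(-\tfrac{\pi}{6},\tfrac{5\pi}{6})$). Moreover, if $\alpha-\tfrac12$ is a non-negative integer, $M$ has a logarithmic singularity at the origin: in each sector $\tilde\Omega_k$ there are matrix functions $A,B$ (depending on $k$), analytic at $0$, with $B(0)\ne0$, such that $M(\eta)=\eta^{-\alpha}A(\eta)+\eta^{\alpha}\log\eta\,B(\eta)$ for all $\eta\in\tilde\Omega_k$ near $0$. -/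

import Mathlib

open Filter Topology Asymptotics Set

namespace ModelRH

noncomputable section

/-! ### Bessel and Hankel functions (principal branches, complex order) -/

/-- The Bessel function of the first kind
`J_ν(z) = (z/2)^ν ∑ₖ (-1)^k (z²/4)^k / (k! Γ(ν+k+1))`, principal branch `-π < arg z ≤ π`.
(At the poles of `Γ` the convention `1/0 = 0` gives the correct value of `1/Γ`.) -/
def besselJ (ν z : ℂ) : ℂ :=
  (z / 2) ^ ν *
    ∑' k : ℕ, (-1) ^ k * (z ^ 2 / 4) ^ k / ((k.factorial : ℂ) * Complex.Gamma (ν + k + 1))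

/-- The quotient defining `Y_ν(z)` for non-integer `ν`. -/
def besselYQuot (ν z : ℂ) : ℂ :=
  (besselJ ν z * Complex.cos (ν * Real.pi) - besselJ (-ν) z) / Complex.sin (ν * Real.pi)

open Classical in
/-- The Bessel function of the second kind `Y_ν(z)`: the quotient above when `ν` is not an integer,
and its limiting value in `ν` when `ν` is an integer. -/
def besselY (ν z : ℂ) : ℂ :=
  if ∃ n : ℤ, ν = n then limUnder (𝓝[≠] ν) (fun μ => besselYQuot μ z) else besselYQuot ν z

/-- The Hankel function of the first kind `H^{(1)}_ν = J_ν + i Y_ν`. -/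
def hankel1 (ν z : ℂ) : ℂ := besselJ ν z + Complex.I * besselY ν z

/-- The Hankel function of the second kind `H^{(2)}_ν = J_ν - i Y_ν`. -/
def hankel2 (ν z : ℂ) : ℂ := besselJ ν z - Complex.I * besselY ν z

/-! ### The contour -/

/-- The open ray `arg η = θ`, oriented to infinity. -/
def ray (θ : ℝ) : Set ℂ := {η | ∃ r : ℝ, 0 < r ∧ η = r * Complex.exp (θ * Complex.I)}

/-- The open sector `a < arg η < b`. -/
def sector (a b : ℝ) : Set ℂ :=
  {η | ∃ r θ : ℝ, 0 < r ∧ a < θ ∧ θ < b ∧ η = r * Complex.exp (θ * Complex.I)}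

def Γ₁ : Set ℂ := ray (Real.pi / 6)
def Γ₂ : Set ℂ := ray (-(7 * Real.pi / 6))
def Γ₃ : Set ℂ := ray (-(5 * Real.pi / 6))
def Γ₄ : Set ℂ := ray (-(Real.pi / 6))

/-- The contour: the four rays together with their common endpoint. -/
def contour : Set ℂ := {0} ∪ (Γ₁ ∪ Γ₂ ∪ Γ₃ ∪ Γ₄)

/-- The right sector, between `Γ₄` and `Γ₁`. -/
def Ω₁ : Set ℂ := sector (-(Real.pi / 6)) (Real.pi / 6)
/-- The upper sector, between `Γ₁` and `Γ₂`. -/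
def Ω₂ : Set ℂ := sector (Real.pi / 6) (5 * Real.pi / 6)
/-- The left sector, between `Γ₂` and `Γ₃`. -/
def Ω₃ : Set ℂ := sector (-(7 * Real.pi / 6)) (-(5 * Real.pi / 6))
/-- The lower sector, between `Γ₃` and `Γ₄`. -/
def Ω₄ : Set ℂ := sector (-(5 * Real.pi / 6)) (-(Real.pi / 6))

/-! ### Branches with the cut along `Γ₂`, i.e. `-7π/6 ≤ arg η < 5π/6` -/

/-- The argument of `η` in `[-7π/6, 5π/6)`. -/
def argΓ (η : ℂ) : ℝ :=
  if Complex.arg η < 5 * Real.pi / 6 then Complex.arg η else Complex.arg η - 2 * Real.pi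

/-- The logarithm with branch cut along `Γ₂`. -/
def logΓ (η : ℂ) : ℂ := Real.log ‖η‖ + argΓ η * Complex.I

/-- The power `η ^ c` (for `η ≠ 0`) with branch cut along `Γ₂`. -/
def powΓ (η c : ℂ) : ℂ := Complex.exp (c * logΓ η)

/-! ### The Riemann-Hilbert problem -/

abbrev Mat := Matrix (Fin 2) (Fin 2) ℂ

/-- `e^{c σ₃}`. -/
def expσ₃ (c : ℂ) : Mat := !![Complex.exp c, 0; 0, Complex.exp (-c)]

def upper (a : ℂ) : Mat := !![1, a; 0, 1]
def lower (a : ℂ) : Mat := !![1, 0; a, 1]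

/-- `M₊ = M₋ J` on the ray `Γ`, where `Ωl` and `Ωr` are the sectors to the left and to the right
of `Γ`: at every point of `Γ` the limits `M₊` from the left and `M₋` from the right exist
and satisfy the relation. -/
def HasJump (M : ℂ → Mat) (Γ Ωl Ωr : Set ℂ) (J : Mat) : Prop :=
  ∀ ζ ∈ Γ, ∃ Mplus Mminus : Mat,
    Tendsto M (𝓝[Ωl] ζ) (𝓝 Mplus) ∧ Tendsto M (𝓝[Ωr] ζ) (𝓝 Mminus) ∧ Mplus = Mminus * J

/-- Entrywise `F(η) = O(|η|^{e i j})` as `η → 0` in `Ω`. -/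
def IsBigOAtZero (F : ℂ → Mat) (Ω : Set ℂ) (e : Matrix (Fin 2) (Fin 2) ℝ) : Prop :=
  ∀ i j, (fun η => F η i j) =O[𝓝[Ω] 0] (fun η => ‖η‖ ^ (e i j))

/-- The constant `s₃ + i e^{-π i α}` in the condition at the origin. -/
def originConst (α : ℝ) (s₃ : ℂ) : ℂ :=
  s₃ + Complex.I * Complex.exp (-(Real.pi * Complex.I * α))

/-- `M` solves the model Riemann-Hilbert problem with parameters `α, s₁, s₃`. -/
structure IsSolution (α : ℝ) (s₁ s₃ : ℂ) (M : ℂ → Mat) : Prop where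
  /-- analyticity off the contour -/
  analytic : ∀ i j, AnalyticOnNhd ℂ (fun η => M η i j) contourᶜ
  /-- the four jump relations -/
  jump₁ : HasJump M Γ₁ Ω₂ Ω₁ (upper (-s₃))
  jump₂ : HasJump M Γ₂ Ω₃ Ω₂ (upper (-s₁))
  jump₃ : HasJump M Γ₃ Ω₄ Ω₃ (lower s₃)
  jump₄ : HasJump M Γ₄ Ω₁ Ω₄ (lower s₁)
  /-- `M(η) = (I + O(1/η)) e^{iησ₃}` as `η → ∞` off the contour -/
  atInfinity : ∀ i j,
    (fun η => (M η * expσ₃ (-(Complex.I * η)) - 1) i j)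
      =O[Bornology.cobounded ℂ ⊓ 𝓟 contourᶜ] (fun η => η⁻¹)
  /-- behaviour at the origin -/
  origin₁ : IsBigOAtZero M Ω₁ !![-α, -α; -α, -α]
  origin₃ : IsBigOAtZero M Ω₃ !![-α, -α; -α, -α]
  origin₂ : IsBigOAtZero (fun η => M η * upper (originConst α s₃)) Ω₂ !![-α, α; -α, α]
  origin₄ : IsBigOAtZero (fun η => M η * lower (-originConst α s₃)) Ω₄ !![α, -α; α, -α]

/-! ### The explicit solution -/

/-- `M₁(η)`, to be used for `-π/6 < arg η < 5π/6`. -/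
def M₁ (α : ℝ) (η : ℂ) : Mat :=
  ((Real.sqrt Real.pi / (2 * Real.sqrt 2) : ℝ) : ℂ) •
    (!![1, Complex.I; Complex.I, 1] *
      !![Complex.I * powΓ η (1 / 2) * hankel1 (α + 1 / 2) η,
          -(powΓ η (1 / 2) * hankel2 (α + 1 / 2) η);
        -(Complex.I * powΓ η (1 / 2) * hankel1 (α - 1 / 2) η),
          powΓ η (1 / 2) * hankel2 (α - 1 / 2) η] *
      expσ₃ (α / 2 * (Real.pi * Complex.I)))

/-- `M₂(η)`, to be used for `-7π/6 < arg η < -π/6`. There `e^{πi} η` has argument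
`arg η + π ∈ (-π/6, 5π/6)`, so that the Hankel functions at `e^{πi} η` are the principal ones
at the point `-η`. -/
def M₂ (α : ℝ) (η : ℂ) : Mat :=
  ((Real.sqrt Real.pi / (2 * Real.sqrt 2) : ℝ) : ℂ) •
    (!![1, Complex.I; Complex.I, 1] *
      !![Complex.I * powΓ η (1 / 2) * hankel2 (α + 1 / 2) (-η),
          powΓ η (1 / 2) * hankel1 (α + 1 / 2) (-η);
        Complex.I * powΓ η (1 / 2) * hankel2 (α - 1 / 2) (-η),
          powΓ η (1 / 2) * hankel1 (α - 1 / 2) (-η)] *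
      expσ₃ (-((α + 1) / 2 * (Real.pi * Complex.I))))

open Classical in
/-- The explicit solution, sector by sector (with the irrelevant value `0` on the contour). -/
def solution (α : ℝ) (s₃ : ℂ) (η : ℂ) : Mat :=
  if η ∈ Ω₁ then M₁ α η
  else if η ∈ Ω₂ then M₁ α η * upper (-s₃)
  else if η ∈ Ω₃ then M₂ α η
  else if η ∈ Ω₄ then M₂ α η * lower s₃
  else 0

/-- Logarithmic singularity at the origin, in the sector `Ω`, with exponents `±α`: near `0` in `Ω`,
`F(η) = η^{-α} A(η) + η^α log η B(η)` with `A`, `B` analytic at `0` and `B(0) ≠ 0`. -/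
def HasLogSingularity (α : ℝ) (Ω : Set ℂ) (F : ℂ → Mat) : Prop :=
  ∃ A B : ℂ → Mat,
    (∀ i j, AnalyticAt ℂ (fun η => A η i j) 0) ∧ (∀ i j, AnalyticAt ℂ (fun η => B η i j) 0) ∧
    B 0 ≠ 0 ∧
    ∀ᶠ η in 𝓝[Ω] 0, F η = powΓ η (-α) • A η + (powΓ η α * logΓ η) • B η

end

end ModelRH

/-! Existence is a verification for the explicit Hankel matrix; uniqueness is a
quotient-and-Liouville argument. The analytic weight lies in the Hankel functions, for which
everything is derived from the power series of `J_ν` and the definition of `Y_ν`.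

Hankel functions. Expanding the exponential and computing the moments of `(1-t²)^μ` gives Poisson's
integral for `J_ν`. Cauchy's theorem rotates it onto two vertical half-lines, where it becomes a
pair of Laplace integrals `G_μ(x) = ∫ e^{-t} t^μ (1+t/(2x))^μ dt`. Thus `J_ν` is the half-sum of two
functions `hankelLaplace (±1) ν`. By Fubini, `G` has a symmetry under `ν ↦ -ν`, so `J_{-ν}` is a
combination of the same two functions; solving for `Y_ν` identifies them with `H^{(1)}_ν` and
`H^{(2)}_ν`, and the identity theorem in `ν` and in `z` spreads this to `Re ν > -1/2` and to the
regions where the integrals converge (`sin_mul_hankelLaplace`, `besselY_eq`). The Laplace integral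
is easy to estimate at infinity and at `0`, uniformly in cones avoiding the negative axis. For
`H^{(2)}` near the positive imaginary axis it gives nothing uniform; that gap is closed by the
half-turn formulas on the left and by the Phragmén–Lindelöf principle in a right-angled sector
(`exists_norm_hankelRatio2_sub_one_le_upper`).

Existence. The candidate satisfies `M(-η) = W M(η) W⁻¹` for a constant matrix `W`
(`solution_eq_conjW`), so only `Ω₁`, `Ω₂`, `Γ₁`, `Γ₂` need work. Across `Γ₁` the matrix is one
analytic function times a constant. Across `Γ₂` the half-turn formulas produce the triangular factor
with entry `2 sin πα` (`conjW_principalM_neg`), and `s₁ + s₃ = -2 sin πα` makes it the required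
jump. At infinity the Hankel phases cancel against the constant factors. At the origin the constant
in the normalisation is the one for which `H^{(1)}` and `H^{(2)}` add up to `2 J` in the second
column, which is smaller by `|η|^{2α}`.

Uniqueness. For two solutions, `M · adj S` has no jumps because all jump matrices have determinant
`1`, so it is holomorphic away from `0`; it has at most a pole there, and boundedness in `Ω₂`
excludes the pole. Liouville's theorem gives `M · adj S = 1`, also for `M = S`, hence `M = S`
(`eq_of_tendsto_of_no_jump`, `IsSolution.mul_adjugate_eq_one`).

Logarithmic case. When `α - 1/2 = n` the orders are the integers `n` and `n + 1`; differentiating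
`sin(νπ) Y_ν = J_ν cos(νπ) - J_{-ν}` in the order exhibits the logarithm in `Y` with its coefficient
(`exists_besselY_natCast_eq`). -/

open MeasureTheory

namespace ModelRH

noncomputable section

/-! ### Holomorphy criteria -/

/-- An integral depending holomorphically on a parameter, with a locally uniform integrable
bound, is holomorphic in the parameter. -/
theorem differentiableOn_integral_of_dominated {X : Type*} [MeasurableSpace X] {m : Measure X}
    {F : ℂ → X → ℂ} {U : Set ℂ} (hU : IsOpen U)
    (hmeas : ∀ p ∈ U, AEStronglyMeasurable (F p) m)
    (hdiff : ∀ᵐ t ∂m, DifferentiableOn ℂ (fun p => F p t) U)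
    (hbound : ∀ p₀ ∈ U, ∃ r > 0, ∃ b : X → ℝ, Integrable b m ∧
      ∀ᵐ t ∂m, ∀ p ∈ Metric.ball p₀ r, ‖F p t‖ ≤ b t) :
    DifferentiableOn ℂ (fun p => ∫ t, F p t ∂m) U := by
  intro p₀ hp₀
  obtain ⟨r₁, hr₁, hb₁⟩ := Metric.isOpen_iff.1 hU p₀ hp₀
  obtain ⟨r₂, hr₂, b, hb, hFb⟩ := hbound p₀ hp₀
  set r := min r₁ r₂ with hr
  have hrpos : 0 < r := lt_min hr₁ hr₂
  have hsub : Metric.ball p₀ r ⊆ U := (Metric.ball_subset_ball (min_le_left _ _)).trans hb₁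
  have hsub₂ : Metric.ball p₀ r ⊆ Metric.ball p₀ r₂ := Metric.ball_subset_ball (min_le_right _ _)
  have hderiv : ∀ᵐ t ∂m, ∀ p ∈ Metric.ball p₀ (r / 2),
      HasDerivAt (fun q => F q t) (deriv (fun q => F q t) p) p := by
    filter_upwards [hdiff] with t ht p hp
    have hpU : p ∈ U := hsub (Metric.ball_subset_ball (by linarith) hp)
    exact (ht.differentiableAt (hU.mem_nhds hpU)).hasDerivAt
  -- Measurability in `t` of the parameter derivative is not assumed: it is inherited from the
  -- difference quotients along the steps `r / (4(n+1))`, which converge to it almost everywhere.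
  have hlim : ∀ᵐ t ∂m, Tendsto (fun n : ℕ => ((r / 4 / (n + 1) : ℝ) : ℂ)⁻¹ *
      (F (p₀ + (r / 4 / (n + 1) : ℝ)) t - F p₀ t)) atTop (𝓝 (deriv (fun q => F q t) p₀)) := by
    filter_upwards [hderiv] with t ht
    have h1 := (ht p₀ (Metric.mem_ball_self (by positivity))).tendsto_slope_zero
    have h2 : Tendsto (fun n : ℕ => ((r / 4 / (n + 1) : ℝ) : ℂ)) atTop (𝓝[≠] 0) := by
      rw [tendsto_nhdsWithin_iff]
      constructor
      · have h3 := (tendsto_one_div_add_atTop_nhds_zero_nat (𝕜 := ℝ)).const_mul (r / 4)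
        simp only [mul_zero, mul_one_div] at h3
        exact_mod_cast (Complex.continuous_ofReal.tendsto 0).comp h3
      · refine Eventually.of_forall fun n => ?_
        have : (r / 4 / (n + 1) : ℝ) ≠ 0 := by positivity
        simpa only [mem_compl_iff, mem_singleton_iff, Complex.ofReal_eq_zero] using this
    simpa [Function.comp_def, smul_eq_mul] using h1.comp h2
  have hmeas' : AEStronglyMeasurable (fun t => deriv (fun q => F q t) p₀) m := by
    refine aestronglyMeasurable_of_tendsto_ae atTop (fun n => ?_) hlim
    have hn : (p₀ + ((r / 4 / (n + 1) : ℝ) : ℂ)) ∈ U := by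
      apply hsub
      rw [Metric.mem_ball, dist_self_add_left, Complex.norm_real, Real.norm_of_nonneg (by positivity)]
      have : r / 4 / ((n : ℝ) + 1) ≤ r / 4 := div_le_self (by positivity) (by linarith [n.cast_nonneg (α := ℝ)])
      linarith
    exact ((hmeas _ hn).sub (hmeas _ hp₀)).const_mul _
  have hint : Integrable (F p₀) m := by
    refine hb.mono' (hmeas _ hp₀) ?_
    filter_upwards [hFb] with t ht using ht _ (Metric.mem_ball_self hr₂)
  have key := hasDerivAt_integral_of_dominated_loc_of_deriv_le (μ := m) (F := F)
    (F' := fun p t => deriv (fun q => F q t) p) (x₀ := p₀) (s := Metric.ball p₀ (r / 2))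
    (bound := fun t => b t / (r / 4))
    (Metric.ball_mem_nhds _ (by positivity))
    (by filter_upwards [hU.mem_nhds hp₀] with p hp using hmeas p hp) hint hmeas'
    (by
      -- Cauchy's estimate on the disc of radius `r/4` about `p`; as `p` is within `r/2` of `p₀`,
      -- that disc stays where `b` dominates.
      filter_upwards [hFb, hdiff] with t ht htd p hp
      have hcb : Metric.closedBall p (r / 4) ⊆ Metric.ball p₀ r := fun x hx => by
        rw [Metric.mem_closedBall] at hx
        rw [Metric.mem_ball] at hp ⊢
        linarith [dist_triangle x p p₀]
      refine Complex.norm_deriv_le_of_forall_mem_sphere_norm_le (by positivity) ?_ fun z hz =>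
        ht z (hsub₂ (hcb (Metric.sphere_subset_closedBall hz)))
      exact (htd.mono (hcb.trans hsub)).diffContOnCl_ball subset_rfl)
    (hb.div_const _) hderiv
  exact key.2.differentiableAt.differentiableWithinAt

open Complex in
/-- A function which is continuous on a disc and holomorphic off the real axis is holomorphic. -/
theorem differentiableOn_ball_of_im_ne_zero {f : ℂ → ℂ} {c : ℂ} {r : ℝ}
    (hc : ContinuousOn f (Metric.ball c r))
    (hd : ∀ z ∈ Metric.ball c r, z.im ≠ 0 → DifferentiableAt ℂ f z) :
    DifferentiableOn ℂ f (Metric.ball c r) := by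
  refine IsExactOn.differentiableOn Metric.isOpen_ball (IsConservativeOn.isExactOn_ball hc ?_)
  intro z w hzw
  rw [← add_eq_zero_iff_eq_neg, wedgeIntegral_add_wedgeIntegral_eq]
  rw [Rectangle] at hzw
  -- Morera's theorem. Cauchy's theorem for a rectangle needs holomorphy only in its interior, so a
  -- rectangle whose interior misses the real axis causes no trouble; any other one is cut along the
  -- axis into two such.
  have aux : ∀ y₁ y₂ : ℝ, uIcc y₁ y₂ ⊆ uIcc z.im w.im → 0 ∉ Ioo (min y₁ y₂) (max y₁ y₂) →
      (∫ x : ℝ in z.re..w.re, f (x + y₁ * I)) - (∫ x : ℝ in z.re..w.re, f (x + y₂ * I)) +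
      I • (∫ y : ℝ in y₁..y₂, f (w.re + y * I)) - I • (∫ y : ℝ in y₁..y₂, f (z.re + y * I)) = 0 := by
    intro y₁ y₂ hy h0
    have hsub : uIcc z.re w.re ×ℂ uIcc y₁ y₂ ⊆ Metric.ball c r :=
      (reProdIm_subset_iff.2 (prod_mono subset_rfl hy)).trans hzw
    have := integral_boundary_rect_eq_zero_of_continuousOn_of_differentiableOn f
      (⟨z.re, y₁⟩ : ℂ) ⟨w.re, y₂⟩ (hc.mono hsub) (fun p hp => ?_)
    · exact this
    · refine (hd p (hsub ?_) fun h => h0 (h ▸ hp.2)).differentiableWithinAt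
      exact ⟨Ioo_subset_Icc_self hp.1, Ioo_subset_Icc_self hp.2⟩
  by_cases h0 : 0 ∈ Ioo (min z.im w.im) (max z.im w.im)
  · have hmem : (0 : ℝ) ∈ uIcc z.im w.im := Ioo_subset_Icc_self h0
    have hz := aux z.im 0 (uIcc_subset_uIcc left_mem_uIcc hmem) (by
      rcases le_total z.im 0 with h | h <;> simp [h])
    have hw := aux 0 w.im (uIcc_subset_uIcc hmem right_mem_uIcc) (by
      rcases le_total w.im 0 with h | h <;> simp [h])
    have hint : ∀ x ∈ uIcc z.re w.re, ∀ y₁ ∈ uIcc z.im w.im, ∀ y₂ ∈ uIcc z.im w.im,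
        IntervalIntegrable (fun y : ℝ => f (x + y * I)) volume y₁ y₂ := by
      intro x hx y₁ h₁ y₂ h₂
      refine ContinuousOn.intervalIntegrable (hc.comp (by fun_prop) fun y hy => hzw ?_)
      simpa [mem_reProdIm] using ⟨hx, uIcc_subset_uIcc h₁ h₂ hy⟩
    rw [← intervalIntegral.integral_add_adjacent_intervals
        (hint w.re right_mem_uIcc z.im left_mem_uIcc 0 hmem)
        (hint w.re right_mem_uIcc 0 hmem w.im right_mem_uIcc),
      ← intervalIntegral.integral_add_adjacent_intervals
        (hint z.re left_mem_uIcc z.im left_mem_uIcc 0 hmem)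
        (hint z.re left_mem_uIcc 0 hmem w.im right_mem_uIcc)]
    simp only [smul_eq_mul] at hz hw ⊢
    linear_combination hz + hw
  · exact aux _ _ subset_rfl h0

/-- A function which is continuous near `ζ` and holomorphic off the line through `0` and `ζ` is
holomorphic at `ζ`. -/
theorem analyticAt_of_continuous_of_off_line {f : ℂ → ℂ} {ζ : ℂ} (hζ : ζ ≠ 0) {r : ℝ} (hr : 0 < r)
    (hc : ContinuousOn f (Metric.ball ζ r))
    (hd : ∀ z ∈ Metric.ball ζ r, (z / ζ).im ≠ 0 → DifferentiableAt ℂ f z) :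
    AnalyticAt ℂ f ζ := by
  have hζn : 0 < ‖ζ‖ := norm_pos_iff.2 hζ
  have hmem : ∀ w ∈ Metric.ball (1 : ℂ) (r / ‖ζ‖), ζ * w ∈ Metric.ball ζ r := fun w hw => by
    rw [Metric.mem_ball, dist_eq_norm] at hw ⊢
    rw [show ζ * w - ζ = ζ * (w - 1) by ring, norm_mul, mul_comm]
    exact (lt_div_iff₀ hζn).1 hw
  have h : DifferentiableOn ℂ (fun w => f (ζ * w)) (Metric.ball 1 (r / ‖ζ‖)) := by
    refine differentiableOn_ball_of_im_ne_zero (hc.comp (by fun_prop) hmem) fun w hw him => ?_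
    have h1 : DifferentiableAt ℂ f (ζ * w) :=
      hd _ (hmem w hw) (by rwa [mul_div_cancel_left₀ _ hζ])
    exact DifferentiableAt.comp w h1 (by fun_prop)
  have h2 : AnalyticAt ℂ (fun w => f (ζ * w)) (ζ / ζ) := by
    rw [div_self hζ]
    exact h.analyticAt (Metric.ball_mem_nhds _ (by positivity))
  have h3 := h2.comp (f := fun z => z / ζ) (by fun_prop (disch := assumption))
  refine h3.congr (Eventually.of_forall fun z => ?_)
  simp only [Function.comp_apply]
  rw [mul_div_cancel₀ _ hζ]

/-! ### The power series of the Bessel function -/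

/-- The entire factor of `J_μ(z) = (z/2)^μ E_μ(z)`. -/
def besselE (μ z : ℂ) : ℂ :=
  ∑' k : ℕ, (-1) ^ k * (z ^ 2 / 4) ^ k / ((k.factorial : ℂ) * Complex.Gamma (μ + k + 1))

theorem besselJ_eq (μ z : ℂ) : besselJ μ z = (z / 2) ^ μ * besselE μ z := rfl

/-- `1/Γ` is entire, hence bounded on a compact set, which handles `k ≤ k₀`. For `k ≥ k₀ ≥ R` one
has `|μ+k+1| ≥ 1`, so the functional equation can only decrease `1/Γ`. This gives a majorant of the
Bessel series that is uniform in the order. -/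
theorem exists_norm_inv_Gamma_le (R : ℝ) : ∃ C > 0, ∀ μ : ℂ, ‖μ‖ ≤ R → ∀ k : ℕ,
    ‖(Complex.Gamma (μ + k + 1))⁻¹‖ ≤ C := by
  obtain ⟨k₀, hk₀⟩ := exists_nat_ge R
  obtain ⟨C, hC⟩ := (isCompact_closedBall (0 : ℂ) (R + k₀ + 1)).exists_bound_of_continuousOn
    Complex.differentiable_one_div_Gamma.continuous.continuousOn
  have hsmall : ∀ μ : ℂ, ‖μ‖ ≤ R → ∀ k : ℕ, k ≤ k₀ → ‖(Complex.Gamma (μ + k + 1))⁻¹‖ ≤ C := by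
    intro μ hμ k hk
    refine hC _ ?_
    rw [mem_closedBall_zero_iff]
    have hk' : (k : ℝ) ≤ k₀ := by exact_mod_cast hk
    calc ‖μ + k + 1‖ ≤ ‖μ‖ + ‖(k : ℂ)‖ + ‖(1 : ℂ)‖ := norm_add₃_le
      _ ≤ R + k₀ + 1 := by rw [Complex.norm_natCast, norm_one]; linarith
  refine ⟨max C 1, by positivity, fun μ hμ k => le_max_of_le_left ?_⟩
  rcases le_total k k₀ with hk | hk
  · exact hsmall μ hμ k hk
  · induction k, hk using Nat.le_induction with
    | base => exact hsmall μ hμ k₀ le_rfl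
    | succ k hk ih =>
      have h1 : 1 ≤ ‖μ + k + 1‖ := by
        have h2 : ‖((k : ℂ) + 1)‖ ≤ ‖μ + k + 1‖ + ‖μ‖ := by
          calc ‖((k : ℂ) + 1)‖ = ‖(μ + k + 1) - μ‖ := by ring_nf
            _ ≤ _ := norm_sub_le _ _
        have h3 : ‖((k : ℂ) + 1)‖ = k + 1 := by
          rw [← Nat.cast_add_one, Complex.norm_natCast]; push_cast; ring
        have hk' : (k₀ : ℝ) ≤ k := by exact_mod_cast hk
        linarith
      have h0 : μ + k + 1 ≠ 0 := fun h => by rw [h, norm_zero] at h1; linarith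
      rw [show μ + ((k + 1 : ℕ) : ℂ) + 1 = (μ + k + 1) + 1 by push_cast; ring,
        Complex.Gamma_add_one _ h0, mul_inv, norm_mul, norm_inv]
      calc _ ≤ 1 * ‖(Complex.Gamma (μ + k + 1))⁻¹‖ := by
            gcongr; exact inv_le_one_of_one_le₀ h1
        _ ≤ C := by rw [one_mul]; exact ih

theorem norm_besselE_term_le {μ z : ℂ} {C Z : ℝ} {k : ℕ}
    (hC : ‖(Complex.Gamma (μ + k + 1))⁻¹‖ ≤ C) (hz : ‖z‖ ≤ Z) :
    ‖(-1) ^ k * (z ^ 2 / 4) ^ k / ((k.factorial : ℂ) * Complex.Gamma (μ + k + 1))‖ ≤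
      C * ((Z ^ 2 / 4) ^ k / k.factorial) := by
  have h : (-1) ^ k * (z ^ 2 / 4) ^ k / ((k.factorial : ℂ) * Complex.Gamma (μ + k + 1)) =
    (Complex.Gamma (μ + k + 1))⁻¹ * ((-1) ^ k * (z ^ 2 / 4) ^ k / (k.factorial : ℂ)) := by
    rw [div_mul_eq_div_div, div_eq_mul_inv _ (Complex.Gamma _), mul_comm]
  rw [h, norm_mul]
  have h0 : 0 ≤ C := (norm_nonneg _).trans hC
  simp only [norm_mul, norm_div, norm_pow, norm_neg, norm_one, one_pow, one_mul,
    Complex.norm_natCast, Complex.norm_ofNat]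
  gcongr

theorem differentiable_besselE_order (z : ℂ) : Differentiable ℂ (fun μ => besselE μ z) := by
  intro μ₀
  obtain ⟨C, -, hC⟩ := exists_norm_inv_Gamma_le (‖μ₀‖ + 1)
  have hmem : ∀ μ ∈ Metric.ball (0 : ℂ) (‖μ₀‖ + 1), ‖μ‖ ≤ ‖μ₀‖ + 1 := fun μ hμ =>
    (mem_ball_zero_iff.1 hμ).le
  have h := Complex.differentiableOn_tsum_of_summable_norm
    (F := fun (k : ℕ) μ => (-1) ^ k * (z ^ 2 / 4) ^ k / ((k.factorial : ℂ) * Complex.Gamma (μ + k + 1)))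
    (U := Metric.ball 0 (‖μ₀‖ + 1))
    ((Real.summable_pow_div_factorial (‖z‖ ^ 2 / 4)).mul_left C)
    (fun k => ?_) Metric.isOpen_ball
    (fun k μ hμ => norm_besselE_term_le (hC μ (hmem μ hμ) k) le_rfl)
  · exact h.differentiableAt (Metric.isOpen_ball.mem_nhds (by simp))
  · simp only [div_mul_eq_div_div, div_eq_mul_inv _ (Complex.Gamma _)]
    exact ((Complex.differentiable_one_div_Gamma.comp
      (by fun_prop : Differentiable ℂ fun μ : ℂ => μ + k + 1)).const_mul _).differentiableOn

theorem differentiable_besselE (μ : ℂ) : Differentiable ℂ (besselE μ) := by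
  intro z₀
  obtain ⟨C, -, hC⟩ := exists_norm_inv_Gamma_le ‖μ‖
  have h := Complex.differentiableOn_tsum_of_summable_norm
    (F := fun (k : ℕ) z => (-1) ^ k * (z ^ 2 / 4) ^ k / ((k.factorial : ℂ) * Complex.Gamma (μ + k + 1)))
    (U := Metric.ball 0 (‖z₀‖ + 1))
    ((Real.summable_pow_div_factorial ((‖z₀‖ + 1) ^ 2 / 4)).mul_left C)
    (fun k => by fun_prop) Metric.isOpen_ball
    (fun k z hz => norm_besselE_term_le (hC μ le_rfl k) (mem_ball_zero_iff.1 hz).le)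
  exact h.differentiableAt (Metric.isOpen_ball.mem_nhds (by simp))

theorem besselE_zero (μ : ℂ) : besselE μ 0 = (Complex.Gamma (μ + 1))⁻¹ := by
  rw [besselE, tsum_eq_single 0]
  · simp
  · intro k hk
    simp [hk]

theorem besselE_neg (μ z : ℂ) : besselE μ (-z) = besselE μ z := by
  simp [besselE]

/-- The order derivative of `E_μ(z)` is entire in `z`. -/
theorem differentiable_deriv_besselE (μ : ℂ) :
    Differentiable ℂ (fun z => deriv (fun ν => besselE ν z) μ) := by
  obtain ⟨C, -, hC⟩ := exists_norm_inv_Gamma_le (‖μ‖ + 1)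
  have hmem : ∀ ν ∈ Metric.ball (0 : ℂ) (‖μ‖ + 1), ‖ν‖ ≤ ‖μ‖ + 1 := fun μ hμ =>
    (mem_ball_zero_iff.1 hμ).le
  have hterm : ∀ (k : ℕ) (z ν : ℂ),
      (-1) ^ k * (z ^ 2 / 4) ^ k / ((k.factorial : ℂ) * Complex.Gamma (ν + k + 1)) =
      ((-1) ^ k * (z ^ 2 / 4) ^ k / (k.factorial : ℂ)) * (Complex.Gamma (ν + k + 1))⁻¹ := by
    intro k z ν
    rw [div_mul_eq_div_div, div_eq_mul_inv _ (Complex.Gamma _)]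
  have hdiff : ∀ k : ℕ, Differentiable ℂ (fun ν : ℂ => (Complex.Gamma (ν + k + 1))⁻¹) := fun k =>
    Complex.differentiable_one_div_Gamma.comp
      (by fun_prop : Differentiable ℂ fun μ : ℂ => μ + k + 1)
  have hsum : ∀ z : ℂ, HasSum (fun k : ℕ => ((-1) ^ k * (z ^ 2 / 4) ^ k / (k.factorial : ℂ)) *
      deriv (fun ν : ℂ => (Complex.Gamma (ν + k + 1))⁻¹) μ)
      (deriv (fun ν => besselE ν z) μ) := by
    intro z
    have h := Complex.hasSum_deriv_of_summable_norm
      (F := fun (k : ℕ) ν => (-1) ^ k * (z ^ 2 / 4) ^ k / ((k.factorial : ℂ) * Complex.Gamma (ν + k + 1)))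
      (U := Metric.ball 0 (‖μ‖ + 1)) (z := μ)
      ((Real.summable_pow_div_factorial (‖z‖ ^ 2 / 4)).mul_left C)
      (fun k => ?_) Metric.isOpen_ball
      (fun k μ hμ => norm_besselE_term_le (hC μ (hmem μ hμ) k) le_rfl) (by simp)
    · have hfun : (fun k : ℕ => ((-1) ^ k * (z ^ 2 / 4) ^ k / (k.factorial : ℂ)) *
          deriv (fun ν : ℂ => (Complex.Gamma (ν + k + 1))⁻¹) μ) = fun k : ℕ => deriv (fun ν : ℂ =>
          (-1) ^ k * (z ^ 2 / 4) ^ k / ((k.factorial : ℂ) * Complex.Gamma (ν + k + 1))) μ := by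
        funext k
        simp only [hterm]
        rw [deriv_const_mul _ (hdiff k μ)]
      rw [hfun]
      exact h
    · simp only [hterm]
      exact ((hdiff k).const_mul _).differentiableOn
  intro z₀
  -- At the real point `‖z₀‖ + 1` the terms have the largest modulus over the disc, so absolute
  -- convergence there is the required majorant.
  have hs := (hsum ((‖z₀‖ + 1 : ℝ) : ℂ)).summable.norm
  have h := Complex.differentiableOn_tsum_of_summable_norm
    (F := fun (k : ℕ) z => ((-1) ^ k * (z ^ 2 / 4) ^ k / (k.factorial : ℂ)) *
      deriv (fun ν : ℂ => (Complex.Gamma (ν + k + 1))⁻¹) μ)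
    (U := Metric.ball 0 (‖z₀‖ + 1)) hs (fun k => by fun_prop) Metric.isOpen_ball
    (fun k z hz => by
      have hz' := (mem_ball_zero_iff.1 hz).le
      simp only [norm_mul, norm_div, norm_pow, norm_neg, norm_one, one_pow, one_mul,
        Complex.norm_natCast, Complex.norm_ofNat, Complex.norm_real, Real.norm_eq_abs]
      gcongr
      exact hz'.trans (le_abs_self _))
  simp only [(hsum _).tsum_eq] at h
  exact h.differentiableAt (Metric.isOpen_ball.mem_nhds (by simp))

/-- For `ν ≥ -1/2` each step of the Gamma recursion multiplies by `ν+k+1 ≥ (k+1)/2`, so `Γ(ν+k+1) ≥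
Γ(ν+1) k!/2^k`. The `k`-th term is then at most a constant times `(|z|^k/k!)²`; one factor is
bounded by `e^{|z|}` and the other sums to `e^{|z|}`. The bound serves both at the origin and as the
crude growth bound for Phragmén–Lindelöf. -/
theorem exists_norm_besselE_le {ν : ℝ} (hν : -(1 / 2) ≤ ν) :
    ∃ C > 0, ∀ z : ℂ, ‖besselE ν z‖ ≤ C * Real.exp (2 * ‖z‖) := by
  have hG : ∀ k : ℕ, Real.Gamma (ν + 1) * (k.factorial / 2 ^ k) ≤ Real.Gamma (ν + k + 1) := by
    intro k
    induction k with
    | zero => simp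
    | succ k ih =>
      have h0 : 0 < ν + k + 1 := by have : (0 : ℝ) ≤ k := k.cast_nonneg; linarith
      rw [show ν + ((k + 1 : ℕ) : ℝ) + 1 = (ν + k + 1) + 1 by push_cast; ring,
        Real.Gamma_add_one h0.ne', Nat.factorial_succ, pow_succ]
      have h1 : ((k : ℝ) + 1) / 2 ≤ ν + k + 1 := by
        have : (0 : ℝ) ≤ k := k.cast_nonneg
        linarith
      calc Real.Gamma (ν + 1) * ((((k + 1) * k.factorial : ℕ) : ℝ) / (2 ^ k * 2))
          = ((k : ℝ) + 1) / 2 * (Real.Gamma (ν + 1) * (k.factorial / 2 ^ k)) := by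
            push_cast; field_simp
        _ ≤ (ν + k + 1) * Real.Gamma (ν + k + 1) := by
            gcongr
            have := Real.Gamma_pos_of_pos (show 0 < ν + 1 by linarith)
            positivity
  have hG1 := Real.Gamma_pos_of_pos (show 0 < ν + 1 by linarith)
  refine ⟨(Real.Gamma (ν + 1))⁻¹, by positivity, fun z => ?_⟩
  have hx := Real.summable_pow_div_factorial ‖z‖
  have hxsum : ∑' k : ℕ, ‖z‖ ^ k / k.factorial = Real.exp ‖z‖ := by
    rw [Real.exp_eq_exp_ℝ, NormedSpace.exp_eq_tsum_div]
  have hbd : ∀ k : ℕ,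
      ‖(-1) ^ k * (z ^ 2 / 4) ^ k / ((k.factorial : ℂ) * Complex.Gamma ((ν : ℂ) + k + 1))‖ ≤
      (Real.Gamma (ν + 1))⁻¹ * (Real.exp ‖z‖ * (‖z‖ ^ k / k.factorial)) := by
    intro k
    have h1 : ‖z‖ ^ k / k.factorial ≤ Real.exp ‖z‖ := by
      rw [← hxsum]
      exact hx.le_tsum k fun j _ => by positivity
    have h2 : ‖Complex.Gamma ((ν : ℂ) + k + 1)‖ = Real.Gamma (ν + k + 1) := by
      rw [show (ν : ℂ) + k + 1 = ((ν + k + 1 : ℝ) : ℂ) by push_cast; ring, Complex.Gamma_ofReal,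
        Complex.norm_real, Real.norm_of_nonneg]
      exact (by positivity : (0:ℝ) ≤ Real.Gamma (ν + 1) * (k.factorial / 2 ^ k)).trans (hG k)
    simp only [norm_mul, norm_div, norm_pow, norm_neg, norm_one, one_pow, one_mul,
        Complex.norm_natCast, Complex.norm_ofNat, h2]
    calc (‖z‖ ^ 2 / 4) ^ k / (k.factorial * Real.Gamma (ν + k + 1))
        ≤ (‖z‖ ^ 2 / 2) ^ k / (k.factorial * (Real.Gamma (ν + 1) * (k.factorial / 2 ^ k))) := by
          gcongr
          · norm_num
          · exact hG k
      _ = (Real.Gamma (ν + 1))⁻¹ * (‖z‖ ^ k / k.factorial * (‖z‖ ^ k / k.factorial)) := by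
          rw [div_pow, ← pow_mul, mul_comm 2 k, pow_mul]; field_simp
      _ ≤ _ := by gcongr
  refine (tsum_of_norm_bounded ((hx.hasSum.mul_left _).mul_left _) hbd).trans ?_
  rw [hxsum, ← Real.exp_add, two_mul]

/-! ### Estimates in a cone around the positive axis -/

/-- The closed cone `Re w ≥ -κ |w|`. -/
def InCone (κ : ℝ) (w : ℂ) : Prop := -κ * ‖w‖ ≤ w.re

theorem InCone.ofReal_mul {κ : ℝ} {w : ℂ} (hw : InCone κ w) {s : ℝ} (hs : 0 ≤ s) :
    InCone κ (s * w) := by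
  unfold InCone at *
  rw [norm_mul, Complex.norm_real, Real.norm_of_nonneg hs, Complex.re_ofReal_mul]
  nlinarith

theorem InCone.inv {κ : ℝ} {w : ℂ} (hw : InCone κ w) : InCone κ w⁻¹ := by
  unfold InCone at *
  rcases eq_or_ne w 0 with rfl | h0
  · simp
  have hn : 0 < ‖w‖ := norm_pos_iff.2 h0
  rw [norm_inv, Complex.inv_re, Complex.normSq_eq_norm_sq, le_div_iff₀ (by positivity)]
  calc -κ * ‖w‖⁻¹ * ‖w‖ ^ 2 = -κ * ‖w‖ := by field_simp
    _ ≤ w.re := hw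

theorem InCone.div {κ : ℝ} {x : ℂ} (hx : InCone κ x) {t : ℝ} (ht : 0 ≤ t) :
    InCone κ (t / (2 * x)) := by
  have h := hx.inv.ofReal_mul (s := t / 2) (by positivity)
  convert h using 1
  push_cast
  rw [div_mul_eq_div_div, div_eq_mul_inv _ x]

theorem InCone.one_add_mem_slitPlane {κ : ℝ} (hκ : κ < 1) {w : ℂ} (hw : InCone κ w) :
    1 + w ∈ Complex.slitPlane := by
  unfold InCone at hw
  rw [Complex.mem_slitPlane_iff]
  by_cases him : w.im = 0
  · left
    have hn : ‖w‖ = |w.re| := by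
      conv_lhs => rw [← Complex.re_add_im w, him]
      simp
    rw [hn] at hw
    rw [Complex.add_re, Complex.one_re]
    rcases le_or_gt 0 w.re with h | h
    · linarith
    · rw [abs_of_neg h] at hw
      nlinarith
  · right
    simpa using him

/-- `|1+w|² ≥ 1 - 2κ|w| + |w|² = (|w|-κ)² + 1 - κ²`, and `1 - κ² ≥ (1-κ)²`. -/
theorem InCone.le_norm_one_add {κ : ℝ} (h0 : 0 ≤ κ) (hκ : κ < 1) {w : ℂ} (hw : InCone κ w) :
    1 - κ ≤ ‖1 + w‖ := by
  unfold InCone at hw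
  refine le_of_sq_le_sq ?_ (norm_nonneg _)
  have h1 : ‖1 + w‖ ^ 2 = 1 + 2 * w.re + ‖w‖ ^ 2 := by
    rw [← Complex.normSq_eq_norm_sq, ← Complex.normSq_eq_norm_sq, Complex.normSq_apply,
      Complex.normSq_apply]
    simp
    ring
  rw [h1]
  nlinarith [sq_nonneg (‖w‖ - κ)]

/-- The triangle inequality settles nonnegative exponents, the lower bound `1-κ` negative ones. A
single polynomial majorant with integer exponent serves for both signs and is easy to integrate
against `e^{-t} t^a`. -/
theorem InCone.norm_one_add_rpow_le {κ : ℝ} (h0 : 0 ≤ κ) (hκ : κ < 1) {w : ℂ} (hw : InCone κ w)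
    {s : ℝ} {N : ℕ} (hs : |s| ≤ N) :
    ‖1 + w‖ ^ s ≤ ((1 - κ)⁻¹) ^ N * (1 + ‖w‖) ^ N := by
  have hc := hw.le_norm_one_add h0 hκ
  have hc0 : 0 < 1 - κ := by linarith
  have hw1 : (1 : ℝ) ≤ 1 + ‖w‖ := by linarith [norm_nonneg w]
  have hi1 : 1 ≤ (1 - κ)⁻¹ := (one_le_inv₀ hc0).2 (by linarith)
  rw [abs_le] at hs
  rcases le_total 0 s with h | h
  · calc ‖1 + w‖ ^ s ≤ (1 + ‖w‖) ^ s := by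
          gcongr
          simpa using norm_add_le (1 : ℂ) w
      _ ≤ (1 + ‖w‖) ^ (N : ℝ) := Real.rpow_le_rpow_of_exponent_le hw1 hs.2
      _ = 1 * (1 + ‖w‖) ^ N := by rw [Real.rpow_natCast, one_mul]
      _ ≤ _ := by gcongr; exact one_le_pow₀ hi1
  · calc ‖1 + w‖ ^ s ≤ (1 - κ) ^ s := Real.rpow_le_rpow_of_nonpos hc0 hc h
      _ = ((1 - κ)⁻¹) ^ (-s) := by rw [Real.inv_rpow hc0.le, Real.rpow_neg hc0.le, inv_inv]
      _ ≤ ((1 - κ)⁻¹) ^ (N : ℝ) := Real.rpow_le_rpow_of_exponent_le hi1 (by linarith)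
      _ = ((1 - κ)⁻¹) ^ N * 1 := by rw [Real.rpow_natCast, mul_one]
      _ ≤ _ := by gcongr; exact one_le_pow₀ hw1

theorem norm_cpow_le_rpow_mul_exp {z : ℂ} (μ : ℂ) :
    ‖z ^ μ‖ ≤ ‖z‖ ^ μ.re * Real.exp (Real.pi * |μ.im|) := by
  refine (Complex.norm_cpow_le z μ).trans ?_
  rw [div_eq_mul_inv, ← Real.exp_neg]
  gcongr
  calc -(z.arg * μ.im) ≤ |z.arg * μ.im| := neg_le_abs _
    _ = |z.arg| * |μ.im| := abs_mul _ _
    _ ≤ Real.pi * |μ.im| := by gcongr; exact Complex.abs_arg_le_pi z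

/-- The cones with `κ < 1` exclude only neighbourhoods of the negative direction, so they exhaust
the slit plane; bounds uniform in a cone thereby become locally uniform bounds on the slit plane. -/
theorem exists_inCone_nhds {x : ℂ} (hx : x ∈ Complex.slitPlane) :
    ∃ κ, 0 ≤ κ ∧ κ < 1 ∧ ∃ δ > 0, ∃ r > 0, ∀ y ∈ Metric.ball x r, InCone κ y ∧ δ ≤ ‖y‖ := by
  have hx0 : 0 < ‖x‖ := norm_pos_iff.2 (Complex.slitPlane_ne_zero hx)
  have h1 : -‖x‖ < x.re := by
    refine lt_of_le_of_ne (neg_le_of_abs_le (Complex.abs_re_le_norm x)) fun h => ?_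
    rw [Complex.mem_slitPlane_iff] at hx
    rcases hx with hx | hx
    · linarith
    · have := Complex.sq_norm_sub_sq_re x
      rw [← h] at this
      apply hx
      nlinarith
  obtain ⟨κ, hκ₁, hκ₂⟩ : ∃ κ, max 0 (-x.re / ‖x‖) < κ ∧ κ < 1 := by
    apply exists_between
    rw [max_lt_iff]
    exact ⟨one_pos, by rw [div_lt_one hx0]; linarith⟩
  rw [max_lt_iff, div_lt_iff₀ hx0] at hκ₁
  have hev : ∀ᶠ y in 𝓝 x, -κ * ‖y‖ < y.re ∧ ‖x‖ / 2 < ‖y‖ := by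
    refine (ContinuousAt.eventually_lt (by fun_prop) (by fun_prop) (by linarith)).and
      (ContinuousAt.eventually_lt (by fun_prop) (by fun_prop) (by linarith))
  obtain ⟨r, hr, hball⟩ := Metric.eventually_nhds_iff_ball.1 hev
  exact ⟨κ, hκ₁.1.le, hκ₂, ‖x‖ / 2, by positivity, r, hr, fun y hy =>
    ⟨(hball y hy).1.le, (hball y hy).2.le⟩⟩

/-! ### The Laplace-type integral -/

/-- The integrand of `laplaceG`. -/
def laplaceKernel (μ x : ℂ) (t : ℝ) : ℂ :=
  Complex.exp (-t) * (t : ℂ) ^ μ * (1 + t / (2 * x)) ^ μ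

/-- `G_μ(x) = ∫₀^∞ e^{-t} t^μ (1 + t/(2x))^μ dt`. -/
def laplaceG (μ x : ℂ) : ℂ := ∫ t in Ioi (0 : ℝ), laplaceKernel μ x t

theorem integrableOn_exp_mul_rpow_mul_pow {a : ℝ} (ha : -1 < a) (C : ℝ) (N : ℕ) :
    IntegrableOn (fun t : ℝ => Real.exp (-t) * t ^ a * (1 + C * t) ^ N) (Ioi 0) := by
  induction N generalizing a with
  | zero => simpa using Real.GammaIntegral_convergent (s := a + 1) (by linarith)
  | succ N ih =>
    refine ((ih ha).add ((ih (a := a + 1) (by linarith)).const_mul C)).congr_fun ?_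
      measurableSet_Ioi
    intro t ht
    simp only [Pi.add_apply]
    rw [Real.rpow_add_one (ne_of_gt ht)]
    ring

/-- The sum `t^a + t^b` dominates `t^{Re μ}` for every `Re μ` in `[a, b]`. The case `a = b = Re μ`
is used when `x` varies, a genuine interval when the order varies. -/
theorem norm_laplaceKernel_le {μ x : ℂ} {κ δ a b B : ℝ} {N : ℕ} (h0 : 0 ≤ κ) (hκ : κ < 1)
    (hx : InCone κ x) (hδ : 0 < δ) (hδx : δ ≤ ‖x‖) (ha : a ≤ μ.re) (hb : μ.re ≤ b)
    (hB : |μ.im| ≤ B) (hN : |μ.re| ≤ N) {t : ℝ} (ht : 0 < t) :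
    ‖laplaceKernel μ x t‖ ≤ Real.exp (Real.pi * B) * ((1 - κ)⁻¹) ^ N *
      (Real.exp (-t) * t ^ a * (1 + (2 * δ)⁻¹ * t) ^ N +
        Real.exp (-t) * t ^ b * (1 + (2 * δ)⁻¹ * t) ^ N) := by
  have h1 : ‖Complex.exp (-t)‖ = Real.exp (-t) := by
    rw [← Complex.ofReal_neg, Complex.norm_exp_ofReal]
  have h2 : ‖(t : ℂ) ^ μ‖ = t ^ μ.re := Complex.norm_cpow_eq_rpow_re_of_pos ht _
  have h3 : t ^ μ.re ≤ t ^ a + t ^ b := by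
    have hpa : 0 < t ^ a := Real.rpow_pos_of_pos ht _
    have hpb : 0 < t ^ b := Real.rpow_pos_of_pos ht _
    rcases le_total t 1 with h | h
    · have := Real.rpow_le_rpow_of_exponent_ge ht h ha
      linarith
    · have := Real.rpow_le_rpow_of_exponent_le h hb
      linarith
  have hw := hx.div ht.le
  have hwn : ‖(t : ℂ) / (2 * x)‖ ≤ (2 * δ)⁻¹ * t := by
    rw [norm_div, norm_mul, Complex.norm_real, Real.norm_of_nonneg ht.le, Complex.norm_ofNat,
      div_eq_inv_mul]
    gcongr
  have h1κ : 0 < 1 - κ := by linarith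
  have h4 : ‖(1 + (t : ℂ) / (2 * x)) ^ μ‖ ≤
      (((1 - κ)⁻¹) ^ N * (1 + (2 * δ)⁻¹ * t) ^ N) * Real.exp (Real.pi * B) := by
    refine (norm_cpow_le_rpow_mul_exp μ).trans ?_
    gcongr
    refine (hw.norm_one_add_rpow_le h0 hκ hN).trans ?_
    gcongr
  rw [laplaceKernel, norm_mul, norm_mul, h1, h2]
  calc Real.exp (-t) * t ^ μ.re * ‖(1 + (t : ℂ) / (2 * x)) ^ μ‖
      ≤ Real.exp (-t) * (t ^ a + t ^ b) *
        ((((1 - κ)⁻¹) ^ N * (1 + (2 * δ)⁻¹ * t) ^ N) * Real.exp (Real.pi * B)) := by gcongr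
    _ = _ := by ring

theorem one_add_div_mem_slitPlane {x : ℂ} (hx : x ∈ Complex.slitPlane) {t : ℝ} (ht : 0 ≤ t) :
    1 + (t : ℂ) / (2 * x) ∈ Complex.slitPlane := by
  obtain ⟨κ, h0, hκ, δ, hδ, r, hr, h⟩ := exists_inCone_nhds hx
  exact ((h x (Metric.mem_ball_self hr)).1.div ht).one_add_mem_slitPlane hκ

theorem aestronglyMeasurable_laplaceKernel (μ : ℂ) {x : ℂ} (hx : x ∈ Complex.slitPlane) :
    AEStronglyMeasurable (laplaceKernel μ x) (volume.restrict (Ioi 0)) := by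
  refine ContinuousOn.aestronglyMeasurable (fun t ht => ContinuousAt.continuousWithinAt ?_)
    measurableSet_Ioi
  unfold laplaceKernel
  have h1 : (t : ℂ) ∈ Complex.slitPlane := Complex.ofReal_mem_slitPlane.2 ht
  have h2 := one_add_div_mem_slitPlane hx (le_of_lt ht)
  fun_prop (disch := assumption)

theorem integrableOn_laplaceKernel {μ x : ℂ} (hμ : -1 < μ.re) (hx : x ∈ Complex.slitPlane) :
    IntegrableOn (laplaceKernel μ x) (Ioi 0) := by
  obtain ⟨κ, h0, hκ, δ, hδ, r, hr, h⟩ := exists_inCone_nhds hx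
  obtain ⟨N, hN⟩ := exists_nat_ge |μ.re|
  refine Integrable.mono' (((integrableOn_exp_mul_rpow_mul_pow hμ (2 * δ)⁻¹ N).add
    (integrableOn_exp_mul_rpow_mul_pow hμ (2 * δ)⁻¹ N)).const_mul
    (Real.exp (Real.pi * |μ.im|) * ((1 - κ)⁻¹) ^ N)) (aestronglyMeasurable_laplaceKernel μ hx) ?_
  filter_upwards [ae_restrict_mem measurableSet_Ioi] with t ht
  obtain ⟨hc, hd⟩ := h x (Metric.mem_ball_self hr)
  exact norm_laplaceKernel_le h0 hκ hc hδ hd le_rfl le_rfl le_rfl hN ht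

theorem differentiableOn_laplaceG {μ : ℂ} (hμ : -1 < μ.re) :
    DifferentiableOn ℂ (laplaceG μ) Complex.slitPlane := by
  refine differentiableOn_integral_of_dominated (F := fun x => laplaceKernel μ x)
    Complex.isOpen_slitPlane (fun x hx => aestronglyMeasurable_laplaceKernel μ hx) ?_ ?_
  · filter_upwards [ae_restrict_mem measurableSet_Ioi] with t ht x hx
    have h2 := one_add_div_mem_slitPlane hx (le_of_lt ht)
    have hx0 : 2 * x ≠ 0 := mul_ne_zero two_ne_zero (Complex.slitPlane_ne_zero hx)
    unfold laplaceKernel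
    refine DifferentiableAt.differentiableWithinAt ?_
    have h3 : DifferentiableAt ℂ (fun p : ℂ => 1 + (t : ℂ) / (2 * p)) x := by
      fun_prop (disch := assumption)
    exact (h3.cpow_const h2).const_mul _
  · intro x hx
    obtain ⟨κ, h0, hκ, δ, hδ, r, hr, h⟩ := exists_inCone_nhds hx
    obtain ⟨N, hN⟩ := exists_nat_ge |μ.re|
    refine ⟨r, hr, _, ((integrableOn_exp_mul_rpow_mul_pow hμ (2 * δ)⁻¹ N).add
      (integrableOn_exp_mul_rpow_mul_pow hμ (2 * δ)⁻¹ N)).const_mul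
      (Real.exp (Real.pi * |μ.im|) * ((1 - κ)⁻¹) ^ N), ?_⟩
    filter_upwards [ae_restrict_mem measurableSet_Ioi] with t ht y hy
    obtain ⟨hc, hd⟩ := h y hy
    exact norm_laplaceKernel_le h0 hκ hc hδ hd le_rfl le_rfl le_rfl hN ht

theorem isOpen_lt_re (a : ℝ) : IsOpen {μ : ℂ | a < μ.re} :=
  isOpen_lt continuous_const Complex.continuous_re

theorem differentiableOn_laplaceG_order {x : ℂ} (hx : x ∈ Complex.slitPlane) :
    DifferentiableOn ℂ (fun μ => laplaceG μ x) {μ | -1 < μ.re} := by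
  refine differentiableOn_integral_of_dominated (F := fun μ => laplaceKernel μ x)
    (isOpen_lt_re _) (fun μ hμ => aestronglyMeasurable_laplaceKernel μ hx) ?_ ?_
  · filter_upwards [ae_restrict_mem measurableSet_Ioi] with t ht μ hμ
    have h2 := Complex.slitPlane_ne_zero (one_add_div_mem_slitPlane hx (le_of_lt ht))
    have h1 : (t : ℂ) ≠ 0 := by exact_mod_cast (ne_of_gt ht)
    unfold laplaceKernel
    refine DifferentiableAt.differentiableWithinAt ?_
    exact ((differentiableAt_id.const_cpow (Or.inl h1)).const_mul _).mul
      (differentiableAt_id.const_cpow (Or.inl h2))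
  · intro μ (hμ : -1 < μ.re)
    obtain ⟨κ, h0, hκ, δ, hδ, r, hr, h⟩ := exists_inCone_nhds hx
    -- Nearby orders may have smaller real part; `a` stays strictly above `-1`, so `t^a` remains
    -- integrable at `0` and dominates all of them.
    obtain ⟨a, ha₁, ha₂⟩ := exists_between hμ
    obtain ⟨N, hN⟩ := exists_nat_ge (|μ.re| + 1)
    obtain ⟨hc, hd⟩ := h x (Metric.mem_ball_self hr)
    refine ⟨min 1 (μ.re - a), lt_min one_pos (by linarith), _,
      ((integrableOn_exp_mul_rpow_mul_pow ha₁ (2 * δ)⁻¹ N).add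
      (integrableOn_exp_mul_rpow_mul_pow (a := μ.re + 1) (by linarith) (2 * δ)⁻¹ N)).const_mul
      (Real.exp (Real.pi * (|μ.im| + 1)) * ((1 - κ)⁻¹) ^ N), ?_⟩
    filter_upwards [ae_restrict_mem measurableSet_Ioi] with t ht ν hν
    rw [Metric.mem_ball, dist_eq_norm, lt_min_iff] at hν
    have hre := Complex.abs_re_le_norm (ν - μ)
    have him := Complex.abs_im_le_norm (ν - μ)
    rw [Complex.sub_re] at hre
    rw [Complex.sub_im] at him
    have h5 := abs_le.1 hre
    refine norm_laplaceKernel_le h0 hκ hc hδ hd (by linarith) (by linarith) ?_ ?_ ht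
    · linarith [abs_sub_abs_le_abs_sub ν.im μ.im]
    · linarith [abs_sub_abs_le_abs_sub ν.re μ.re]

/-- `(1 + w)^μ = 1 + O(w)`, uniformly in a cone. -/
theorem InCone.norm_one_add_cpow_sub_one_le {κ : ℝ} (h0 : 0 ≤ κ) (hκ : κ < 1) {w : ℂ}
    (hw : InCone κ w) {μ : ℝ} {N : ℕ} (hN : |μ - 1| ≤ N) :
    ‖(1 + w) ^ (μ : ℂ) - 1‖ ≤ |μ| * (((1 - κ)⁻¹) ^ N * (1 + ‖w‖) ^ N) * ‖w‖ := by
  -- Mean value inequality along the segment from `1` to `1 + w`, which lies in the slit plane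
  -- because the cone is star-shaped about `0`.
  have hderiv : ∀ s ∈ Icc (0 : ℝ) 1, HasDerivWithinAt (fun s : ℝ => (1 + (s : ℂ) * w) ^ (μ : ℂ))
      ((μ : ℂ) * (1 + s * w) ^ ((μ : ℂ) - 1) * w) (Icc 0 1) s := by
    intro s hs
    have h1 : HasDerivAt (fun z : ℂ => 1 + z * w) w (s : ℂ) := by
      simpa using ((hasDerivAt_id (s : ℂ)).mul_const w).const_add 1
    exact (h1.cpow_const ((hw.ofReal_mul hs.1).one_add_mem_slitPlane hκ)).comp_ofReal.hasDerivWithinAt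
  have h := norm_image_sub_le_of_norm_deriv_le_segment_01'
    (C := |μ| * (((1 - κ)⁻¹) ^ N * (1 + ‖w‖) ^ N) * ‖w‖) hderiv fun s hs => by
    rw [norm_mul, norm_mul, Complex.norm_real, Real.norm_eq_abs, ← Complex.ofReal_one,
      ← Complex.ofReal_sub, Complex.norm_cpow_real, Complex.ofReal_one]
    have h1κ : 0 < 1 - κ := by linarith
    gcongr
    refine ((hw.ofReal_mul hs.1).norm_one_add_rpow_le h0 hκ hN).trans ?_
    gcongr
    rw [norm_mul, Complex.norm_real, Real.norm_of_nonneg hs.1]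
    exact mul_le_of_le_one_left (norm_nonneg _) hs.2.le
  simpa using h

theorem Gamma_add_one_eq_integral {μ : ℝ} (hμ : -1 < μ) :
    Complex.Gamma (μ + 1) = ∫ t in Ioi (0 : ℝ), Complex.exp (-t) * (t : ℂ) ^ (μ : ℂ) := by
  rw [Complex.Gamma_eq_integral (by simp; linarith), Complex.GammaIntegral]
  simp

/-- `G_μ(x) = Γ(μ+1) + O(1/x)` at infinity, uniformly in a cone. -/
theorem exists_norm_laplaceG_sub_Gamma_le {κ μ : ℝ} (h0 : 0 ≤ κ) (hκ : κ < 1) (hμ : -1 < μ) :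
    ∃ C > 0, ∀ x : ℂ, InCone κ x → 1 ≤ ‖x‖ →
      ‖laplaceG μ x - Complex.Gamma (μ + 1)‖ ≤ C / ‖x‖ := by
  obtain ⟨N, hN⟩ := exists_nat_ge |μ - 1|
  have hint := (integrableOn_exp_mul_rpow_mul_pow (a := μ + 1) (by linarith) 2⁻¹ N).const_mul
    (|μ| * ((1 - κ)⁻¹) ^ N * 2⁻¹)
  set K := ∫ t in Ioi (0 : ℝ), |μ| * ((1 - κ)⁻¹) ^ N * 2⁻¹ *
    (Real.exp (-t) * t ^ (μ + 1) * (1 + 2⁻¹ * t) ^ N) with hK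
  have h1κ : 0 < 1 - κ := by linarith
  have hK0 : 0 ≤ K := by
    refine setIntegral_nonneg measurableSet_Ioi fun t ht => ?_
    have : (0 : ℝ) < t := ht
    positivity
  refine ⟨K + 1, by positivity, fun x hx hx1 => ?_⟩
  have hxn : 0 < ‖x‖ := by linarith
  have hslit : x ∈ Complex.slitPlane := by
    rw [Complex.mem_slitPlane_iff]
    by_contra! hcon
    have hn : ‖x‖ = |x.re| := by
      conv_lhs => rw [← Complex.re_add_im x, hcon.2]
      simp
    rw [abs_of_nonpos hcon.1] at hn
    unfold InCone at hx
    nlinarith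
  have hsub : laplaceG μ x - Complex.Gamma (μ + 1) =
      ∫ t in Ioi (0 : ℝ), (laplaceKernel μ x t - Complex.exp (-t) * (t : ℂ) ^ (μ : ℂ)) := by
    rw [integral_sub, ← Gamma_add_one_eq_integral hμ, laplaceG]
    · exact integrableOn_laplaceKernel (by simpa using hμ) hslit
    · have h := Complex.GammaIntegral_convergent (s := μ + 1) (by simp; linarith)
      simp only [add_sub_cancel_right, Complex.ofReal_exp, Complex.ofReal_neg] at h
      exact h
  rw [hsub]
  have hbound : ∀ t ∈ Ioi (0 : ℝ),
      ‖laplaceKernel μ x t - Complex.exp (-t) * (t : ℂ) ^ (μ : ℂ)‖ ≤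
      (|μ| * ((1 - κ)⁻¹) ^ N * 2⁻¹ *
        (Real.exp (-t) * t ^ (μ + 1) * (1 + 2⁻¹ * t) ^ N)) * ‖x‖⁻¹ := by
    intro t ht
    have ht0 : (0 : ℝ) < t := ht
    have hw := hx.div ht0.le
    have hwn : ‖(t : ℂ) / (2 * x)‖ = 2⁻¹ * t * ‖x‖⁻¹ := by
      rw [norm_div, norm_mul, Complex.norm_real, Real.norm_of_nonneg ht0.le, Complex.norm_ofNat]
      field_simp
    have h2 := hw.norm_one_add_cpow_sub_one_le h0 hκ hN
    rw [hwn] at h2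
    have hfac : laplaceKernel μ x t - Complex.exp (-t) * (t : ℂ) ^ (μ : ℂ) =
        Complex.exp (-t) * (t : ℂ) ^ (μ : ℂ) * ((1 + t / (2 * x)) ^ (μ : ℂ) - 1) := by
      rw [laplaceKernel]; ring
    rw [hfac, norm_mul, norm_mul, Complex.norm_cpow_eq_rpow_re_of_pos ht0, Complex.ofReal_re,
      ← Complex.ofReal_neg, Complex.norm_exp_ofReal]
    -- One factor `‖x‖⁻¹` is kept outside as the rate; inside the polynomial it is discarded using
    -- `‖x‖ ≥ 1`.
    have h3 : 2⁻¹ * t * ‖x‖⁻¹ ≤ 2⁻¹ * t :=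
      mul_le_of_le_one_right (by positivity) (inv_le_one_of_one_le₀ hx1)
    calc _ ≤ Real.exp (-t) * t ^ μ * (|μ| * (((1 - κ)⁻¹) ^ N * (1 + 2⁻¹ * t * ‖x‖⁻¹) ^ N) *
          (2⁻¹ * t * ‖x‖⁻¹)) := by gcongr
      _ ≤ Real.exp (-t) * t ^ μ * (|μ| * (((1 - κ)⁻¹) ^ N * (1 + 2⁻¹ * t) ^ N) *
          (2⁻¹ * t * ‖x‖⁻¹)) := by gcongr
      _ = _ := by rw [Real.rpow_add_one ht0.ne']; ring
  refine (norm_integral_le_of_norm_le (hint.mul_const ‖x‖⁻¹)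
    ((ae_restrict_mem measurableSet_Ioi).mono hbound)).trans ?_
  rw [integral_mul_const, ← hK, ← div_eq_mul_inv]
  gcongr
  linarith

/-- `G_μ(x) = O(|x|^{-max(μ,0)})` at the origin, uniformly in a cone. -/
theorem exists_norm_laplaceG_le {κ μ : ℝ} (h0 : 0 ≤ κ) (hκ : κ < 1) (hμ : -1 < μ) :
    ∃ C > 0, ∀ x : ℂ, InCone κ x → x ≠ 0 → ‖x‖ ≤ 1 →
      ‖laplaceG μ x‖ ≤ C * ‖x‖ ^ (-max μ 0) := by
  obtain ⟨N, hN⟩ := exists_nat_ge |μ|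
  have hint := (integrableOn_exp_mul_rpow_mul_pow hμ 1 N).const_mul (((1 - κ)⁻¹) ^ N)
  set K := ∫ t in Ioi (0 : ℝ), ((1 - κ)⁻¹) ^ N * (Real.exp (-t) * t ^ μ * (1 + 1 * t) ^ N)
    with hK
  have h1κ : 0 < 1 - κ := by linarith
  have hi1 : 1 ≤ (1 - κ)⁻¹ := (one_le_inv₀ h1κ).2 (by linarith)
  have hK0 : 0 ≤ K := by
    refine setIntegral_nonneg measurableSet_Ioi fun t ht => ?_
    have : (0 : ℝ) < t := ht
    positivity
  refine ⟨K + 1, by positivity, fun x hx hx0 hx1 => ?_⟩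
  have hxn : 0 < ‖x‖ := norm_pos_iff.2 hx0
  have hbound : ∀ t ∈ Ioi (0 : ℝ), ‖laplaceKernel μ x t‖ ≤
      (((1 - κ)⁻¹) ^ N * (Real.exp (-t) * t ^ μ * (1 + 1 * t) ^ N)) * ‖x‖ ^ (-max μ 0) := by
    intro t ht
    have ht0 : (0 : ℝ) < t := ht
    have hw := hx.div ht0.le
    have hwn : ‖(t : ℂ) / (2 * x)‖ = 2⁻¹ * t * ‖x‖⁻¹ := by
      rw [norm_div, norm_mul, Complex.norm_real, Real.norm_of_nonneg ht0.le, Complex.norm_ofNat]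
      field_simp
    have hkey : ‖1 + (t : ℂ) / (2 * x)‖ ^ μ ≤
        ((1 - κ)⁻¹) ^ N * (1 + 1 * t) ^ N * ‖x‖ ^ (-max μ 0) := by
      -- For `μ ≥ 0` the power of `x` comes from `1 + t/(2|x|) ≤ (1+t)/|x|`, valid for `|x| ≤ 1`.
      -- For `μ ≤ 0` the factor is bounded uniformly in `x`, since `|1 + t/(2x)| ≥ 1-κ` in the cone.
      rcases le_total 0 μ with h | h
      · rw [max_eq_left h, Real.rpow_neg hxn.le, ← Real.inv_rpow hxn.le]
        have h3 : 1 ≤ ‖x‖⁻¹ := (one_le_inv₀ hxn).2 hx1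
        calc ‖1 + (t : ℂ) / (2 * x)‖ ^ μ ≤ ((1 + t) * ‖x‖⁻¹) ^ μ := by
              gcongr
              refine (norm_add_le _ _).trans ?_
              rw [hwn, norm_one]
              nlinarith [mul_pos ht0 (inv_pos.2 hxn)]
          _ = (1 + t) ^ μ * ‖x‖⁻¹ ^ μ := Real.mul_rpow (by positivity) (by positivity)
          _ ≤ (1 * (1 + 1 * t) ^ (N : ℝ)) * ‖x‖⁻¹ ^ μ := by
              rw [one_mul, one_mul]
              gcongr
              · linarith
              · exact (le_abs_self _).trans hN
          _ ≤ _ := by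
              rw [Real.rpow_natCast]
              gcongr
              exact one_le_pow₀ hi1
      · rw [max_eq_right h, neg_zero, Real.rpow_zero, mul_one]
        have h2 := hw.le_norm_one_add h0 hκ
        rw [abs_of_nonpos h] at hN
        calc ‖1 + (t : ℂ) / (2 * x)‖ ^ μ ≤ (1 - κ) ^ μ := Real.rpow_le_rpow_of_nonpos h1κ h2 h
          _ = ((1 - κ)⁻¹) ^ (-μ) := by rw [Real.inv_rpow h1κ.le, Real.rpow_neg h1κ.le, inv_inv]
          _ ≤ ((1 - κ)⁻¹) ^ (N : ℝ) := Real.rpow_le_rpow_of_exponent_le hi1 hN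
          _ = ((1 - κ)⁻¹) ^ N * 1 := by rw [Real.rpow_natCast, mul_one]
          _ ≤ _ := by gcongr; exact one_le_pow₀ (by linarith)
    rw [laplaceKernel, norm_mul, norm_mul, Complex.norm_cpow_eq_rpow_re_of_pos ht0,
      Complex.ofReal_re, Complex.norm_cpow_real, ← Complex.ofReal_neg, Complex.norm_exp_ofReal]
    calc _ ≤ Real.exp (-t) * t ^ μ *
          (((1 - κ)⁻¹) ^ N * (1 + 1 * t) ^ N * ‖x‖ ^ (-max μ 0)) := by gcongr
      _ = _ := by ring
  refine (norm_integral_le_of_norm_le (hint.mul_const (‖x‖ ^ (-max μ 0)))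
    ((ae_restrict_mem measurableSet_Ioi).mono hbound)).trans ?_
  rw [integral_mul_const, ← hK]
  gcongr
  linarith

/-! ### Poisson's integral for the Bessel function -/

/-- The shift `t ↦ t + 1` gives a Beta integral over `[0, 2]` with both parameters `μ + 1`;
Legendre's duplication formula then removes `Γ(2μ+2)`. -/
theorem integral_one_sub_sq_rpow {μ : ℝ} (hμ : 0 < μ) :
    ∫ t in (-1 : ℝ)..1, (1 - t ^ 2) ^ μ =
      √Real.pi * Real.Gamma (μ + 1) / Real.Gamma (μ + 3 / 2) := by
  have h1 := Complex.betaIntegral_scaled (μ + 1) (μ + 1) (a := 2) two_pos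
  have h2 := Complex.Gamma_mul_Gamma_eq_betaIntegral (s := μ + 1) (t := μ + 1)
    (by simp; linarith) (by simp; linarith)
  have h3 := Complex.Gamma_mul_Gamma_add_half (μ + 1)
  have h4 : ((∫ t in (-1 : ℝ)..1, (1 - t ^ 2) ^ μ : ℝ) : ℂ) =
      ∫ x in (0 : ℝ)..2, (x : ℂ) ^ ((μ : ℂ) + 1 - 1) * ((2 : ℝ) - x : ℂ) ^ ((μ : ℂ) + 1 - 1) := by
    rw [← intervalIntegral.integral_ofReal]
    have h5 := intervalIntegral.integral_comp_add_right (a := -1) (b := 1)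
      (fun x : ℝ => (x : ℂ) ^ ((μ : ℂ) + 1 - 1) * ((2 : ℝ) - x : ℂ) ^ ((μ : ℂ) + 1 - 1)) 1
    rw [show (-1 : ℝ) + 1 = 0 by norm_num, show (1 : ℝ) + 1 = 2 by norm_num] at h5
    rw [← h5]
    refine intervalIntegral.integral_congr fun t ht => ?_
    rw [uIcc_of_le (by norm_num)] at ht
    simp only [add_sub_cancel_right]
    rw [← Complex.ofReal_sub, ← Complex.mul_cpow_ofReal_nonneg (by linarith [ht.1])
      (by linarith [ht.2]), ← Complex.ofReal_mul, Complex.ofReal_cpow (by nlinarith [ht.1, ht.2])]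
    congr 2
    ring
  have hG1 : Complex.Gamma (μ + 1 + (μ + 1)) ≠ 0 :=
    Complex.Gamma_ne_zero_of_re_pos (by simp; linarith)
  have hG2 : Complex.Gamma (μ + 1) ≠ 0 :=
    Complex.Gamma_ne_zero_of_re_pos (by simp; linarith)
  have hG3 : Complex.Gamma (μ + 3 / 2) ≠ 0 :=
    Complex.Gamma_ne_zero_of_re_pos (by simp; linarith)
  rw [h1] at h4
  have h6 : ((∫ t in (-1 : ℝ)..1, (1 - t ^ 2) ^ μ : ℝ) : ℂ) =
      ((√Real.pi * Real.Gamma (μ + 1) / Real.Gamma (μ + 3 / 2) : ℝ) : ℂ) := by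
    rw [h4]
    push_cast [← Complex.Gamma_ofReal]
    rw [eq_div_iff hG3]
    refine mul_left_cancel₀ (mul_ne_zero hG1 hG2) ?_
    rw [show (μ : ℂ) + 1 + 1 / 2 = μ + 3 / 2 by ring,
      show (2 : ℂ) * (μ + 1) = μ + 1 + (μ + 1) by ring] at h3
    have h7 : (2 : ℂ) ^ ((μ : ℂ) + 1 + (μ + 1) - 1) * 2 ^ (1 - ((μ : ℂ) + 1 + (μ + 1))) = 1 := by
      rw [← Complex.cpow_add _ _ two_ne_zero]
      simp
    calc _ = (2 : ℂ) ^ ((μ : ℂ) + 1 + (μ + 1) - 1) * (Complex.Gamma (μ + 1 + (μ + 1)) *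
          Complex.betaIntegral (μ + 1) (μ + 1)) * (Complex.Gamma (μ + 1) *
          Complex.Gamma (μ + 3 / 2)) := by ring
      _ = _ := by
        rw [← h2, h3]
        linear_combination (Complex.Gamma (μ + 1) * Complex.Gamma (μ + 1) *
          Complex.Gamma (μ + 1 + (μ + 1)) * √Real.pi) * h7
  exact_mod_cast h6

theorem continuous_one_sub_sq_rpow {μ : ℝ} (hμ : 0 ≤ μ) :
    Continuous fun t : ℝ => (1 - t ^ 2) ^ μ :=
  (by fun_prop : Continuous fun t : ℝ => 1 - t ^ 2).rpow_const fun _ => Or.inr hμ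

/-- The derivative of `t^{2k+1} (1-t²)^{μ+1}` is integrated over `[-1, 1]`, where this function
vanishes at both ends. -/
theorem integral_pow_mul_one_sub_sq_rpow_succ {μ : ℝ} (hμ : 0 < μ) (k : ℕ) :
    (k + μ + 3 / 2) * ∫ t in (-1 : ℝ)..1, t ^ (2 * (k + 1)) * (1 - t ^ 2) ^ μ =
      (k + 1 / 2) * ∫ t in (-1 : ℝ)..1, t ^ (2 * k) * (1 - t ^ 2) ^ μ := by
  have hc := continuous_one_sub_sq_rpow hμ.le
  have hint : ∀ n : ℕ, IntervalIntegrable (fun t : ℝ => t ^ n * (1 - t ^ 2) ^ μ) volume (-1) 1 :=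
    fun n => ((continuous_pow n).mul hc).intervalIntegrable _ _
  have h := intervalIntegral.integral_eq_sub_of_hasDerivAt_of_le (a := -1) (b := 1)
    (f := fun t : ℝ => t ^ (2 * k + 1) * (1 - t ^ 2) ^ (μ + 1))
    (f' := fun t : ℝ => (2 * k + 1) * (t ^ (2 * k) * (1 - t ^ 2) ^ μ) -
      (2 * k + 2 * μ + 3) * (t ^ (2 * (k + 1)) * (1 - t ^ 2) ^ μ)) (by norm_num)
    ((continuous_pow _).mul (continuous_one_sub_sq_rpow (by linarith))).continuousOn
    (fun t ht => by
      have hpos : 0 < 1 - t ^ 2 := by nlinarith [ht.1, ht.2]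
      have h1 : HasDerivAt (fun t : ℝ => 1 - t ^ 2) (-(2 * t)) t := by
        simpa using (hasDerivAt_pow 2 t).const_sub 1
      have h2 := (hasDerivAt_pow (2 * k + 1) t).mul (h1.rpow_const (p := μ + 1) (Or.inl hpos.ne'))
      refine h2.congr_deriv ?_
      rw [Real.rpow_add_one hpos.ne', add_sub_cancel_right, Nat.add_sub_cancel]
      push_cast
      ring)
    (((hint _).const_mul _).sub ((hint _).const_mul _))
  rw [intervalIntegral.integral_sub ((hint _).const_mul _) ((hint _).const_mul _),
    intervalIntegral.integral_const_mul, intervalIntegral.integral_const_mul] at h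
  have h0 : (0 : ℝ) ^ (μ + 1) = 0 := Real.zero_rpow (by linarith)
  norm_num [h0] at h
  linarith

/-- Divided by `(2k)!`, the moments are up to sign and the factor `√π Γ(μ+1)` the Taylor
coefficients of `E_{μ+1/2}`, which is what makes Poisson's integral work. -/
theorem integral_pow_mul_one_sub_sq_rpow {μ : ℝ} (hμ : 0 < μ) (k : ℕ) :
    (∫ t in (-1 : ℝ)..1, t ^ (2 * k) * (1 - t ^ 2) ^ μ) / (2 * k).factorial =
      √Real.pi * Real.Gamma (μ + 1) / (4 ^ k * k.factorial * Real.Gamma (μ + k + 3 / 2)) := by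
  induction k with
  | zero => simpa using integral_one_sub_sq_rpow hμ
  | succ k ih =>
    have hpos : 0 < μ + k + 3 / 2 := by positivity
    have hG := Real.Gamma_pos_of_pos hpos
    have hrec := integral_pow_mul_one_sub_sq_rpow_succ hμ k
    rw [show μ + ((k + 1 : ℕ) : ℝ) + 3 / 2 = μ + k + 3 / 2 + 1 by push_cast; ring,
      Real.Gamma_add_one hpos.ne', show 2 * (k + 1) = 2 * k + 1 + 1 by ring, Nat.factorial_succ,
      Nat.factorial_succ, Nat.factorial_succ, pow_succ]
    rw [show 2 * (k + 1) = 2 * k + 1 + 1 by ring] at hrec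
    push_cast
    have hf : (((2 * k).factorial : ℕ) : ℝ) ≠ 0 := by positivity
    rw [div_eq_iff hf] at ih
    rw [ih] at hrec
    have hI : (∫ t in (-1 : ℝ)..1, t ^ (2 * k + 1 + 1) * (1 - t ^ 2) ^ μ) =
      (k + 1 / 2) * (√Real.pi * Real.Gamma (μ + 1) / (4 ^ k * k.factorial *
        Real.Gamma (μ + k + 3 / 2)) * (2 * k).factorial) / (k + μ + 3 / 2) := by
      rw [← hrec]
      field_simp
    rw [hI]
    have h1 : (k : ℝ) + μ + 3 / 2 ≠ 0 := by positivity
    field_simp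
    ring

/-- Poisson's integral. -/
theorem integral_one_sub_sq_rpow_mul_exp {μ : ℝ} (hμ : 0 < μ) (z : ℂ) :
    ∫ t in (-1 : ℝ)..1, (((1 - t ^ 2) ^ μ : ℝ) : ℂ) * Complex.exp (Complex.I * z * t) =
      √Real.pi * Complex.Gamma (μ + 1) * besselE (μ + 1 / 2) z := by
  have hc := continuous_one_sub_sq_rpow hμ.le
  have hsum : HasSum (fun n : ℕ => ∫ t in (-1 : ℝ)..1,
      (((1 - t ^ 2) ^ μ : ℝ) : ℂ) * ((Complex.I * z * t) ^ n / (n.factorial : ℂ)))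
      (∫ t in (-1 : ℝ)..1, (((1 - t ^ 2) ^ μ : ℝ) : ℂ) * Complex.exp (Complex.I * z * t)) := by
    refine intervalIntegral.hasSum_integral_of_dominated_convergence
      (fun n _ => ‖z‖ ^ n / n.factorial) (fun n => ?_) (fun n => ?_) ?_ ?_ ?_
    · exact ((Complex.continuous_ofReal.comp hc).mul (by fun_prop)).aestronglyMeasurable
    · refine Eventually.of_forall fun t ht => ?_
      rw [uIoc_of_le (by norm_num)] at ht
      have h1 : |t| ≤ 1 := abs_le.2 ⟨ht.1.le, ht.2⟩
      have h2 : t ^ 2 ≤ 1 := by rw [← sq_abs]; nlinarith [abs_nonneg t]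
      rw [norm_mul, norm_div, norm_pow, norm_mul, norm_mul, Complex.norm_I, one_mul,
        Complex.norm_real, Complex.norm_real, Complex.norm_natCast, Real.norm_eq_abs t,
        Real.norm_of_nonneg (by apply Real.rpow_nonneg; linarith)]
      calc (1 - t ^ 2) ^ μ * ((‖z‖ * |t|) ^ n / n.factorial)
          ≤ 1 * ((‖z‖ * 1) ^ n / n.factorial) := by
            gcongr
            exact Real.rpow_le_one (by linarith) (by nlinarith [sq_nonneg t]) hμ.le
        _ = _ := by rw [one_mul, mul_one]
    · exact Eventually.of_forall fun t _ => Real.summable_pow_div_factorial ‖z‖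
    · exact intervalIntegrable_const
    · refine Eventually.of_forall fun t _ => HasSum.mul_left _ ?_
      rw [Complex.exp_eq_exp_ℂ]
      exact NormedSpace.expSeries_div_hasSum_exp _
  have hpull : ∀ n : ℕ, ∫ t in (-1 : ℝ)..1,
      (((1 - t ^ 2) ^ μ : ℝ) : ℂ) * ((Complex.I * z * t) ^ n / (n.factorial : ℂ)) =
      (Complex.I * z) ^ n / (n.factorial : ℂ) *
        ((∫ t in (-1 : ℝ)..1, t ^ n * (1 - t ^ 2) ^ μ : ℝ) : ℂ) := by
    intro n
    rw [← intervalIntegral.integral_ofReal, ← intervalIntegral.integral_const_mul]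
    congr 1
    funext t
    push_cast
    rw [mul_pow]
    ring
  have hodd : ∀ n ∉ range (fun k : ℕ => 2 * k), ∫ t in (-1 : ℝ)..1,
      (((1 - t ^ 2) ^ μ : ℝ) : ℂ) * ((Complex.I * z * t) ^ n / (n.factorial : ℂ)) = 0 := by
    intro n hn
    have hn' : Odd n := by
      rw [← Nat.not_even_iff_odd]
      rintro ⟨m, rfl⟩
      exact hn ⟨m, by simp only; ring⟩
    rw [hpull]
    have h1 := intervalIntegral.integral_comp_neg (a := -1) (b := 1)
      (fun t : ℝ => t ^ n * (1 - t ^ 2) ^ μ)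
    simp only [hn'.neg_pow, neg_neg, even_two.neg_pow, neg_mul, intervalIntegral.integral_neg] at h1
    have h2 : ∫ t in (-1 : ℝ)..1, t ^ n * (1 - t ^ 2) ^ μ = 0 := by linarith
    rw [h2]
    simp
  have hinj : Function.Injective (fun k : ℕ => 2 * k) := fun a b h => by
    simpa using h
  rw [← hinj.hasSum_iff hodd] at hsum
  rw [← hsum.tsum_eq, besselE, ← tsum_mul_left]
  congr 1
  funext k
  simp only [Function.comp_apply]
  have hf : (((2 * k).factorial : ℕ) : ℝ) ≠ 0 := by positivity
  have hmom := integral_pow_mul_one_sub_sq_rpow hμ k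
  rw [div_eq_iff hf] at hmom
  rw [hpull, hmom]
  push_cast [← Complex.Gamma_ofReal]
  have hG : Complex.Gamma ((μ : ℂ) + k + 3 / 2) ≠ 0 := by
    refine Complex.Gamma_ne_zero_of_re_pos ?_
    simp
    positivity
  have hf' : (((2 * k).factorial : ℕ) : ℂ) ≠ 0 := by exact_mod_cast hf
  rw [show (μ : ℂ) + 1 / 2 + k + 1 = μ + k + 3 / 2 by ring, pow_mul, mul_pow, Complex.I_sq,
    mul_pow, div_pow]
  field_simp

theorem mul_cpow_of_arg {x y : ℂ} (hx : x ≠ 0) (hy : y ≠ 0)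
    (h : x.arg + y.arg ∈ Ioc (-Real.pi) Real.pi) (c : ℂ) : (x * y) ^ c = x ^ c * y ^ c := by
  rw [Complex.cpow_def_of_ne_zero (mul_ne_zero hx hy), Complex.cpow_def_of_ne_zero hx,
    Complex.cpow_def_of_ne_zero hy, Complex.log_mul hx hy h, add_mul, Complex.exp_add]

theorem ofReal_mul_cpow {r : ℝ} (hr : 0 < r) {x : ℂ} (hx : x ≠ 0) (c : ℂ) :
    (r * x) ^ c = (r : ℂ) ^ c * x ^ c := by
  refine mul_cpow_of_arg (by exact_mod_cast hr.ne') hx ?_ c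
  rw [Complex.arg_ofReal_of_nonneg hr.le, zero_add]
  exact Complex.arg_mem_Ioc x

/-- The identity theorem for functions agreeing on a real interval. -/
theorem eqOn_of_eq_ofReal {f g : ℂ → ℂ} {U : Set ℂ} (hU : IsOpen U) (hU' : IsPreconnected U)
    (hf : DifferentiableOn ℂ f U) (hg : DifferentiableOn ℂ g U) {a b : ℝ} (hab : a < b)
    (hsub : ∀ x ∈ Ioo a b, (x : ℂ) ∈ U) (h : ∀ x ∈ Ioo a b, f x = g x) : EqOn f g U := by
  obtain ⟨c, hc⟩ := nonempty_Ioo.2 hab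
  refine (hf.analyticOnNhd hU).eqOn_of_preconnected_of_frequently_eq (hg.analyticOnNhd hU) hU'
    (hsub c hc) ?_
  have ht : Tendsto (fun x : ℝ => (x : ℂ)) (𝓝[≠] c) (𝓝[≠] (c : ℂ)) :=
    tendsto_nhdsWithin_of_tendsto_nhds_of_eventually_within _
      (Complex.continuous_ofReal.continuousAt.tendsto.mono_left nhdsWithin_le_nhds)
      (by filter_upwards [self_mem_nhdsWithin] with x hx
          simpa only [mem_compl_iff, mem_singleton_iff, Complex.ofReal_inj] using hx)
  refine ht.frequently (Eventually.frequently ?_)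
  filter_upwards [nhdsWithin_le_nhds (Ioo_mem_nhds hc.1 hc.2)] with x hx using h x hx

/-- On the vertical half-lines bounding the strip, Poisson's integrand is a rescaled Laplace
kernel; `ε = 1` for the right one, `ε = -1` for the left one. -/
theorem poisson_kernel_eq {μ z y : ℝ} (hz : 0 < z) (hy : 0 < y) {ε : ℝ}
    (hε : ε = 1 ∨ ε = -1) :
    (1 - ((ε : ℂ) + y * Complex.I) ^ 2) ^ (μ : ℂ) *
        Complex.exp (Complex.I * z * ((ε : ℂ) + y * Complex.I)) =
      ((2 / z : ℝ) : ℂ) ^ (μ : ℂ) * Complex.exp (-(ε * (Real.pi * μ / 2 * Complex.I))) *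
        Complex.exp (ε * (Complex.I * z)) *
        laplaceKernel μ (-(ε * (Complex.I * z))) (z * y) := by
  have hzc : (z : ℂ) ≠ 0 := by exact_mod_cast hz.ne'
  have hεε : (ε : ℂ) * ε = 1 := by rcases hε with rfl | rfl <;> norm_num
  have hε0 : (ε : ℂ) ≠ 0 := left_ne_zero_of_mul_eq_one hεε
  -- The factorisation is `1 - (ε+iy)² = 2y · (-iε) · u` with `Re u = 1`. The arguments of `-iε` and
  -- `u` add up to something inside `(-π, π)`, so the principal power splits over the product, and
  -- `u` is the factor `1 + t/(2x)` for `t = zy`, `x = -εiz`.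
  set u : ℂ := 1 + ε * (y / 2 * Complex.I) with hu
  have hure : u.re = 1 := by simp [hu]
  have hu0 : u ≠ 0 := fun h => by rw [h] at hure; simp at hure
  have h1 : 1 - ((ε : ℂ) + y * Complex.I) ^ 2 = ((2 * y : ℝ) : ℂ) * ((-(ε * Complex.I)) * u) := by
    rw [hu]
    push_cast
    linear_combination (-1 + y ^ 2 * Complex.I ^ 2) * hεε
  have hεI : -((ε : ℂ) * Complex.I) ≠ 0 := neg_ne_zero.2 (mul_ne_zero hε0 Complex.I_ne_zero)
  have harg : Complex.arg (-((ε : ℂ) * Complex.I)) = -(ε * (Real.pi / 2)) := by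
    rcases hε with rfl | rfl
    · simp
    · simp
  have hargu : |u.arg| < Real.pi / 2 := Complex.abs_arg_lt_pi_div_two_iff.2 (Or.inl (by simp [hure]))
  have h2 : (-((ε : ℂ) * Complex.I)) ^ (μ : ℂ) =
      Complex.exp (-(ε * (Real.pi * μ / 2 * Complex.I))) := by
    have hn : ‖-((ε : ℂ) * Complex.I)‖ = 1 := by
      rcases hε with rfl | rfl <;> simp
    rw [Complex.cpow_def_of_ne_zero hεI, Complex.log, hn, harg]
    congr 1
    push_cast
    simp
    ring
  have h3 : (-((ε : ℂ) * Complex.I) * u) ^ (μ : ℂ) =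
      Complex.exp (-(ε * (Real.pi * μ / 2 * Complex.I))) * u ^ (μ : ℂ) := by
    rw [← h2]
    refine mul_cpow_of_arg hεI hu0 ?_ _
    rw [harg]
    rw [abs_lt] at hargu
    rcases hε with rfl | rfl <;> constructor <;> linarith [Real.pi_pos]
  have h4 : 1 + ((z * y : ℝ) : ℂ) / (2 * -(ε * (Complex.I * z))) = u := by
    have h5 : (y / 2 : ℂ) * Complex.I * ε * (2 * -(ε * (Complex.I * z))) = z * y := by
      linear_combination (-y * z * Complex.I ^ 2) * hεε - (y * z : ℂ) * Complex.I_sq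
    rw [hu, add_right_inj, div_eq_iff (mul_ne_zero two_ne_zero
      (neg_ne_zero.2 (mul_ne_zero hε0 (mul_ne_zero Complex.I_ne_zero hzc))))]
    push_cast
    linear_combination -h5
  have h6 : ((2 * y : ℝ) : ℂ) ^ (μ : ℂ) = ((2 / z : ℝ) : ℂ) ^ (μ : ℂ) * ((z * y : ℝ) : ℂ) ^ (μ : ℂ) := by
    rw [← Complex.mul_cpow_ofReal_nonneg (by positivity) (by positivity), ← Complex.ofReal_mul]
    congr 2
    field_simp
  have h7 : Complex.exp (Complex.I * z * ((ε : ℂ) + y * Complex.I)) =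
      Complex.exp (ε * (Complex.I * z)) * Complex.exp (-((z * y : ℝ) : ℂ)) := by
    rw [← Complex.exp_add]
    congr 1
    push_cast
    linear_combination (z * y : ℂ) * Complex.I_sq
  rw [laplaceKernel, h4, h1, ofReal_mul_cpow (by positivity) (mul_ne_zero hεI hu0), h3, h6, h7]
  ring

theorem ofReal_mul_I_mem_slitPlane {y : ℝ} (hy : y ≠ 0) : (y : ℂ) * Complex.I ∈ Complex.slitPlane := by
  rw [Complex.mem_slitPlane_iff]
  right
  simpa using hy

theorem integral_poisson_vertical {μ z : ℝ} (hμ : -1 < μ) (hz : 0 < z) {ε : ℝ}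
    (hε : ε = 1 ∨ ε = -1) :
    IntegrableOn (fun y : ℝ => (1 - ((ε : ℂ) + y * Complex.I) ^ 2) ^ (μ : ℂ) *
        Complex.exp (Complex.I * z * ((ε : ℂ) + y * Complex.I))) (Ioi 0) ∧
    ∫ y in Ioi (0 : ℝ), (1 - ((ε : ℂ) + y * Complex.I) ^ 2) ^ (μ : ℂ) *
        Complex.exp (Complex.I * z * ((ε : ℂ) + y * Complex.I)) =
      ((2 / z : ℝ) : ℂ) ^ (μ : ℂ) * Complex.exp (-(ε * (Real.pi * μ / 2 * Complex.I))) *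
        Complex.exp (ε * (Complex.I * z)) * ((z : ℂ)⁻¹ * laplaceG μ (-(ε * (Complex.I * z)))) := by
  set K : ℂ := ((2 / z : ℝ) : ℂ) ^ (μ : ℂ) * Complex.exp (-(ε * (Real.pi * μ / 2 * Complex.I))) *
        Complex.exp (ε * (Complex.I * z)) with hK
  have hslit : -((ε : ℂ) * (Complex.I * z)) ∈ Complex.slitPlane := by
    have h := ofReal_mul_I_mem_slitPlane (y := -(ε * z))
      (neg_ne_zero.2 (mul_ne_zero (by rcases hε with rfl | rfl <;> norm_num) hz.ne'))
    convert h using 1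
    push_cast
    ring
  have hint := integrableOn_laplaceKernel (μ := μ) (by simpa using hμ) hslit
  have h2 : IntegrableOn (fun y : ℝ => K * laplaceKernel μ (-(ε * (Complex.I * z))) (z * y))
      (Ioi 0) := by
    refine Integrable.const_mul ?_ K
    refine (integrableOn_Ioi_comp_mul_left_iff (laplaceKernel μ (-(ε * (Complex.I * z)))) 0 hz).2 ?_
    rwa [mul_zero]
  constructor
  · exact h2.congr_fun (fun y hy => (poisson_kernel_eq hz hy hε).symm) measurableSet_Ioi
  · rw [setIntegral_congr_fun measurableSet_Ioi (fun y hy => poisson_kernel_eq hz hy hε),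
      integral_const_mul,
      integral_comp_mul_left_Ioi (laplaceKernel μ (-(ε * (Complex.I * z)))) 0 hz, mul_zero,
      Complex.real_smul, Complex.ofReal_inv, laplaceG]

/-- Rotation of Poisson's integral into two Laplace integrals. -/
theorem integral_poisson_eq_laplaceG {μ z : ℝ} (hμ : 0 < μ) (hz : 0 < z) :
    ∫ t in (-1 : ℝ)..1, (1 - (t : ℂ) ^ 2) ^ (μ : ℂ) * Complex.exp (Complex.I * z * t) =
      Complex.I * ((2 / z : ℝ) : ℂ) ^ (μ : ℂ) * (z : ℂ)⁻¹ *
        (Complex.exp (Real.pi * μ / 2 * Complex.I) * Complex.exp (-(Complex.I * z)) *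
            laplaceG μ (Complex.I * z) -
          Complex.exp (-(Real.pi * μ / 2 * Complex.I)) * Complex.exp (Complex.I * z) *
            laplaceG μ (-(Complex.I * z))) := by
  set f : ℂ → ℂ := fun w => (1 - w ^ 2) ^ (μ : ℂ) * Complex.exp (Complex.I * z * w) with hf
  obtain ⟨hi₁, hI₁⟩ := integral_poisson_vertical (z := z) (by linarith : -1 < μ) hz (Or.inl rfl : (1 : ℝ) = 1 ∨ _)
  obtain ⟨hi₂, hI₂⟩ := integral_poisson_vertical (z := z) (by linarith : -1 < μ) hz (Or.inr rfl : _ ∨ (-1 : ℝ) = -1)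
  have hre : ∀ w : ℂ, (1 - w ^ 2).re = 1 - w.re ^ 2 + w.im ^ 2 := fun w => by
    simp [pow_two]; ring
  -- Cauchy's theorem on `[-1, 1] × [0, R]`. The integrand has branch points at the corners `±1`; it
  -- is continuous there because `μ > 0`, and it is holomorphic inside.
  have hrect : ∀ R : ℝ, 0 < R → (∫ t in (-1 : ℝ)..1, f t) =
      (∫ t in (-1 : ℝ)..1, f (t + R * Complex.I)) -
        Complex.I * (∫ y in (0 : ℝ)..R, f (((1 : ℝ) : ℂ) + y * Complex.I)) +
        Complex.I * (∫ y in (0 : ℝ)..R, f (((-1 : ℝ) : ℂ) + y * Complex.I)) := by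
    intro R hR
    have h := Complex.integral_boundary_rect_eq_zero_of_continuousOn_of_differentiableOn f
      (⟨-1, 0⟩ : ℂ) ⟨1, R⟩ ?_ ?_
    · simp only [smul_eq_mul, Complex.ofReal_zero, zero_mul, add_zero] at h
      linear_combination h
    · rintro w ⟨hw₁, hw₂⟩
      simp only [mem_preimage] at hw₁ hw₂
      rw [uIcc_of_le (by norm_num)] at hw₁
      have hcp : ContinuousAt (fun x : ℂ => x ^ (μ : ℂ)) (1 - w ^ 2) := by
        refine Complex.continuousAt_cpow_const_of_re_pos (Or.inl ?_) (by simpa using hμ)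
        rw [hre]
        nlinarith [hw₁.1, hw₁.2, sq_nonneg w.im]
      refine ContinuousAt.continuousWithinAt (ContinuousAt.mul ?_ (by fun_prop))
      exact ContinuousAt.comp (f := fun w : ℂ => 1 - w ^ 2) hcp (by fun_prop)
    · rintro w ⟨hw₁, hw₂⟩
      simp only [mem_preimage] at hw₁ hw₂
      rw [min_eq_left (by norm_num), max_eq_right (by norm_num)] at hw₁
      refine DifferentiableAt.differentiableWithinAt (DifferentiableAt.mul ?_ (by fun_prop))
      refine DifferentiableAt.cpow_const (by fun_prop) ?_
      rw [Complex.mem_slitPlane_iff, hre]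
      left
      nlinarith [hw₁.1, hw₁.2, sq_nonneg w.im]
  -- On the top edge the integrand is at most `(R+2)^{2μ} e^{-zR}`, since `|1-w²| ≤ (R+2)²` there.
  have htop : Tendsto (fun R : ℝ => ∫ t in (-1 : ℝ)..1, f (t + R * Complex.I)) atTop (𝓝 0) := by
    have hlim : Tendsto (fun R : ℝ => Real.exp (2 * z) *
        ((R + 2) ^ (2 * μ) * Real.exp (-z * (R + 2))) * |(1 : ℝ) - (-1)|) atTop (𝓝 0) := by
      have h := (tendsto_rpow_mul_exp_neg_mul_atTop_nhds_zero (2 * μ) z hz).comp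
        (tendsto_atTop_add_const_right atTop (2 : ℝ) tendsto_id)
      simpa using (h.const_mul (Real.exp (2 * z))).mul_const |(1 : ℝ) - (-1)|
    refine squeeze_zero_norm' ?_ hlim
    filter_upwards [eventually_ge_atTop 0] with R hR
    refine intervalIntegral.norm_integral_le_of_norm_le_const fun t ht => ?_
    rw [uIoc_of_le (by norm_num)] at ht
    have hn : ‖(t : ℂ) + R * Complex.I‖ ≤ 1 + R := by
      refine (norm_add_le _ _).trans ?_
      rw [norm_mul, Complex.norm_I, mul_one, Complex.norm_real, Complex.norm_real,
        Real.norm_of_nonneg hR, Real.norm_eq_abs]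
      linarith [abs_le.2 ⟨ht.1.le, ht.2⟩]
    rw [hf]
    simp only
    rw [norm_mul, Complex.norm_cpow_real, Complex.norm_exp]
    have h1 : (Complex.I * z * (t + R * Complex.I)).re = -z * R := by
      simp
    rw [h1]
    have h2 : ‖1 - ((t : ℂ) + R * Complex.I) ^ 2‖ ≤ (R + 2) ^ (2 : ℝ) := by
      refine (norm_sub_le _ _).trans ?_
      rw [norm_pow, norm_one, Real.rpow_two]
      nlinarith [norm_nonneg ((t : ℂ) + R * Complex.I)]
    calc ‖1 - ((t : ℂ) + R * Complex.I) ^ 2‖ ^ μ * Real.exp (-z * R)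
        ≤ ((R + 2) ^ (2 : ℝ)) ^ μ * Real.exp (-z * R) := by gcongr
      _ = Real.exp (2 * z) * ((R + 2) ^ (2 * μ) * Real.exp (-z * (R + 2))) := by
        rw [← Real.rpow_mul (by linarith), mul_left_comm, ← Real.exp_add]
        congr 2
        ring
  have hlim := (htop.sub ((intervalIntegral_tendsto_integral_Ioi 0 hi₁ tendsto_id).const_mul
    Complex.I)).add ((intervalIntegral_tendsto_integral_Ioi 0 hi₂ tendsto_id).const_mul Complex.I)
  have hconst : Tendsto (fun _ : ℝ => ∫ t in (-1 : ℝ)..1, f t) atTop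
      (𝓝 (∫ t in (-1 : ℝ)..1, f t)) := tendsto_const_nhds
  have heq := tendsto_nhds_unique (hconst.congr' (by
    filter_upwards [eventually_gt_atTop 0] with R hR using hrect R hR)) hlim
  rw [hI₁, hI₂] at heq
  rw [heq]
  push_cast
  simp only [one_mul, neg_mul, neg_neg]
  ring

theorem isPreconnected_slitPlane : IsPreconnected Complex.slitPlane :=
  (Complex.starConvex_one_slitPlane.isPathConnected
    Complex.one_mem_slitPlane).isConnected.isPreconnected

/-! ### Symmetry of the Laplace integral in the order -/

/-- With `r = 1 + t/(2x)`, the factor `Γ(1/2-ν) r^{ν-1/2}` is itself the integral of `u^{-ν-1/2}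
e^{-ru}`. For `|ν| < 1/2` both powers are integrable at `0`. -/
theorem Gamma_mul_laplaceG_eq_integral {ν x : ℝ} (hν : |ν| < 1 / 2) (hx : 0 < x) :
    Complex.Gamma (1 / 2 - ν) * laplaceG (ν - 1 / 2) x =
      ((∫ t in Ioi (0 : ℝ), ∫ u in Ioi (0 : ℝ), Real.exp (-t) * t ^ (ν - 1 / 2) *
        (u ^ (-ν - 1 / 2) * Real.exp (-((1 + t / (2 * x)) * u))) : ℝ) : ℂ) := by
  rw [abs_lt] at hν
  rw [← integral_complex_ofReal, laplaceG, ← integral_const_mul]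
  refine setIntegral_congr_fun measurableSet_Ioi fun t ht => ?_
  have ht0 : (0 : ℝ) < t := ht
  have hr : 0 < 1 + t / (2 * x) := by positivity
  have h := Real.integral_rpow_mul_exp_neg_mul_Ioi (a := 1 / 2 - ν) (by linarith) hr
  rw [show 1 / 2 - ν - 1 = -ν - 1 / 2 by ring] at h
  rw [integral_const_mul, h, laplaceKernel]
  push_cast [Complex.ofReal_cpow ht0.le, Complex.ofReal_cpow (show 0 ≤ 1 / (1 + t / (2 * x)) by positivity),
    ← Complex.Gamma_ofReal]
  have hrc : ((1 : ℂ) / (1 + t / (2 * x))) ^ ((1 : ℂ) / 2 - ν) = (1 + t / (2 * x)) ^ ((ν : ℂ) - 1 / 2) := by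
    rw [show (1 : ℂ) + t / (2 * x) = ((1 + t / (2 * x) : ℝ) : ℂ) by push_cast; ring, one_div,
      Complex.inv_cpow, ← Complex.cpow_neg, neg_sub]
    rw [Complex.arg_ofReal_of_nonneg hr.le]
    exact Real.pi_pos.ne
  rw [hrc]
  ring

/-- In the double integral the exponent `t + u + tu/(2x)` is symmetric, so exchanging `t` and `u` by
Fubini exchanges `ν` and `-ν`. This is done for `x > 0` and continued to the slit plane. -/
theorem laplaceG_symm {ν : ℝ} (hν : |ν| < 1 / 2) {x : ℂ} (hx : x ∈ Complex.slitPlane) :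
    laplaceG (-ν - 1 / 2) x / Complex.Gamma (-ν + 1 / 2) =
      laplaceG (ν - 1 / 2) x / Complex.Gamma (ν + 1 / 2) := by
  have hν' := abs_lt.1 hν
  refine eqOn_of_eq_ofReal (U := Complex.slitPlane) (a := 0) (b := 1) Complex.isOpen_slitPlane
    isPreconnected_slitPlane
    ((differentiableOn_laplaceG (by simp; linarith)).div_const _)
    ((differentiableOn_laplaceG (by simp; linarith)).div_const _) one_pos
    (fun x hx => Complex.ofReal_mem_slitPlane.2 hx.1) (fun x hx => ?_) hx
  have hx0 : 0 < x := hx.1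
  have h1 := Gamma_mul_laplaceG_eq_integral hν hx0
  have h2 := Gamma_mul_laplaceG_eq_integral (ν := -ν) (by rwa [abs_neg]) hx0
  have hint₁ := Real.GammaIntegral_convergent (s := ν + 1 / 2) (by linarith)
  have hint₂ := Real.GammaIntegral_convergent (s := -ν + 1 / 2) (by linarith)
  have hprod : Integrable (Function.uncurry fun t u : ℝ => Real.exp (-t) * t ^ (ν - 1 / 2) *
      (u ^ (-ν - 1 / 2) * Real.exp (-((1 + t / (2 * x)) * u))))
      ((volume.restrict (Ioi 0)).prod (volume.restrict (Ioi 0))) := by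
    refine (hint₁.mul_prod hint₂).mono' ?_ ?_
    · refine Measurable.aestronglyMeasurable ?_
      unfold Function.uncurry
      fun_prop
    · rw [Measure.prod_restrict]
      filter_upwards [ae_restrict_mem (measurableSet_Ioi.prod measurableSet_Ioi)] with p hp
      have h1 : (0 : ℝ) < p.1 := hp.1
      have h2 : (0 : ℝ) < p.2 := hp.2
      rw [Function.uncurry, Real.norm_of_nonneg (by positivity),
        show ν + 1 / 2 - 1 = ν - 1 / 2 by ring, show -ν + 1 / 2 - 1 = -ν - 1 / 2 by ring,
        mul_comm (p.2 ^ _)]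
      gcongr
      have : 0 < p.1 / (2 * x) * p.2 := by positivity
      linarith
  rw [integral_integral_swap hprod] at h1
  have hswap : (∫ u in Ioi (0 : ℝ), ∫ t in Ioi (0 : ℝ), Real.exp (-t) * t ^ (ν - 1 / 2) *
        (u ^ (-ν - 1 / 2) * Real.exp (-((1 + t / (2 * x)) * u)))) =
      ∫ t in Ioi (0 : ℝ), ∫ u in Ioi (0 : ℝ), Real.exp (-t) * t ^ (-ν - 1 / 2) *
        (u ^ (- -ν - 1 / 2) * Real.exp (-((1 + t / (2 * x)) * u))) := by
    refine integral_congr_ae (Eventually.of_forall fun u => integral_congr_ae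
      (Eventually.of_forall fun t => ?_))
    simp only [neg_neg]
    have h3 : Real.exp (-t) * Real.exp (-((1 + t / (2 * x)) * u)) =
        Real.exp (-u) * Real.exp (-((1 + u / (2 * x)) * t)) := by
      rw [← Real.exp_add, ← Real.exp_add]
      congr 1
      ring
    linear_combination (t ^ (ν - 1 / 2) * u ^ (-ν - 1 / 2)) * h3
  rw [hswap, ← h2] at h1
  have hG1 : Complex.Gamma (-ν + 1 / 2) ≠ 0 :=
    Complex.Gamma_ne_zero_of_re_pos (by simp; linarith)
  have hG2 : Complex.Gamma (ν + 1 / 2) ≠ 0 :=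
    Complex.Gamma_ne_zero_of_re_pos (by simp; linarith)
  push_cast at h1
  rw [sub_neg_eq_add, add_comm (1 / 2 : ℂ) (ν : ℂ), sub_eq_add_neg (1 / 2 : ℂ) (ν : ℂ),
    add_comm (1 / 2 : ℂ) (-(ν : ℂ))] at h1
  rw [div_eq_div_iff hG1 hG2]
  linear_combination -h1

/-! ### The Hankel functions as Laplace integrals -/

/-- The Laplace-type integral for the Hankel function of the first (`ε = 1`) or second
(`ε = -1`) kind. -/
def hankelLaplace (ε : ℝ) (ν z : ℂ) : ℂ :=
  √(2 / Real.pi) * z ^ (-(1 / 2) : ℂ) *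
    Complex.exp (ε * (Complex.I * (z - ν * Real.pi / 2 - Real.pi / 4))) *
    (laplaceG (ν - 1 / 2) (-(ε * (Complex.I * z))) / Complex.Gamma (ν + 1 / 2))

/-- The region where `hankelLaplace ε` represents the Hankel function. -/
def hankelRegion (ε : ℝ) : Set ℂ := {z | 0 < z.re ∨ 0 < ε * z.im}

theorem isOpen_hankelRegion (ε : ℝ) : IsOpen (hankelRegion ε) :=
  (isOpen_lt continuous_const Complex.continuous_re).union
    (isOpen_lt continuous_const (continuous_const.mul Complex.continuous_im))

theorem isPreconnected_hankelRegion {ε : ℝ} (hε : ε = 1 ∨ ε = -1) :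
    IsPreconnected (hankelRegion ε) := by
  have hlin : IsLinearMap ℝ fun z : ℂ => ε * z.im :=
    ⟨fun x y => by simp [mul_add], fun c x => by simp; ring⟩
  refine IsPreconnected.union (1 + ε * Complex.I : ℂ) ?_ ?_
    (convex_halfSpace_re_gt 0).isPreconnected (convex_halfSpace_gt hlin 0).isPreconnected
  · change 0 < (1 + ε * Complex.I : ℂ).re
    simp
  · change 0 < ε * (1 + ε * Complex.I : ℂ).im
    rcases hε with rfl | rfl <;> simp

theorem mem_slitPlane_of_mem_hankelRegion {ε : ℝ} {z : ℂ}
    (hz : z ∈ hankelRegion ε) : z ∈ Complex.slitPlane := by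
  rw [Complex.mem_slitPlane_iff]
  rcases hz with hz | hz
  · exact Or.inl hz
  · exact Or.inr fun h => by simp [h] at hz

theorem neg_I_mul_mem_slitPlane_of_mem_hankelRegion {ε : ℝ} (hε : ε = 1 ∨ ε = -1) {z : ℂ}
    (hz : z ∈ hankelRegion ε) : -(ε * (Complex.I * z)) ∈ Complex.slitPlane := by
  rw [Complex.mem_slitPlane_iff]
  rcases hz with hz | hz
  · refine Or.inr ?_
    rcases hε with rfl | rfl <;> simp <;> exact hz.ne'
  · refine Or.inl ?_
    simpa using hz

theorem ofReal_mem_hankelRegion (ε : ℝ) {x : ℝ} (hx : 0 < x) : (x : ℂ) ∈ hankelRegion ε :=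
  Or.inl (by simpa using hx)

theorem differentiableOn_hankelLaplace {ε : ℝ} (hε : ε = 1 ∨ ε = -1) {ν : ℂ}
    (hν : -(1 / 2) < ν.re) : DifferentiableOn ℂ (hankelLaplace ε ν) (hankelRegion ε) := by
  intro z hz
  have h1 := mem_slitPlane_of_mem_hankelRegion hz
  have h2 : DifferentiableAt ℂ (laplaceG (ν - 1 / 2)) (-(ε * (Complex.I * z))) :=
    (differentiableOn_laplaceG (by simp; linarith)).differentiableAt
    (Complex.isOpen_slitPlane.mem_nhds (neg_I_mul_mem_slitPlane_of_mem_hankelRegion hε hz))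
  have h3 : DifferentiableAt ℂ (fun z => laplaceG (ν - 1 / 2) (-(ε * (Complex.I * z)))) z :=
    DifferentiableAt.comp (f := fun z : ℂ => -(ε * (Complex.I * z))) z h2 (by fun_prop)
  have h4 : DifferentiableAt ℂ (fun z : ℂ => z ^ (-(1 / 2) : ℂ)) z :=
    differentiableAt_id.cpow_const h1
  exact (((h4.const_mul _).mul (by fun_prop)).mul (h3.div_const _)).differentiableWithinAt

theorem differentiableOn_hankelLaplace_order {ε : ℝ} (hε : ε = 1 ∨ ε = -1) {z : ℂ}
    (hz : z ∈ hankelRegion ε) :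
    DifferentiableOn ℂ (fun ν => hankelLaplace ε ν z) {ν | -(1 / 2) < ν.re} := by
  intro ν (hν : -(1 / 2) < ν.re)
  have h2 : DifferentiableAt ℂ (fun μ => laplaceG μ (-(ε * (Complex.I * z)))) (ν - 1 / 2) :=
    (differentiableOn_laplaceG_order (neg_I_mul_mem_slitPlane_of_mem_hankelRegion hε hz)).differentiableAt
      ((isOpen_lt_re _).mem_nhds (by simp; linarith))
  have h3 : DifferentiableAt ℂ (fun ν => laplaceG (ν - 1 / 2) (-(ε * (Complex.I * z)))) ν :=
    DifferentiableAt.comp (f := fun ν : ℂ => ν - 1 / 2) ν h2 (by fun_prop)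
  have h4 : DifferentiableAt ℂ (fun ν : ℂ => (Complex.Gamma (ν + 1 / 2))⁻¹) ν :=
    DifferentiableAt.comp (f := fun ν : ℂ => ν + 1 / 2) ν
      (Complex.differentiable_one_div_Gamma _) (by fun_prop)
  simp only [hankelLaplace, div_eq_mul_inv (laplaceG _ _)]
  exact (DifferentiableAt.mul (by fun_prop) (h3.mul h4)).differentiableWithinAt

theorem differentiable_besselJ_order {z : ℂ} (hz : z ≠ 0) :
    Differentiable ℂ (fun ν => besselJ ν z) := fun ν =>
  (differentiableAt_id.const_cpow (Or.inl (div_ne_zero hz two_ne_zero))).mul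
    (differentiable_besselE_order z ν)

theorem differentiableOn_besselJ (ν : ℂ) : DifferentiableOn ℂ (besselJ ν) Complex.slitPlane := by
  intro z hz
  have h1 : z / 2 ∈ Complex.slitPlane := by
    have := (Complex.mem_slitPlane_iff.1 hz)
    rw [Complex.mem_slitPlane_iff]
    simpa using this
  exact (((differentiableAt_id.div_const 2).cpow_const h1).mul
    (differentiable_besselE ν z)).differentiableWithinAt

theorem isPreconnected_lt_re (a : ℝ) : IsPreconnected {μ : ℂ | a < μ.re} :=
  (convex_halfSpace_re_gt a).isPreconnected

/-- For real `ν` in `(1/2, 1)` this is the rotated Poisson integral, which needs `μ = ν - 1/2 > 0`.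
Both sides are holomorphic in `ν` on `Re ν > -1/2`, so the identity theorem reaches the smaller
orders, where `J_ν` and `J_{-ν}` can be compared. -/
theorem besselJ_eq_hankelLaplace_of_pos {ν : ℂ} (hν : -(1 / 2) < ν.re) {z : ℝ} (hz : 0 < z) :
    besselJ ν z = (hankelLaplace 1 ν z + hankelLaplace (-1) ν z) / 2 := by
  have hz0 : (z : ℂ) ≠ 0 := by exact_mod_cast hz.ne'
  refine eqOn_of_eq_ofReal (f := fun ν => besselJ ν z)
    (g := fun ν => (hankelLaplace 1 ν z + hankelLaplace (-1) ν z) / 2)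
    (U := {ν : ℂ | -(1 / 2) < ν.re}) (a := 1 / 2) (b := 1) (isOpen_lt_re _) (isPreconnected_lt_re _)
    (differentiable_besselJ_order hz0).differentiableOn
    (((differentiableOn_hankelLaplace_order (Or.inl rfl) (ofReal_mem_hankelRegion 1 hz)).add
      (differentiableOn_hankelLaplace_order (Or.inr rfl)
        (ofReal_mem_hankelRegion (-1) hz))).div_const 2)
    (by norm_num) (fun ν hν => by simp; linarith [hν.1]) (fun ν hν => ?_) hν
  have hμ : 0 < ν - 1 / 2 := by linarith [hν.1]
  have h1 := integral_one_sub_sq_rpow_mul_exp hμ z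
  have h2 := integral_poisson_eq_laplaceG hμ hz
  have h3 : ∫ t in (-1 : ℝ)..1, (((1 - t ^ 2) ^ (ν - 1 / 2) : ℝ) : ℂ) *
      Complex.exp (Complex.I * z * t) = ∫ t in (-1 : ℝ)..1,
      (1 - (t : ℂ) ^ 2) ^ ((ν - 1 / 2 : ℝ) : ℂ) * Complex.exp (Complex.I * z * t) := by
    refine intervalIntegral.integral_congr fun t ht => ?_
    rw [uIcc_of_le (by norm_num)] at ht
    rw [Complex.ofReal_cpow (by nlinarith [ht.1, ht.2])]
    push_cast
    ring
  rw [h1] at h3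
  rw [h2] at h3
  push_cast at h3
  rw [show (ν : ℂ) - 1 / 2 + 1 = ν + 1 / 2 by ring, sub_add_cancel] at h3
  have hG : Complex.Gamma (ν + 1 / 2) ≠ 0 :=
    Complex.Gamma_ne_zero_of_re_pos (by simp; linarith)
  have hpi : ((√Real.pi : ℝ) : ℂ) ≠ 0 := by
    exact_mod_cast (Real.sqrt_pos.2 Real.pi_pos).ne'
  have hE : besselE ν z = (√Real.pi * Complex.Gamma (ν + 1 / 2))⁻¹ *
      (√Real.pi * Complex.Gamma (ν + 1 / 2) * besselE ν z) := by
    rw [inv_mul_cancel_left₀ (mul_ne_zero hpi hG)]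
  rw [besselJ_eq, hE, h3]
  have hpow : ((z : ℂ) / 2) ^ (ν : ℂ) * (2 / (z : ℂ)) ^ ((ν : ℂ) - 1 / 2) * (z : ℂ)⁻¹ *
      ((√Real.pi : ℝ) : ℂ)⁻¹ = (√(2 / Real.pi) : ℝ) * (z : ℂ) ^ (-(1 / 2) : ℂ) / 2 := by
    have h4 : (z : ℂ) / 2 = ((z / 2 : ℝ) : ℂ) := by push_cast; ring
    have h5 : (2 : ℂ) / z = ((2 / z : ℝ) : ℂ) := by push_cast; ring
    rw [h4, h5, show (ν : ℂ) - 1 / 2 = ((ν - 1 / 2 : ℝ) : ℂ) by push_cast; ring,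
      show (-(1 / 2) : ℂ) = ((-(1 / 2) : ℝ) : ℂ) by push_cast; ring,
      ← Complex.ofReal_cpow (by positivity), ← Complex.ofReal_cpow (by positivity),
      ← Complex.ofReal_cpow (by positivity)]
    norm_cast
    have h6 : (2 / z) = (z / 2)⁻¹ := by rw [inv_div]
    rw [h6, Real.inv_rpow (by positivity), ← Real.rpow_neg (by positivity),
      ← Real.rpow_add (by positivity), show ν + -(ν - 1 / 2) = 1 / 2 by ring,
      ← Real.sqrt_eq_rpow, Real.rpow_neg hz.le, ← Real.sqrt_eq_rpow, Real.sqrt_div hz.le,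
      Real.sqrt_div two_pos.le]
    have h7 : √z * √z = z := Real.mul_self_sqrt hz.le
    have h8 : √2 * √2 = (2 : ℝ) := Real.mul_self_sqrt two_pos.le
    field_simp
    linear_combination (2 : ℝ) * h7 - z * h8
  have he₁ : Complex.I * Complex.exp (Real.pi * (ν - 1 / 2) / 2 * Complex.I) *
      Complex.exp (-(Complex.I * z)) =
      Complex.exp (((-1 : ℝ) : ℂ) * (Complex.I * (z - ν * Real.pi / 2 - Real.pi / 4))) := by
    conv_lhs => enter [1, 1]; rw [← Complex.exp_pi_div_two_mul_I]
    rw [← Complex.exp_add, ← Complex.exp_add]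
    congr 1
    push_cast
    ring
  have he₂ : -Complex.I * Complex.exp (-(Real.pi * (ν - 1 / 2) / 2 * Complex.I)) *
      Complex.exp (Complex.I * z) =
      Complex.exp (((1 : ℝ) : ℂ) * (Complex.I * (z - ν * Real.pi / 2 - Real.pi / 4))) := by
    conv_lhs => enter [1, 1]; rw [← Complex.exp_neg_pi_div_two_mul_I]
    rw [← Complex.exp_add, ← Complex.exp_add]
    congr 1
    push_cast
    ring
  simp only [hankelLaplace]
  rw [← he₁, ← he₂]
  push_cast
  simp only [one_mul, neg_mul, neg_neg, mul_inv]
  linear_combination ((Complex.Gamma (ν + 1 / 2))⁻¹ * Complex.I *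
    (Complex.exp (Real.pi * (ν - 1 / 2) / 2 * Complex.I) * Complex.exp (-(Complex.I * z)) *
            laplaceG (ν - 1 / 2) (Complex.I * z) -
          Complex.exp (-(Real.pi * (ν - 1 / 2) / 2 * Complex.I)) * Complex.exp (Complex.I * z) *
            laplaceG (ν - 1 / 2) (-(Complex.I * z)))) * hpow

/-- The Laplace integral divided by its Gamma factor is even in `ν`, so only the phase `e^{-εiνπ/2}`
changes. -/
theorem hankelLaplace_neg_order {ε ν : ℝ} (hε : ε = 1 ∨ ε = -1) (hν : |ν| < 1 / 2) {z : ℂ}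
    (hz : z ∈ hankelRegion ε) :
    hankelLaplace ε (-ν) z = Complex.exp (ε * (ν * Real.pi * Complex.I)) * hankelLaplace ε ν z := by
  rw [hankelLaplace, laplaceG_symm hν (neg_I_mul_mem_slitPlane_of_mem_hankelRegion hε hz),
    hankelLaplace]
  have h : Complex.exp (ε * (Complex.I * (z - -ν * Real.pi / 2 - Real.pi / 4))) =
      Complex.exp (ε * (ν * Real.pi * Complex.I)) *
        Complex.exp (ε * (Complex.I * (z - ν * Real.pi / 2 - Real.pi / 4))) := by
    rw [← Complex.exp_add]
    congr 1
    ring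
  rw [h]
  ring

theorem exp_neg_eps_mul {ε : ℝ} (hε : ε = 1 ∨ ε = -1) (w : ℂ) :
    Complex.exp (-(ε * (w * Complex.I))) = Complex.cos w - ε * Complex.sin w * Complex.I := by
  rcases hε with rfl | rfl
  · push_cast
    rw [one_mul, ← neg_mul, Complex.exp_mul_I, Complex.cos_neg, Complex.sin_neg]
    ring
  · push_cast
    rw [neg_mul, neg_neg, one_mul, Complex.exp_mul_I]
    ring

/-- The connection of the Laplace integrals with `J_ν` and `J_{-ν}`. -/
theorem sin_mul_hankelLaplace {ε : ℝ} (hε : ε = 1 ∨ ε = -1) {ν : ℂ} (hν : -(1 / 2) < ν.re)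
    {z : ℂ} (hz : z ∈ hankelRegion ε) :
    ε * Complex.I * Complex.sin (ν * Real.pi) * hankelLaplace ε ν z =
      besselJ (-ν) z - Complex.exp (-(ε * (ν * Real.pi * Complex.I))) * besselJ ν z := by
  -- For real `|ν| < 1/2` both `J_ν` and `J_{-ν}` are half-sums of the two Laplace functions of
  -- order `ν`, the second with phases `e^{±iπν}`; the claim is the elimination of one of them. The
  -- identity theorem then removes the restriction on `ν`, and finally the one on `z`.
  have hreal : ∀ (ν x : ℝ), |ν| < 1 / 2 → 0 < x →
      ε * Complex.I * Complex.sin (ν * Real.pi) * hankelLaplace ε ν x =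
      besselJ (-ν) x - Complex.exp (-(ε * (ν * Real.pi * Complex.I))) * besselJ ν x := by
    intro ν x hν hx
    have hν' := abs_lt.1 hν
    have h1 := hankelLaplace_neg_order (Or.inl rfl) hν (ofReal_mem_hankelRegion 1 hx)
    have h2 := hankelLaplace_neg_order (Or.inr rfl) hν (ofReal_mem_hankelRegion (-1) hx)
    rw [besselJ_eq_hankelLaplace_of_pos (by simp; linarith) hx,
      besselJ_eq_hankelLaplace_of_pos (by simp; linarith) hx, h1, h2, exp_neg_eps_mul hε]
    have h3 := exp_neg_eps_mul (ε := -1) (Or.inr rfl) (ν * Real.pi)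
    have h4 := exp_neg_eps_mul (ε := 1) (Or.inl rfl) (ν * Real.pi)
    push_cast at h3 h4 ⊢
    simp only [neg_mul, one_mul, neg_neg] at h3 h4 ⊢
    rw [h3, h4]
    rcases hε with rfl | rfl <;> push_cast <;> ring
  have horder : ∀ (x : ℝ), 0 < x → ∀ ν : ℂ, -(1 / 2) < ν.re →
      ε * Complex.I * Complex.sin (ν * Real.pi) * hankelLaplace ε ν x =
      besselJ (-ν) x - Complex.exp (-(ε * (ν * Real.pi * Complex.I))) * besselJ ν x := by
    intro x hx ν hν
    have hx0 : (x : ℂ) ≠ 0 := by exact_mod_cast hx.ne'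
    refine eqOn_of_eq_ofReal
      (f := fun ν => ε * Complex.I * Complex.sin (ν * Real.pi) * hankelLaplace ε ν x)
      (g := fun ν => besselJ (-ν) x -
        Complex.exp (-(ε * (ν * Real.pi * Complex.I))) * besselJ ν x)
      (U := {ν : ℂ | -(1 / 2) < ν.re}) (a := -(1 / 2)) (b := 1 / 2) (isOpen_lt_re _)
      (isPreconnected_lt_re _) ?_ ?_ (by norm_num) (fun ν hν => by simpa using hν.1)
      (fun ν hν => hreal ν x (abs_lt.2 hν) hx) hν
    · exact DifferentiableOn.mul (by fun_prop)
        (differentiableOn_hankelLaplace_order hε (ofReal_mem_hankelRegion ε hx))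
    · have h1 := differentiable_besselJ_order hx0
      have h2 : Differentiable ℂ (fun ν : ℂ => besselJ (-ν) x) := h1.comp differentiable_neg
      exact (h2.sub (Differentiable.mul (by fun_prop) h1)).differentiableOn
  refine eqOn_of_eq_ofReal
    (f := fun z => ε * Complex.I * Complex.sin (ν * Real.pi) * hankelLaplace ε ν z)
    (g := fun z => besselJ (-ν) z -
        Complex.exp (-(ε * (ν * Real.pi * Complex.I))) * besselJ ν z)
    (isOpen_hankelRegion ε) (isPreconnected_hankelRegion hε)
    ((differentiableOn_hankelLaplace hε hν).const_mul _) ?_ one_pos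
    (fun x hx => ofReal_mem_hankelRegion ε hx.1) (fun x hx => horder x hx.1 ν hν) hz
  have hsub : hankelRegion ε ⊆ Complex.slitPlane := fun z hz => mem_slitPlane_of_mem_hankelRegion hz
  exact ((differentiableOn_besselJ _).mono hsub).sub
    (((differentiableOn_besselJ _).mono hsub).const_mul _)

theorem besselYQuot_eq {ε : ℝ} (hε : ε = 1 ∨ ε = -1) {ν : ℂ} (hν : -(1 / 2) < ν.re)
    (hs : Complex.sin (ν * Real.pi) ≠ 0) {z : ℂ} (hz : z ∈ hankelRegion ε) :
    besselYQuot ν z = -(ε * Complex.I) * (hankelLaplace ε ν z - besselJ ν z) := by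
  have h := sin_mul_hankelLaplace hε hν hz
  rw [exp_neg_eps_mul hε] at h
  rw [besselYQuot, div_eq_iff hs]
  linear_combination h

theorem eventually_sin_ne_zero {ν : ℂ} :
    ∀ᶠ μ in 𝓝[≠] ν, Complex.sin (μ * Real.pi) ≠ 0 := by
  have hd : Differentiable ℂ fun μ : ℂ => Complex.sin (μ * Real.pi) := by fun_prop
  rcases (hd.analyticAt ν).eventually_eq_zero_or_eventually_ne_zero with h | h
  · exfalso
    have h1 := (hd.differentiableOn.analyticOnNhd isOpen_univ).eqOn_zero_of_preconnected_of_eventuallyEq_zero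
      isPreconnected_univ (mem_univ ν) h
    have h2 := h1 (mem_univ (1 / 2 : ℂ))
    simp only [Pi.zero_apply] at h2
    rw [one_div_mul_eq_div, Complex.sin_pi_div_two] at h2
    exact one_ne_zero h2
  · exact h

theorem sin_mul_pi_ne_zero {ν : ℂ} (h : ¬ ∃ n : ℤ, ν = n) : Complex.sin (ν * Real.pi) ≠ 0 := by
  rw [Complex.sin_ne_zero_iff]
  intro n hn
  exact h ⟨n, mul_right_cancel₀ (by exact_mod_cast Real.pi_ne_zero) hn⟩

/-- At integer order `Y` is defined as a limit of quotients. These agree with the right-hand side at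
nearby non-integer orders, and the right-hand side is continuous in the order, so its value is the
limit. -/
theorem besselY_eq {ε : ℝ} (hε : ε = 1 ∨ ε = -1) {ν : ℂ} (hν : -(1 / 2) < ν.re)
    {z : ℂ} (hz : z ∈ hankelRegion ε) :
    besselY ν z = -(ε * Complex.I) * (hankelLaplace ε ν z - besselJ ν z) := by
  rw [besselY]
  split_ifs with hint
  · refine Tendsto.limUnder_eq ?_
    have hz0 := Complex.slitPlane_ne_zero (mem_slitPlane_of_mem_hankelRegion hz)
    have hmem : {ν : ℂ | -(1 / 2) < ν.re} ∈ 𝓝 ν := (isOpen_lt_re _).mem_nhds hν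
    have hc : ContinuousAt (fun ν => -(ε * Complex.I) * (hankelLaplace ε ν z - besselJ ν z)) ν :=
      (((differentiableOn_hankelLaplace_order hε hz).differentiableAt hmem).continuousAt.sub
        (differentiable_besselJ_order hz0 ν).continuousAt).const_mul _
    refine (hc.tendsto.mono_left nhdsWithin_le_nhds).congr' ?_
    filter_upwards [eventually_sin_ne_zero, nhdsWithin_le_nhds hmem] with μ hs hμ
    exact (besselYQuot_eq hε hμ hs hz).symm
  · exact besselYQuot_eq hε hν (sin_mul_pi_ne_zero hint) hz

theorem hankel1_eq {ν : ℂ} (hν : -(1 / 2) < ν.re) {z : ℂ} (hz : z ∈ hankelRegion 1) :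
    hankel1 ν z = hankelLaplace 1 ν z := by
  rw [hankel1, besselY_eq (Or.inl rfl) hν hz]
  push_cast
  linear_combination (besselJ ν z - hankelLaplace 1 ν z) * Complex.I_sq

theorem hankel2_eq {ν : ℂ} (hν : -(1 / 2) < ν.re) {z : ℂ} (hz : z ∈ hankelRegion (-1)) :
    hankel2 ν z = hankelLaplace (-1) ν z := by
  rw [hankel2, besselY_eq (Or.inr rfl) hν hz]
  push_cast
  linear_combination (besselJ ν z - hankelLaplace (-1) ν z) * Complex.I_sq

theorem hankel1_add_hankel2 (ν z : ℂ) : hankel1 ν z + hankel2 ν z = 2 * besselJ ν z := by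
  rw [hankel1, hankel2]; ring

/-- The cosine in the defining quotient vanishes at `±π/2`. Order `-1/2` arises for `α = 0` and is
the endpoint where the Laplace integral diverges; these identities reduce it to order `1/2`. -/
theorem besselY_half (z : ℂ) :
    besselY (1 / 2) z = -besselJ (-(1 / 2)) z ∧ besselY (-(1 / 2)) z = besselJ (1 / 2) z := by
  have h1 : ¬ ∃ n : ℤ, (1 / 2 : ℂ) = n := by
    rintro ⟨n, hn⟩
    have h2 : (1 : ℂ) = ((2 * n : ℤ) : ℂ) := by push_cast; linear_combination 2 * hn
    have h3 : (1 : ℤ) = 2 * n := by exact_mod_cast h2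
    omega
  have h2 : ¬ ∃ n : ℤ, (-(1 / 2) : ℂ) = n := by
    rintro ⟨n, hn⟩
    exact h1 ⟨-n, by push_cast; rw [← hn]; ring⟩
  have hp : (1 / 2 : ℂ) * Real.pi = Real.pi / 2 := by ring
  have hm : (-(1 / 2) : ℂ) * Real.pi = -(Real.pi / 2) := by ring
  constructor
  · rw [besselY, if_neg h1, besselYQuot, hp, Complex.cos_pi_div_two, Complex.sin_pi_div_two]
    ring
  · rw [besselY, if_neg h2, besselYQuot, hm, Complex.cos_neg, Complex.sin_neg,
      Complex.cos_pi_div_two, Complex.sin_pi_div_two, neg_neg]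
    ring

theorem hankel1_neg_half (z : ℂ) : hankel1 (-(1 / 2)) z = Complex.I * hankel1 (1 / 2) z := by
  rw [hankel1, hankel1, (besselY_half z).1, (besselY_half z).2]
  linear_combination besselJ (-(1 / 2)) z * Complex.I_sq

theorem hankel2_neg_half (z : ℂ) : hankel2 (-(1 / 2)) z = -Complex.I * hankel2 (1 / 2) z := by
  rw [hankel2, hankel2, (besselY_half z).1, (besselY_half z).2]
  linear_combination besselJ (-(1 / 2)) z * Complex.I_sq

theorem neg_half_lt_re {ν : ℝ} (hν : -(1 / 2) < ν) : -(1 / 2) < (ν : ℂ).re := by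
  simpa using hν

theorem differentiableOn_hankel1 {ν : ℝ} (hν : -(1 / 2) ≤ ν) :
    DifferentiableOn ℂ (hankel1 ν) (hankelRegion 1) := by
  have h : ∀ ν : ℝ, -(1 / 2) < ν → DifferentiableOn ℂ (hankel1 ν) (hankelRegion 1) := fun ν hν =>
    (differentiableOn_hankelLaplace (Or.inl rfl) (neg_half_lt_re hν)).congr
      fun z hz => hankel1_eq (neg_half_lt_re hν) hz
  rcases hν.eq_or_lt with rfl | hν
  · have h2 := (h (1 / 2) (by norm_num)).const_mul Complex.I
    push_cast at h2 ⊢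
    exact h2.congr fun z _ => hankel1_neg_half z
  · exact h ν hν

theorem hankelRegion_subset (ε : ℝ) : hankelRegion ε ⊆ Complex.slitPlane :=
  fun _ hz => mem_slitPlane_of_mem_hankelRegion hz

theorem hankel2_eq_sub (ν z : ℂ) : hankel2 ν z = 2 * besselJ ν z - hankel1 ν z :=
  eq_sub_of_add_eq' (hankel1_add_hankel2 ν z)

/-- The Laplace integral for `H^{(2)}` lives on the region turned downwards; on the one turned
upwards holomorphy comes from `H^{(2)} = 2J - H^{(1)}`. -/
theorem differentiableOn_hankel2 {ν : ℝ} (hν : -(1 / 2) ≤ ν) :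
    DifferentiableOn ℂ (hankel2 ν) (hankelRegion 1) :=
  ((((differentiableOn_besselJ ν).mono (hankelRegion_subset 1)).const_mul 2).sub
    (differentiableOn_hankel1 hν)).congr fun z _ => hankel2_eq_sub ν z

/-! ### Continuation by a half-turn -/

theorem log_eq_log_neg_add {z : ℂ} (hz : 0 < z.im) :
    Complex.log z = Complex.log (-z) + Real.pi * Complex.I := by
  rw [Complex.log, Complex.log, norm_neg, Complex.arg_neg_eq_arg_sub_pi_of_im_pos hz]
  push_cast
  ring

theorem cpow_eq_cpow_neg {z : ℂ} (hz : 0 < z.im) (c : ℂ) :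
    z ^ c = Complex.exp (c * (Real.pi * Complex.I)) * (-z) ^ c := by
  have h0 : z ≠ 0 := fun h => by simp [h] at hz
  rw [Complex.cpow_def_of_ne_zero h0, Complex.cpow_def_of_ne_zero (neg_ne_zero.2 h0),
    log_eq_log_neg_add hz, ← Complex.exp_add]
  congr 1
  ring

theorem besselJ_eq_besselJ_neg {z : ℂ} (hz : 0 < z.im) (ν : ℂ) :
    besselJ ν z = Complex.exp (ν * (Real.pi * Complex.I)) * besselJ ν (-z) := by
  rw [besselJ_eq, besselJ_eq, besselE_neg, cpow_eq_cpow_neg (by simpa using hz), neg_div]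
  ring

/-- The Laplace integrals for `H^{(1)}` at `z` and for `H^{(2)}` at `-z` have the same argument
`-iz`, so only the elementary prefactors differ. -/
theorem hankel1_eq_hankel2_neg {ν : ℝ} (hν : -(1 / 2) ≤ ν) {z : ℂ} (hz : 0 < z.im) :
    hankel1 ν z = -Complex.exp (-(ν * (Real.pi * Complex.I))) * hankel2 ν (-z) := by
  have key : ∀ ν : ℝ, -(1 / 2) < ν →
      hankel1 ν z = -Complex.exp (-(ν * (Real.pi * Complex.I))) * hankel2 ν (-z) := by
    intro ν hν
    rw [hankel1_eq (neg_half_lt_re hν) (Or.inr (by simpa using hz)),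
      hankel2_eq (neg_half_lt_re hν) (Or.inr (by simpa using hz)), hankelLaplace, hankelLaplace,
      cpow_eq_cpow_neg hz]
    have h1 : -(((1 : ℝ) : ℂ) * (Complex.I * z)) = -(((-1 : ℝ) : ℂ) * (Complex.I * -z)) := by
      push_cast; ring
    have h2 : Complex.exp (-(1 / 2) * (Real.pi * Complex.I)) *
        Complex.exp (((1 : ℝ) : ℂ) * (Complex.I * (z - ν * Real.pi / 2 - Real.pi / 4))) =
        -Complex.exp (-(ν * (Real.pi * Complex.I))) *
        Complex.exp (((-1 : ℝ) : ℂ) * (Complex.I * (-z - ν * Real.pi / 2 - Real.pi / 4))) := by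
      rw [← neg_one_mul (Complex.exp (-(ν * (Real.pi * Complex.I))))]
      rw [show (-1 : ℂ) = Complex.exp (-(Real.pi * Complex.I)) by
        rw [Complex.exp_neg, Complex.exp_pi_mul_I]; norm_num]
      rw [← Complex.exp_add, ← Complex.exp_add, ← Complex.exp_add]
      congr 1
      push_cast
      ring
    rw [h1]
    linear_combination (√(2 / Real.pi) * (-z) ^ (-(1 / 2) : ℂ) *
      (laplaceG (ν - 1 / 2) (-(((-1 : ℝ) : ℂ) * (Complex.I * -z))) /
        Complex.Gamma (ν + 1 / 2))) * h2
  rcases hν.eq_or_lt with rfl | hν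
  · have h := key (1 / 2) (by norm_num)
    push_cast at h ⊢
    rw [hankel1_neg_half, hankel2_neg_half, h]
    rw [show -((1 / 2 : ℂ) * (Real.pi * Complex.I)) = -Real.pi / 2 * Complex.I by ring,
      show -(-(1 / 2 : ℂ) * (Real.pi * Complex.I)) = Real.pi / 2 * Complex.I by ring,
      Complex.exp_neg_pi_div_two_mul_I, Complex.exp_pi_div_two_mul_I]
    ring
  · exact key ν hν

theorem hankel2_eq_hankel_neg {ν : ℝ} (hν : -(1 / 2) ≤ ν) {z : ℂ} (hz : 0 < z.im) :
    hankel2 ν z = Complex.exp (ν * (Real.pi * Complex.I)) * hankel1 ν (-z) +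
      (Complex.exp (ν * (Real.pi * Complex.I)) + Complex.exp (-(ν * (Real.pi * Complex.I)))) *
        hankel2 ν (-z) := by
  rw [hankel2_eq_sub, hankel1_eq_hankel2_neg hν hz, besselJ_eq_besselJ_neg hz]
  linear_combination -Complex.exp (ν * (Real.pi * Complex.I)) * hankel1_add_hankel2 ν (-z)

/-! ### Asymptotics at infinity -/

/-- The Hankel function of the first kind divided by its leading term at infinity. -/
def hankelRatio1 (ν : ℝ) (z : ℂ) : ℂ :=
  √(Real.pi / 2) * z ^ (1 / 2 : ℂ) * hankel1 ν z *
    Complex.exp (-(Complex.I * (z - ν * Real.pi / 2 - Real.pi / 4)))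

/-- The Hankel function of the second kind divided by its leading term at infinity. -/
def hankelRatio2 (ν : ℝ) (z : ℂ) : ℂ :=
  √(Real.pi / 2) * z ^ (1 / 2 : ℂ) * hankel2 ν z *
    Complex.exp (Complex.I * (z - ν * Real.pi / 2 - Real.pi / 4))

theorem hankelRatio1_neg_half (z : ℂ) : hankelRatio1 (-(1 / 2)) z = hankelRatio1 (1 / 2) z := by
  rw [hankelRatio1, hankelRatio1]
  push_cast
  rw [hankel1_neg_half]
  have h : Complex.I * Complex.exp (-(Complex.I * (z - -(1 / 2) * Real.pi / 2 - Real.pi / 4))) =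
      Complex.exp (-(Complex.I * (z - 1 / 2 * Real.pi / 2 - Real.pi / 4))) := by
    conv_lhs => enter [1]; rw [← Complex.exp_pi_div_two_mul_I]
    rw [← Complex.exp_add]
    congr 1
    ring
  rw [← h]
  ring

theorem hankelRatio2_neg_half (z : ℂ) : hankelRatio2 (-(1 / 2)) z = hankelRatio2 (1 / 2) z := by
  rw [hankelRatio2, hankelRatio2]
  push_cast
  rw [hankel2_neg_half]
  have h : -Complex.I * Complex.exp (Complex.I * (z - -(1 / 2) * Real.pi / 2 - Real.pi / 4)) =
      Complex.exp (Complex.I * (z - 1 / 2 * Real.pi / 2 - Real.pi / 4)) := by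
    conv_lhs => enter [1]; rw [← Complex.exp_neg_pi_div_two_mul_I]
    rw [← Complex.exp_add]
    congr 1
    ring
  rw [← h]
  ring

theorem sqrt_mul_cpow_mul_hankelLaplace {ε ν : ℝ} {z : ℂ} (hz : z ≠ 0) :
    √(Real.pi / 2) * z ^ (1 / 2 : ℂ) * hankelLaplace ε ν z =
      Complex.exp (ε * (Complex.I * (z - ν * Real.pi / 2 - Real.pi / 4))) *
      (laplaceG (ν - 1 / 2) (-(ε * (Complex.I * z))) / Complex.Gamma (ν + 1 / 2)) := by
  have h1 : ((√(Real.pi / 2) : ℝ) : ℂ) * (√(2 / Real.pi) : ℝ) = 1 := by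
    rw [← Complex.ofReal_mul, ← Real.sqrt_mul (by positivity), div_mul_div_comm, mul_comm,
      div_self (by positivity), Real.sqrt_one, Complex.ofReal_one]
  have h2 : z ^ (1 / 2 : ℂ) * z ^ (-(1 / 2) : ℂ) = 1 := by
    rw [← Complex.cpow_add _ _ hz, add_neg_cancel, Complex.cpow_zero]
  rw [hankelLaplace]
  linear_combination (z ^ (1 / 2 : ℂ) * z ^ (-(1 / 2) : ℂ) *
    Complex.exp (ε * (Complex.I * (z - ν * Real.pi / 2 - Real.pi / 4))) *
      (laplaceG (ν - 1 / 2) (-(ε * (Complex.I * z))) / Complex.Gamma (ν + 1 / 2))) * h1 +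
    (Complex.exp (ε * (Complex.I * (z - ν * Real.pi / 2 - Real.pi / 4))) *
      (laplaceG (ν - 1 / 2) (-(ε * (Complex.I * z))) / Complex.Gamma (ν + 1 / 2))) * h2

theorem exp_mul_exp_neg (w : ℂ) : Complex.exp w * Complex.exp (-w) = 1 := by
  rw [← Complex.exp_add, add_neg_cancel, Complex.exp_zero]

theorem exists_norm_laplaceG_div_sub_one_le {ν : ℝ} (hν : -(1 / 2) < ν) :
    ∃ C > 0, ∀ x : ℂ, InCone (3 / 4) x → 1 ≤ ‖x‖ →
      ‖laplaceG (ν - 1 / 2) x / Complex.Gamma (ν + 1 / 2) - 1‖ ≤ C / ‖x‖ := by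
  obtain ⟨C, hC, h⟩ := exists_norm_laplaceG_sub_Gamma_le (κ := 3 / 4) (μ := ν - 1 / 2)
    (by norm_num) (by norm_num) (by linarith)
  have hG : Complex.Gamma (ν + 1 / 2) ≠ 0 :=
    Complex.Gamma_ne_zero_of_re_pos (by simp; linarith)
  have hGn : 0 < ‖Complex.Gamma (ν + 1 / 2)‖ := norm_pos_iff.2 hG
  refine ⟨C / ‖Complex.Gamma (ν + 1 / 2)‖, by positivity, fun x hx hx1 => ?_⟩
  have h1 := h x hx hx1
  push_cast at h1
  rw [show (ν : ℂ) - 1 / 2 + 1 = ν + 1 / 2 by ring] at h1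
  rw [div_sub_one hG, norm_div, div_right_comm]
  gcongr

/-- The Laplace variable `-iz` has real part `Im z`, so the hypothesis is the cone condition with `κ
= 3/4`. The sectors need only `1/2 = sin(π/6)`; the slack is used when passing to `-z` and to the
45° lines below. -/
theorem exists_norm_hankelRatio1_sub_one_le {ν : ℝ} (hν : -(1 / 2) ≤ ν) :
    ∃ C > 0, ∀ z ∈ hankelRegion 1, -(3 / 4) * ‖z‖ ≤ z.im → 1 ≤ ‖z‖ →
      ‖hankelRatio1 ν z - 1‖ ≤ C / ‖z‖ := by
  have key : ∀ ν : ℝ, -(1 / 2) < ν → ∃ C > 0, ∀ z ∈ hankelRegion 1, -(3 / 4) * ‖z‖ ≤ z.im →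
      1 ≤ ‖z‖ → ‖hankelRatio1 ν z - 1‖ ≤ C / ‖z‖ := by
    intro ν hν
    obtain ⟨C, hC, h⟩ := exists_norm_laplaceG_div_sub_one_le hν
    refine ⟨C, hC, fun z hz him hz1 => ?_⟩
    have hn : ‖-(((1 : ℝ) : ℂ) * (Complex.I * z))‖ = ‖z‖ := by simp
    have h1 := h (-(((1 : ℝ) : ℂ) * (Complex.I * z))) (by rw [InCone, hn]; simpa using him)
      (by rwa [hn])
    rw [hn] at h1
    convert h1 using 3
    rw [hankelRatio1, hankel1_eq (neg_half_lt_re hν) hz,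
      sqrt_mul_cpow_mul_hankelLaplace (Complex.slitPlane_ne_zero (hankelRegion_subset 1 hz))]
    push_cast
    rw [one_mul, mul_right_comm, exp_mul_exp_neg, one_mul]
  rcases hν.eq_or_lt with rfl | hν
  · simpa only [hankelRatio1_neg_half] using key (1 / 2) (by norm_num)
  · exact key ν hν

theorem exists_norm_hankelRatio2_sub_one_le_direct {ν : ℝ} (hν : -(1 / 2) ≤ ν) :
    ∃ C > 0, ∀ z ∈ hankelRegion (-1), z.im ≤ 3 / 4 * ‖z‖ → 1 ≤ ‖z‖ →
      ‖hankelRatio2 ν z - 1‖ ≤ C / ‖z‖ := by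
  have key : ∀ ν : ℝ, -(1 / 2) < ν → ∃ C > 0, ∀ z ∈ hankelRegion (-1), z.im ≤ 3 / 4 * ‖z‖ →
      1 ≤ ‖z‖ → ‖hankelRatio2 ν z - 1‖ ≤ C / ‖z‖ := by
    intro ν hν
    obtain ⟨C, hC, h⟩ := exists_norm_laplaceG_div_sub_one_le hν
    refine ⟨C, hC, fun z hz him hz1 => ?_⟩
    have hn : ‖-(((-1 : ℝ) : ℂ) * (Complex.I * z))‖ = ‖z‖ := by simp
    have h1 := h (-(((-1 : ℝ) : ℂ) * (Complex.I * z))) (by rw [InCone, hn]; simp; linarith)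
      (by rwa [hn])
    rw [hn] at h1
    convert h1 using 3
    rw [hankelRatio2, hankel2_eq (neg_half_lt_re hν) hz,
      sqrt_mul_cpow_mul_hankelLaplace (Complex.slitPlane_ne_zero (hankelRegion_subset (-1) hz))]
    have he := exp_mul_exp_neg (Complex.I * (z - ν * Real.pi / 2 - Real.pi / 4))
    push_cast
    rw [neg_one_mul, mul_right_comm, mul_comm (Complex.exp _) (Complex.exp _), he, one_mul]
  rcases hν.eq_or_lt with rfl | hν
  · simpa only [hankelRatio2_neg_half] using key (1 / 2) (by norm_num)
  · exact key ν hν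

theorem hankelRatio2_eq_neg {ν : ℝ} (hν : -(1 / 2) ≤ ν) {z : ℂ} (hz : 0 < z.im) :
    hankelRatio2 ν z = hankelRatio1 ν (-z) +
      (Complex.exp (ν * (Real.pi * Complex.I)) + Complex.exp (-(ν * (Real.pi * Complex.I)))) *
        Complex.I * Complex.exp (2 * (Complex.I * z)) * hankelRatio2 ν (-z) := by
  have h1 : Complex.exp (1 / 2 * (Real.pi * Complex.I)) = Complex.I := by
    conv_rhs => rw [← Complex.exp_pi_div_two_mul_I]
    congr 1
    ring
  have h2 : Complex.I * Complex.exp (ν * (Real.pi * Complex.I)) *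
      Complex.exp (Complex.I * (z - ν * Real.pi / 2 - Real.pi / 4)) =
      Complex.exp (-(Complex.I * (-z - ν * Real.pi / 2 - Real.pi / 4))) := by
    conv_lhs => enter [1, 1]; rw [← Complex.exp_pi_div_two_mul_I]
    rw [← Complex.exp_add, ← Complex.exp_add]
    congr 1
    ring
  have h3 : Complex.exp (Complex.I * (z - ν * Real.pi / 2 - Real.pi / 4)) =
      Complex.exp (2 * (Complex.I * z)) *
        Complex.exp (Complex.I * (-z - ν * Real.pi / 2 - Real.pi / 4)) := by
    rw [← Complex.exp_add]
    congr 1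
    ring
  rw [hankelRatio2, hankelRatio1, hankelRatio2, hankel2_eq_hankel_neg hν hz,
    cpow_eq_cpow_neg hz, h1, ← h2, h3]
  ring

/-- By the half-turn formula the ratio at `z` is the `H^{(1)}`-ratio at `-z` plus a multiple of
`e^{2iz}`. Since `Im z ≥ |z|/2`, the latter is at most `e^{-|z|} ≤ 1/|z|`, and `-z` lies where the
direct estimates apply. -/
theorem exists_norm_hankelRatio2_sub_one_le_left {ν : ℝ} (hν : -(1 / 2) ≤ ν) :
    ∃ C > 0, ∀ z : ℂ, z.re < 0 → ‖z‖ / 2 ≤ z.im → z.im ≤ 3 / 4 * ‖z‖ → 1 ≤ ‖z‖ →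
      ‖hankelRatio2 ν z - 1‖ ≤ C / ‖z‖ := by
  obtain ⟨C₁, hC₁, h₁⟩ := exists_norm_hankelRatio1_sub_one_le hν
  obtain ⟨C₂, hC₂, h₂⟩ := exists_norm_hankelRatio2_sub_one_le_direct hν
  set K : ℂ := (Complex.exp (ν * (Real.pi * Complex.I)) +
    Complex.exp (-(ν * (Real.pi * Complex.I)))) * Complex.I with hK
  refine ⟨C₁ + ‖K‖ * (C₂ + 1), by positivity, fun z hre him him' hz => ?_⟩
  have hn : 0 < ‖z‖ := by linarith
  have hpos : 0 < z.im := by linarith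
  rw [hankelRatio2_eq_neg hν hpos, ← hK]
  have e₁ := h₁ (-z) (Or.inl (by simpa using hre)) (by rw [norm_neg, Complex.neg_im]; linarith)
    (by rwa [norm_neg])
  have e₂ := h₂ (-z) (Or.inl (by simpa using hre)) (by rw [norm_neg, Complex.neg_im]; linarith)
    (by rwa [norm_neg])
  rw [norm_neg] at e₁ e₂
  have e₃ : ‖hankelRatio2 ν (-z)‖ ≤ C₂ + 1 := by
    have h3 : C₂ / ‖z‖ ≤ C₂ := div_le_self hC₂.le hz
    have h4 := norm_add_le (hankelRatio2 ν (-z) - 1) 1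
    rw [sub_add_cancel, norm_one] at h4
    linarith
  have e₄ : ‖Complex.exp (2 * (Complex.I * z))‖ ≤ 1 / ‖z‖ := by
    rw [Complex.norm_exp]
    have h3 : (2 * (Complex.I * z)).re = -(2 * z.im) := by simp
    rw [h3, Real.exp_neg, ← one_div]
    gcongr
    linarith [Real.add_one_le_exp (2 * z.im)]
  calc ‖hankelRatio1 ν (-z) + K * Complex.exp (2 * (Complex.I * z)) * hankelRatio2 ν (-z) - 1‖
      = ‖(hankelRatio1 ν (-z) - 1) +
          K * Complex.exp (2 * (Complex.I * z)) * hankelRatio2 ν (-z)‖ := by ring_nf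
    _ ≤ C₁ / ‖z‖ + ‖K‖ * (1 / ‖z‖) * (C₂ + 1) := by
        refine (norm_add_le _ _).trans ?_
        rw [norm_mul, norm_mul]
        gcongr
    _ = (C₁ + ‖K‖ * (C₂ + 1)) / ‖z‖ := by ring

theorem differentiableAt_hankelRatio2 {ν : ℝ} (hν : -(1 / 2) ≤ ν) {z : ℂ} (hz : z ∈ hankelRegion 1) :
    DifferentiableAt ℂ (hankelRatio2 ν) z := by
  have h1 := (differentiableOn_hankel2 hν).differentiableAt ((isOpen_hankelRegion 1).mem_nhds hz)
  have h2 : DifferentiableAt ℂ (fun z : ℂ => z ^ (1 / 2 : ℂ)) z :=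
    differentiableAt_id.cpow_const (hankelRegion_subset 1 hz)
  exact ((h2.const_mul _).mul h1).mul (by fun_prop)

/-- The a priori growth bound required by Phragmén–Lindelöf: write `H^{(2)} = 2J - H^{(1)}`, bound
`J` by its power series, and note that the phase factors are bounded when `Im z > 0`. -/
theorem exists_norm_hankelRatio2_le_exp {ν : ℝ} (hν : -(1 / 2) ≤ ν) :
    ∃ C > 0, ∀ z : ℂ, 0 < z.im → 1 ≤ ‖z‖ → ‖hankelRatio2 ν z‖ ≤ C * Real.exp (3 * ‖z‖) := by
  obtain ⟨C₁, hC₁, h₁⟩ := exists_norm_hankelRatio1_sub_one_le hν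
  obtain ⟨C₂, hC₂, h₂⟩ := exists_norm_besselE_le hν
  obtain ⟨N, hN⟩ := exists_nat_ge (ν + 1 / 2)
  set s : ℝ := √(Real.pi / 2) with hs
  have hs0 : 0 ≤ s := Real.sqrt_nonneg _
  refine ⟨s * 2 * (2⁻¹ ^ ν * N.factorial * C₂) + (C₁ + 1), by positivity, fun z hz hz1 => ?_⟩
  have hn : 0 < ‖z‖ := by linarith
  have hreg : z ∈ hankelRegion 1 := Or.inr (by simpa using hz)
  have hphase : (Complex.I * (z - ν * Real.pi / 2 - Real.pi / 4)).re = -z.im := by simp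
  set w := Complex.I * (z - ν * Real.pi / 2 - Real.pi / 4) with hw
  have hexp : ‖Complex.exp w‖ ≤ 1 := by
    rw [Complex.norm_exp, hphase]
    exact Real.exp_le_one_iff.2 (by linarith)
  have hsplit : hankelRatio2 ν z = s * 2 * (z ^ (1 / 2 : ℂ) * besselJ ν z) * Complex.exp w -
      hankelRatio1 ν z * (Complex.exp w * Complex.exp w) := by
    rw [hankelRatio2, hankel2_eq_sub, hankelRatio1, ← hw, ← hs]
    linear_combination (s * z ^ (1 / 2 : ℂ) * hankel1 ν z * Complex.exp w) * exp_mul_exp_neg w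
  have hr1 : ‖hankelRatio1 ν z‖ ≤ C₁ + 1 := by
    have h3 : C₁ / ‖z‖ ≤ C₁ := div_le_self hC₁.le hz1
    have h4 := norm_add_le (hankelRatio1 ν z - 1) 1
    rw [sub_add_cancel, norm_one] at h4
    linarith [h₁ z hreg (by nlinarith) hz1]
  have hJ : ‖z ^ (1 / 2 : ℂ) * besselJ ν z‖ ≤
      2⁻¹ ^ ν * N.factorial * C₂ * Real.exp (3 * ‖z‖) := by
    rw [besselJ_eq, norm_mul, norm_mul, show (1 / 2 : ℂ) = ((1 / 2 : ℝ) : ℂ) by push_cast; rfl,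
      Complex.norm_cpow_real, Complex.norm_cpow_real, norm_div, Complex.norm_ofNat,
      div_eq_mul_inv ‖z‖, Real.mul_rpow hn.le (by norm_num)]
    have h5 : ‖z‖ ^ (1 / 2 : ℝ) * ‖z‖ ^ ν ≤ N.factorial * Real.exp ‖z‖ := by
      rw [← Real.rpow_add hn]
      calc ‖z‖ ^ (1 / 2 + ν) ≤ ‖z‖ ^ (N : ℝ) :=
            Real.rpow_le_rpow_of_exponent_le hz1 (by linarith)
        _ = ‖z‖ ^ N := Real.rpow_natCast _ _
        _ ≤ N.factorial * Real.exp ‖z‖ := by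
            have := Real.pow_div_factorial_le_exp ‖z‖ hn.le N
            rwa [div_le_iff₀' (by positivity)] at this
    calc ‖z‖ ^ (1 / 2 : ℝ) * (‖z‖ ^ ν * 2⁻¹ ^ ν * ‖besselE ν z‖)
        = (‖z‖ ^ (1 / 2 : ℝ) * ‖z‖ ^ ν) * 2⁻¹ ^ ν * ‖besselE ν z‖ := by ring
      _ ≤ (N.factorial * Real.exp ‖z‖) * 2⁻¹ ^ ν * (C₂ * Real.exp (2 * ‖z‖)) := by
          gcongr
          exact h₂ z
      _ = 2⁻¹ ^ ν * N.factorial * C₂ * (Real.exp ‖z‖ * Real.exp (2 * ‖z‖)) := by ring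
      _ = _ := by rw [← Real.exp_add]; ring_nf
  have he1 : 1 ≤ Real.exp (3 * ‖z‖) := Real.one_le_exp (by positivity)
  rw [hsplit]
  calc _ ≤ s * 2 * (2⁻¹ ^ ν * N.factorial * C₂ * Real.exp (3 * ‖z‖)) * 1 + (C₁ + 1) * (1 * 1) := by
        refine (norm_sub_le _ _).trans ?_
        rw [norm_mul, norm_mul, norm_mul, norm_mul (hankelRatio1 ν z), norm_mul (Complex.exp w),
          Complex.norm_real, Real.norm_of_nonneg hs0, Complex.norm_ofNat]
        gcongr
    _ ≤ s * 2 * (2⁻¹ ^ ν * N.factorial * C₂ * Real.exp (3 * ‖z‖)) +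
          (C₁ + 1) * Real.exp (3 * ‖z‖) := by
        rw [mul_one, mul_one, mul_one]
        gcongr
        exact le_mul_of_one_le_right (by positivity) he1
    _ = _ := by ring

/-- Along the 45° lines `Im z/|z|` is about `1/√2 < 3/4`; from radius `20` on this margin absorbs
the shift by `1`. -/
theorem im_le_of_im_le_abs_re_add_one {z : ℂ} (hz : 20 ≤ ‖z‖) (h : z.im ≤ |z.re| + 1) :
    z.im ≤ 3 / 4 * ‖z‖ := by
  by_contra! hcon
  have h1 : ‖z‖ ^ 2 = |z.re| ^ 2 + z.im ^ 2 := by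
    rw [← Complex.normSq_eq_norm_sq, Complex.normSq_apply, sq_abs]; ring
  nlinarith [abs_nonneg z.re]

/-- In the sector around the positive imaginary axis, where the Laplace integrals give no uniform
estimate, the asymptotics follow from the Phragmén–Lindelöf principle. -/
theorem exists_norm_hankelRatio2_sub_one_le_upper {ν : ℝ} (hν : -(1 / 2) ≤ ν) :
    ∃ C > 0, ∀ z : ℂ, |z.re| ≤ z.im - 1 → ‖hankelRatio2 ν z - 1‖ ≤ C / ‖z‖ := by
  obtain ⟨C₁, hC₁, h₁⟩ := exists_norm_hankelRatio2_sub_one_le_direct hν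
  obtain ⟨C₂, hC₂, h₂⟩ := exists_norm_hankelRatio2_sub_one_le_left hν
  obtain ⟨C₃, hC₃, h₃⟩ := exists_norm_hankelRatio2_le_exp hν
  -- Boundedness of `F` is exactly the `1/z` rate. On the edges `Im z = |Re z| + 1` it follows from
  -- the right and left estimates for large `z`, and from compactness otherwise; the shift by `1`
  -- keeps the sector away from `0`.
  set F : ℂ → ℂ := fun z => z * (hankelRatio2 ν z - 1) with hF
  have hreg : ∀ z : ℂ, 0 < z.im → z ∈ hankelRegion 1 := fun z hz => Or.inr (by simpa using hz)
  have hFd : ∀ z : ℂ, 0 < z.im → DifferentiableAt ℂ F z := fun z hz =>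
    differentiableAt_id.mul ((differentiableAt_hankelRatio2 hν (hreg z hz)).sub_const 1)
  have hcomp : IsCompact (Metric.closedBall (0 : ℂ) 20 ∩ {z : ℂ | 1 ≤ z.im}) :=
    (isCompact_closedBall _ _).inter_right (isClosed_le continuous_const Complex.continuous_im)
  obtain ⟨C₀, hC₀⟩ := hcomp.exists_bound_of_continuousOn (f := F) fun z hz =>
    (hFd z (by linarith [hz.2.out])).continuousAt.continuousWithinAt
  set M := max C₀ (max C₁ C₂) with hM
  have hedge : ∀ z : ℂ, z.im = |z.re| + 1 → ‖F z‖ ≤ M := by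
    intro z hz
    have hz1 : 1 ≤ z.im := by linarith [abs_nonneg z.re]
    rcases le_or_gt ‖z‖ 20 with hn | hn
    · exact (hC₀ z ⟨by simpa using hn, hz1⟩).trans (le_max_left _ _)
    · have him := im_le_of_im_le_abs_re_add_one hn.le hz.le
      have hn0 : 0 < ‖z‖ := by linarith
      rw [hF]
      simp only
      rw [norm_mul, mul_comm]
      have h0 : z.re ≠ 0 := by
        intro h0
        have h4 : ‖z‖ = 1 := by
          have h5 := Complex.sq_norm_sub_sq_re z
          rw [h0, hz, h0] at h5
          norm_num at h5
          exact h5.resolve_right (by linarith)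
        linarith
      rcases h0.lt_or_gt with hre | hre
      · have h5 : ‖z‖ / 2 ≤ z.im := by
          have := Complex.norm_le_abs_re_add_abs_im z
          rw [abs_of_pos (by linarith : 0 < z.im)] at this
          linarith
        have h4 := h₂ z hre h5 him (by linarith)
        rw [le_div_iff₀ hn0] at h4
        exact h4.trans ((le_max_right _ _).trans (le_max_right _ _))
      · have h4 := h₁ z (Or.inl hre) him (by linarith)
        rw [le_div_iff₀ hn0] at h4
        exact h4.trans ((le_max_left _ _).trans (le_max_right _ _))
  -- The map `ζ ↦ i + (1+i)ζ` carries the first quadrant onto the sector `|Re z| ≤ Im z - 1`.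
  set g : ℂ → ℂ := fun ζ => F (Complex.I + (1 + Complex.I) * ζ) with hg
  have him : ∀ ζ : ℂ, (Complex.I + (1 + Complex.I) * ζ).im = 1 + ζ.re + ζ.im := fun ζ => by
    simp; ring
  have hre : ∀ ζ : ℂ, (Complex.I + (1 + Complex.I) * ζ).re = ζ.re - ζ.im := fun ζ => by simp
  have hd : DiffContOnCl ℂ g (Ioi 0 ×ℂ Ioi 0) := by
    refine DifferentiableOn.diffContOnCl fun ζ hζ => ?_
    rw [Complex.closure_reProdIm, closure_Ioi] at hζ
    have hζ1 : 0 ≤ ζ.re := hζ.1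
    have hζ2 : 0 ≤ ζ.im := hζ.2
    have h4 := hFd (Complex.I + (1 + Complex.I) * ζ) (by rw [him]; linarith)
    exact (DifferentiableAt.comp (f := fun ζ : ℂ => Complex.I + (1 + Complex.I) * ζ) ζ h4
      (by fun_prop)).differentiableWithinAt
  have hB : ∃ c < (2 : ℝ), ∃ B, g =O[Bornology.cobounded ℂ ⊓ 𝓟 (Ioi 0 ×ℂ Ioi 0)]
      fun ζ => Real.exp (B * ‖ζ‖ ^ c) := by
    -- Exponential growth of order `1` is below the critical order `2` of a right angle. The
    -- constants come from `4|z| ≤ 4 + 8|ζ|`.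
    refine ⟨1, by norm_num, 8, IsBigO.of_bound ((C₃ + 1) * Real.exp 4) ?_⟩
    filter_upwards [mem_inf_of_right (mem_principal_self _)] with ζ hζ
    have hζ1 : 0 < ζ.re := hζ.1
    have hζ2 : 0 < ζ.im := hζ.2
    set z := Complex.I + (1 + Complex.I) * ζ with hz
    have hzim : 1 ≤ z.im := by rw [him]; linarith
    have hz1 : 1 ≤ ‖z‖ := hzim.trans ((le_abs_self _).trans (Complex.abs_im_le_norm z))
    have hzn : ‖z‖ ≤ 1 + 2 * ‖ζ‖ := by
      refine (norm_add_le _ _).trans ?_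
      rw [Complex.norm_I, norm_mul]
      gcongr
      refine (norm_add_le _ _).trans ?_
      rw [Complex.norm_I, norm_one]
      norm_num
    have h4 := h₃ z (by linarith) hz1
    rw [Real.rpow_one, Real.norm_of_nonneg (Real.exp_pos _).le]
    calc ‖g ζ‖ = ‖z‖ * ‖hankelRatio2 ν z - 1‖ := by rw [hg, hF]; simp only; rw [norm_mul]
      _ ≤ Real.exp ‖z‖ * (C₃ * Real.exp (3 * ‖z‖) + 1 * Real.exp (3 * ‖z‖)) := by
          gcongr
          · linarith [Real.add_one_le_exp ‖z‖]
          · refine (norm_sub_le _ _).trans ?_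
            rw [norm_one, one_mul]
            gcongr
            exact Real.one_le_exp (by positivity)
      _ = (C₃ + 1) * (Real.exp ‖z‖ * Real.exp (3 * ‖z‖)) := by ring
      _ = (C₃ + 1) * Real.exp (4 * ‖z‖) := by rw [← Real.exp_add]; ring_nf
      _ ≤ (C₃ + 1) * Real.exp (4 + 8 * ‖ζ‖) := by gcongr; linarith
      _ = _ := by rw [Real.exp_add]; ring
  refine ⟨M, lt_of_lt_of_le hC₁ ((le_max_left _ _).trans (le_max_right _ _)), fun z hz => ?_⟩
  have hzim : 1 ≤ z.im := by linarith [abs_nonneg z.re]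
  have hn0 : 0 < ‖z‖ := by
    linarith [(le_abs_self _).trans (Complex.abs_im_le_norm z)]
  have hz' := abs_le.1 hz
  have hgz := PhragmenLindelof.quadrant_I (C := M)
    (z := ⟨(z.re + (z.im - 1)) / 2, (z.im - 1 - z.re) / 2⟩) hd hB
    (fun x hx => hedge _ (by
      rw [him, hre]
      simp [abs_of_nonneg hx, add_comm]))
    (fun x hx => hedge _ (by
      rw [him, hre]
      simp [abs_of_nonneg hx, add_comm]))
    (by simp only; linarith) (by simp only; linarith)
  have hzeq : Complex.I + (1 + Complex.I) *
      (⟨(z.re + (z.im - 1)) / 2, (z.im - 1 - z.re) / 2⟩ : ℂ) = z := by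
    apply Complex.ext
    · rw [hre]; ring
    · rw [him]; ring
  rw [hg] at hgz
  simp only at hgz
  rw [hzeq, hF] at hgz
  simp only at hgz
  rw [le_div_iff₀ hn0, mul_comm, ← norm_mul]
  exact hgz

theorem exists_norm_hankelRatio2_sub_one_le {ν : ℝ} (hν : -(1 / 2) ≤ ν) :
    ∃ C > 0, ∀ z : ℂ, (0 < z.re ∧ |z.im| ≤ ‖z‖ / 2) ∨ ‖z‖ / 2 ≤ z.im → 20 ≤ ‖z‖ →
      ‖hankelRatio2 ν z - 1‖ ≤ C / ‖z‖ := by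
  obtain ⟨C₁, hC₁, h₁⟩ := exists_norm_hankelRatio2_sub_one_le_direct hν
  obtain ⟨C₂, hC₂, h₂⟩ := exists_norm_hankelRatio2_sub_one_le_left hν
  obtain ⟨C₃, hC₃, h₃⟩ := exists_norm_hankelRatio2_sub_one_le_upper hν
  refine ⟨max C₁ (max C₂ C₃), lt_max_of_lt_left hC₁, fun z hz hn => ?_⟩
  have hn0 : 0 < ‖z‖ := by linarith
  rcases le_total (|z.re|) (z.im - 1) with h | h
  · refine (h₃ z h).trans ?_
    gcongr
    exact (le_max_right _ _).trans (le_max_right _ _)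
  · have him := im_le_of_im_le_abs_re_add_one hn (by linarith)
    have hcase : 0 < z.re ∨ (z.re < 0 ∧ ‖z‖ / 2 ≤ z.im) := by
      rcases hz with hz | hz
      · exact Or.inl hz.1
      · rcases lt_trichotomy z.re 0 with h0 | h0 | h0
        · exact Or.inr ⟨h0, hz⟩
        · rw [h0, abs_zero] at h
          linarith
        · exact Or.inl h0
    rcases hcase with h0 | ⟨h0, h1⟩
    · refine (h₁ z (Or.inl h0) him (by linarith)).trans ?_
      gcongr
      exact le_max_left _ _
    · refine (h₂ z h0 h1 him (by linarith)).trans ?_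
      gcongr
      exact (le_max_left _ _).trans (le_max_right _ _)

/-! ### The sectors in linear coordinates -/

/-- A linear form vanishing on `Γ₁ ∪ Γ₃`. -/
def formU (η : ℂ) : ℝ := η.re - √3 * η.im
/-- A linear form vanishing on `Γ₂ ∪ Γ₄`. -/
def formV (η : ℂ) : ℝ := η.re + √3 * η.im

theorem formU_neg (η : ℂ) : formU (-η) = -formU η := by simp [formU]; ring
theorem formV_neg (η : ℂ) : formV (-η) = -formV η := by simp [formV]; ring

theorem continuous_formU : Continuous formU := by unfold formU; fun_prop
theorem continuous_formV : Continuous formV := by unfold formV; fun_prop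

theorem formU_polar (r θ : ℝ) :
    formU (r * Complex.exp (θ * Complex.I)) = 2 * r * Real.cos (θ + Real.pi / 3) := by
  rw [Real.cos_add, Real.cos_pi_div_three, Real.sin_pi_div_three, formU, Complex.re_ofReal_mul,
    Complex.im_ofReal_mul, Complex.exp_ofReal_mul_I_re, Complex.exp_ofReal_mul_I_im]
  ring

theorem formV_polar (r θ : ℝ) :
    formV (r * Complex.exp (θ * Complex.I)) = 2 * r * Real.cos (θ - Real.pi / 3) := by
  rw [Real.cos_sub, Real.cos_pi_div_three, Real.sin_pi_div_three, formV, Complex.re_ofReal_mul,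
    Complex.im_ofReal_mul, Complex.exp_ofReal_mul_I_re, Complex.exp_ofReal_mul_I_im]
  ring

theorem cos_pos_of_mem {x : ℝ} (h1 : -(Real.pi / 2) < x) (h2 : x < Real.pi / 2) : 0 < Real.cos x :=
  Real.cos_pos_of_mem_Ioo ⟨h1, h2⟩

theorem cos_neg_of_mem_neg {x : ℝ} (h1 : x < -(Real.pi / 2)) (h2 : -(3 * Real.pi / 2) < x) :
    Real.cos x < 0 := by
  rw [← Real.cos_neg]
  exact Real.cos_neg_of_pi_div_two_lt_of_lt (by linarith) (by linarith)

theorem forms_of_mem_Ω₁ {η : ℂ} (h : η ∈ Ω₁) : 0 < formU η ∧ 0 < formV η := by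
  obtain ⟨r, θ, hr, h1, h2, rfl⟩ := h
  have hpi := Real.pi_pos
  rw [formU_polar, formV_polar]
  exact ⟨mul_pos (by linarith) (cos_pos_of_mem (by linarith) (by linarith)),
    mul_pos (by linarith) (cos_pos_of_mem (by linarith) (by linarith))⟩

theorem forms_of_mem_Ω₂ {η : ℂ} (h : η ∈ Ω₂) : formU η < 0 ∧ 0 < formV η := by
  obtain ⟨r, θ, hr, h1, h2, rfl⟩ := h
  have hpi := Real.pi_pos
  rw [formU_polar, formV_polar]
  exact ⟨mul_neg_of_pos_of_neg (by linarith)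
    (Real.cos_neg_of_pi_div_two_lt_of_lt (by linarith) (by linarith)),
    mul_pos (by linarith) (cos_pos_of_mem (by linarith) (by linarith))⟩

theorem forms_of_mem_Ω₃ {η : ℂ} (h : η ∈ Ω₃) : formU η < 0 ∧ formV η < 0 := by
  obtain ⟨r, θ, hr, h1, h2, rfl⟩ := h
  have hpi := Real.pi_pos
  rw [formU_polar, formV_polar]
  exact ⟨mul_neg_of_pos_of_neg (by linarith) (cos_neg_of_mem_neg (by linarith) (by linarith)),
    mul_neg_of_pos_of_neg (by linarith) (cos_neg_of_mem_neg (by linarith) (by linarith))⟩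

theorem forms_of_mem_Ω₄ {η : ℂ} (h : η ∈ Ω₄) : 0 < formU η ∧ formV η < 0 := by
  obtain ⟨r, θ, hr, h1, h2, rfl⟩ := h
  have hpi := Real.pi_pos
  rw [formU_polar, formV_polar]
  exact ⟨mul_pos (by linarith) (cos_pos_of_mem (by linarith) (by linarith)),
    mul_neg_of_pos_of_neg (by linarith) (cos_neg_of_mem_neg (by linarith) (by linarith))⟩

theorem forms_of_mem_Γ₁ {η : ℂ} (h : η ∈ Γ₁) : formU η = 0 ∧ 0 < formV η := by
  obtain ⟨r, hr, rfl⟩ := h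
  have hpi := Real.pi_pos
  rw [formU_polar, formV_polar, show Real.pi / 6 + Real.pi / 3 = Real.pi / 2 by ring,
    Real.cos_pi_div_two]
  exact ⟨mul_zero _, mul_pos (by linarith) (cos_pos_of_mem (by linarith) (by linarith))⟩

theorem forms_of_mem_Γ₂ {η : ℂ} (h : η ∈ Γ₂) : formU η < 0 ∧ formV η = 0 := by
  obtain ⟨r, hr, rfl⟩ := h
  have hpi := Real.pi_pos
  rw [formU_polar, formV_polar,
    show -(7 * Real.pi / 6) - Real.pi / 3 = Real.pi / 2 - 2 * Real.pi by ring,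
    Real.cos_sub_two_pi, Real.cos_pi_div_two]
  exact ⟨mul_neg_of_pos_of_neg (by linarith) (cos_neg_of_mem_neg (by linarith) (by linarith)),
    mul_zero _⟩

theorem forms_of_mem_Γ₃ {η : ℂ} (h : η ∈ Γ₃) : formU η = 0 ∧ formV η < 0 := by
  obtain ⟨r, hr, rfl⟩ := h
  have hpi := Real.pi_pos
  rw [formU_polar, formV_polar,
    show -(5 * Real.pi / 6) + Real.pi / 3 = -(Real.pi / 2) by ring,
    Real.cos_neg, Real.cos_pi_div_two]
  exact ⟨mul_zero _,
    mul_neg_of_pos_of_neg (by linarith) (cos_neg_of_mem_neg (by linarith) (by linarith))⟩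

theorem forms_of_mem_Γ₄ {η : ℂ} (h : η ∈ Γ₄) : 0 < formU η ∧ formV η = 0 := by
  obtain ⟨r, hr, rfl⟩ := h
  have hpi := Real.pi_pos
  rw [formU_polar, formV_polar,
    show -(Real.pi / 6) - Real.pi / 3 = -(Real.pi / 2) by ring,
    Real.cos_neg, Real.cos_pi_div_two]
  exact ⟨mul_pos (by linarith) (cos_pos_of_mem (by linarith) (by linarith)), mul_zero _⟩

/-- Exhaustiveness is what turns the one-way sign conditions on `formU` and `formV` into
characterisations: the nine sign patterns exclude each other. Afterwards openness, disjointness and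
the behaviour under `η ↦ -η` are read off from two linear forms. -/
theorem mem_cases (η : ℂ) : η = 0 ∨ η ∈ Γ₁ ∨ η ∈ Γ₂ ∨ η ∈ Γ₃ ∨ η ∈ Γ₄ ∨
    η ∈ Ω₁ ∨ η ∈ Ω₂ ∨ η ∈ Ω₃ ∨ η ∈ Ω₄ := by
  rcases eq_or_ne η 0 with h0 | h0
  · exact Or.inl h0
  right
  have hpi := Real.pi_pos
  have hr : 0 < ‖η‖ := norm_pos_iff.2 h0
  have harg := Complex.arg_mem_Ioc η
  obtain ⟨θ, h1, h2, h3⟩ : ∃ θ : ℝ, -(7 * Real.pi / 6) ≤ θ ∧ θ < 5 * Real.pi / 6 ∧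
      η = ‖η‖ * Complex.exp (θ * Complex.I) := by
    rcases lt_or_ge η.arg (5 * Real.pi / 6) with h | h
    · exact ⟨η.arg, by linarith [harg.1], h, (Complex.norm_mul_exp_arg_mul_I η).symm⟩
    · refine ⟨η.arg - 2 * Real.pi, by linarith, by linarith [harg.2], ?_⟩
      conv_lhs => rw [← Complex.norm_mul_exp_arg_mul_I η]
      push_cast
      rw [sub_mul, Complex.exp_sub, Complex.exp_two_pi_mul_I, div_one]
  rcases h1.eq_or_lt with h1 | h1
  · exact Or.inr (Or.inl ⟨‖η‖, hr, by rw [h1]; exact h3⟩)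
  rcases lt_trichotomy θ (-(5 * Real.pi / 6)) with h4 | h4 | h4
  · exact Or.inr (Or.inr (Or.inr (Or.inr (Or.inr (Or.inr (Or.inl ⟨‖η‖, θ, hr, h1, h4, h3⟩))))))
  · exact Or.inr (Or.inr (Or.inl ⟨‖η‖, hr, by rw [← h4]; exact h3⟩))
  rcases lt_trichotomy θ (-(Real.pi / 6)) with h5 | h5 | h5
  · exact Or.inr (Or.inr (Or.inr (Or.inr (Or.inr (Or.inr (Or.inr ⟨‖η‖, θ, hr, h4, h5, h3⟩))))))
  · exact Or.inr (Or.inr (Or.inr (Or.inl ⟨‖η‖, hr, by rw [← h5]; exact h3⟩)))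
  rcases lt_trichotomy θ (Real.pi / 6) with h6 | h6 | h6
  · exact Or.inr (Or.inr (Or.inr (Or.inr (Or.inl ⟨‖η‖, θ, hr, h5, h6, h3⟩))))
  · exact Or.inl ⟨‖η‖, hr, by rw [← h6]; exact h3⟩
  · exact Or.inr (Or.inr (Or.inr (Or.inr (Or.inr (Or.inl ⟨‖η‖, θ, hr, h6, h2, h3⟩)))))

theorem formU_zero : formU 0 = 0 := by simp [formU]
theorem formV_zero : formV 0 = 0 := by simp [formV]

theorem mem_Ω₁_iff {η : ℂ} : η ∈ Ω₁ ↔ 0 < formU η ∧ 0 < formV η := by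
  refine ⟨forms_of_mem_Ω₁, fun h => ?_⟩
  rcases mem_cases η with h' | h' | h' | h' | h' | h' | h' | h' | h'
  · rw [h', formU_zero] at h; linarith [h.1]
  · linarith [h.1, (forms_of_mem_Γ₁ h').1]
  · linarith [h.1, (forms_of_mem_Γ₂ h').1]
  · linarith [h.1, (forms_of_mem_Γ₃ h').1]
  · linarith [h.2, (forms_of_mem_Γ₄ h').2]
  · exact h'
  · linarith [h.1, (forms_of_mem_Ω₂ h').1]
  · linarith [h.1, (forms_of_mem_Ω₃ h').1]
  · linarith [h.2, (forms_of_mem_Ω₄ h').2]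

theorem mem_Ω₂_iff {η : ℂ} : η ∈ Ω₂ ↔ formU η < 0 ∧ 0 < formV η := by
  refine ⟨forms_of_mem_Ω₂, fun h => ?_⟩
  rcases mem_cases η with h' | h' | h' | h' | h' | h' | h' | h' | h'
  · rw [h', formU_zero] at h; linarith [h.1]
  · linarith [h.1, (forms_of_mem_Γ₁ h').1]
  · linarith [h.2, (forms_of_mem_Γ₂ h').2]
  · linarith [h.1, (forms_of_mem_Γ₃ h').1]
  · linarith [h.2, (forms_of_mem_Γ₄ h').2]
  · linarith [h.1, (forms_of_mem_Ω₁ h').1]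
  · exact h'
  · linarith [h.2, (forms_of_mem_Ω₃ h').2]
  · linarith [h.2, (forms_of_mem_Ω₄ h').2]

theorem mem_Ω₃_iff {η : ℂ} : η ∈ Ω₃ ↔ formU η < 0 ∧ formV η < 0 := by
  refine ⟨forms_of_mem_Ω₃, fun h => ?_⟩
  rcases mem_cases η with h' | h' | h' | h' | h' | h' | h' | h' | h'
  · rw [h', formU_zero] at h; linarith [h.1]
  · linarith [h.1, (forms_of_mem_Γ₁ h').1]
  · linarith [h.2, (forms_of_mem_Γ₂ h').2]
  · linarith [h.1, (forms_of_mem_Γ₃ h').1]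
  · linarith [h.2, (forms_of_mem_Γ₄ h').2]
  · linarith [h.1, (forms_of_mem_Ω₁ h').1]
  · linarith [h.2, (forms_of_mem_Ω₂ h').2]
  · exact h'
  · linarith [h.1, (forms_of_mem_Ω₄ h').1]

theorem mem_Ω₄_iff {η : ℂ} : η ∈ Ω₄ ↔ 0 < formU η ∧ formV η < 0 := by
  refine ⟨forms_of_mem_Ω₄, fun h => ?_⟩
  rcases mem_cases η with h' | h' | h' | h' | h' | h' | h' | h' | h'
  · rw [h', formU_zero] at h; linarith [h.1]
  · linarith [h.1, (forms_of_mem_Γ₁ h').1]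
  · linarith [h.2, (forms_of_mem_Γ₂ h').2]
  · linarith [h.1, (forms_of_mem_Γ₃ h').1]
  · linarith [h.2, (forms_of_mem_Γ₄ h').2]
  · linarith [h.2, (forms_of_mem_Ω₁ h').2]
  · linarith [h.2, (forms_of_mem_Ω₂ h').2]
  · linarith [h.1, (forms_of_mem_Ω₃ h').1]
  · exact h'

theorem mem_contour_iff {η : ℂ} : η ∈ contour ↔ formU η = 0 ∨ formV η = 0 := by
  constructor
  · rintro (h | ((h | h) | h) | h)
    · rw [mem_singleton_iff.1 h]; exact Or.inl formU_zero
    · exact Or.inl (forms_of_mem_Γ₁ h).1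
    · exact Or.inr (forms_of_mem_Γ₂ h).2
    · exact Or.inl (forms_of_mem_Γ₃ h).1
    · exact Or.inr (forms_of_mem_Γ₄ h).2
  · intro h
    rcases mem_cases η with h' | h' | h' | h' | h' | h' | h' | h' | h'
    · exact Or.inl h'
    · exact Or.inr (Or.inl (Or.inl (Or.inl h')))
    · exact Or.inr (Or.inl (Or.inl (Or.inr h')))
    · exact Or.inr (Or.inl (Or.inr h'))
    · exact Or.inr (Or.inr h')
    · rcases h with h | h <;> linarith [(forms_of_mem_Ω₁ h').1, (forms_of_mem_Ω₁ h').2]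
    · rcases h with h | h <;> linarith [(forms_of_mem_Ω₂ h').1, (forms_of_mem_Ω₂ h').2]
    · rcases h with h | h <;> linarith [(forms_of_mem_Ω₃ h').1, (forms_of_mem_Ω₃ h').2]
    · rcases h with h | h <;> linarith [(forms_of_mem_Ω₄ h').1, (forms_of_mem_Ω₄ h').2]

theorem compl_contour_eq : contourᶜ = Ω₁ ∪ Ω₂ ∪ Ω₃ ∪ Ω₄ := by
  ext η
  rw [mem_compl_iff, mem_contour_iff, mem_union, mem_union, mem_union, mem_Ω₁_iff, mem_Ω₂_iff,
    mem_Ω₃_iff, mem_Ω₄_iff]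
  constructor
  · intro h
    rw [not_or] at h
    rcases lt_or_gt_of_ne h.1 with h1 | h1 <;> rcases lt_or_gt_of_ne h.2 with h2 | h2 <;>
      simp [h1, h2]
  · rintro (((h | h) | h) | h) (h' | h') <;> linarith [h.1, h.2]

theorem isOpen_Ω₁ : IsOpen Ω₁ := by
  rw [show Ω₁ = {η | 0 < formU η ∧ 0 < formV η} from ext fun _ => mem_Ω₁_iff]
  exact (isOpen_lt continuous_const continuous_formU).inter
    (isOpen_lt continuous_const continuous_formV)

theorem isOpen_Ω₂ : IsOpen Ω₂ := by
  rw [show Ω₂ = {η | formU η < 0 ∧ 0 < formV η} from ext fun _ => mem_Ω₂_iff]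
  exact (isOpen_lt continuous_formU continuous_const).inter
    (isOpen_lt continuous_const continuous_formV)

theorem neg_mem_Ω₁_iff {η : ℂ} : -η ∈ Ω₁ ↔ η ∈ Ω₃ := by
  rw [mem_Ω₁_iff, mem_Ω₃_iff, formU_neg, formV_neg, neg_pos, neg_pos]

theorem neg_mem_Ω₂_iff {η : ℂ} : -η ∈ Ω₂ ↔ η ∈ Ω₄ := by
  rw [mem_Ω₂_iff, mem_Ω₄_iff, formU_neg, formV_neg, neg_lt_zero, neg_pos]

theorem neg_mem_Ω₃_iff {η : ℂ} : -η ∈ Ω₃ ↔ η ∈ Ω₁ := by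
  rw [← neg_mem_Ω₁_iff, neg_neg]

theorem isOpen_compl_contour : IsOpen contourᶜ := by
  rw [isOpen_compl_iff, show contour = {η | formU η = 0 ∨ formV η = 0} from
    ext fun _ => mem_contour_iff]
  exact (isClosed_eq continuous_formU continuous_const).union
    (isClosed_eq continuous_formV continuous_const)

theorem re_pos_of_mem_Ω₁ {η : ℂ} (h : η ∈ Ω₁) : 0 < η.re := by
  have h' := mem_Ω₁_iff.1 h
  rw [formU, formV] at h'
  linarith [h'.1, h'.2]

theorem norm_sq_eq (η : ℂ) : ‖η‖ ^ 2 = η.re ^ 2 + η.im ^ 2 := by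
  rw [← Complex.normSq_eq_norm_sq, Complex.normSq_apply]; ring

/-- The product `formU · formV` equals `(Re η)² - 3 (Im η)²`, so its sign compares `(Im η)²` with
`|η|²/4`. The same identity with the opposite sign gives the bound in `Ω₂`. -/
theorem abs_im_le_of_mem_Ω₁ {η : ℂ} (h : η ∈ Ω₁) : |η.im| ≤ ‖η‖ / 2 := by
  have h' := mem_Ω₁_iff.1 h
  rw [formU, formV] at h'
  have h3 : √3 * √3 = (3 : ℝ) := Real.mul_self_sqrt (by norm_num)
  refine abs_le_of_sq_le_sq ?_ (by positivity)
  rw [div_pow, norm_sq_eq]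
  nlinarith [mul_pos h'.1 h'.2]

theorem norm_div_two_le_im_of_mem_Ω₂ {η : ℂ} (h : η ∈ Ω₂) : ‖η‖ / 2 ≤ η.im := by
  have h' := mem_Ω₂_iff.1 h
  rw [formU, formV] at h'
  have h3 : √3 * √3 = (3 : ℝ) := Real.mul_self_sqrt (by norm_num)
  have h4 : 0 < √3 := by positivity
  have him : 0 < η.im := by
    have : 0 < √3 * η.im := by linarith [h'.1, h'.2]
    exact pos_of_mul_pos_right this h4.le
  refine le_of_sq_le_sq ?_ him.le
  rw [div_pow, norm_sq_eq]
  nlinarith [mul_pos (neg_pos.2 h'.1) h'.2]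

theorem ne_zero_of_mem_Ω₂ {η : ℂ} (h : η ∈ Ω₂) : η ≠ 0 := by
  rintro rfl
  have := (mem_Ω₂_iff.1 h).2
  rw [formV_zero] at this
  exact this.false

/-! ### The branch of the logarithm -/

theorem argΓ_eq_of_polar {r θ : ℝ} (hr : 0 < r) (h1 : -(7 * Real.pi / 6) ≤ θ)
    (h2 : θ < 5 * Real.pi / 6) : argΓ (r * Complex.exp (θ * Complex.I)) = θ := by
  have hpi := Real.pi_pos
  rcases lt_or_ge (-Real.pi) θ with h | h
  · have harg : Complex.arg (r * Complex.exp (θ * Complex.I)) = θ := by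
      rw [Complex.exp_mul_I, Complex.arg_mul_cos_add_sin_mul_I hr ⟨h, by linarith⟩]
    rw [argΓ, harg, if_pos h2]
  · have harg : Complex.arg (r * Complex.exp (θ * Complex.I)) = θ + 2 * Real.pi := by
      have h3 : Complex.exp (θ * Complex.I) =
          Complex.exp (((θ + 2 * Real.pi : ℝ) : ℂ) * Complex.I) := by
        push_cast
        rw [add_mul, Complex.exp_add, Complex.exp_two_pi_mul_I, mul_one]
      rw [h3, Complex.exp_mul_I, Complex.arg_mul_cos_add_sin_mul_I hr ⟨by linarith, by linarith⟩]
    rw [argΓ, harg, if_neg (by linarith)]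
    ring

theorem logΓ_polar {r θ : ℝ} (hr : 0 < r) (h1 : -(7 * Real.pi / 6) ≤ θ)
    (h2 : θ < 5 * Real.pi / 6) :
    logΓ (r * Complex.exp (θ * Complex.I)) = Real.log r + θ * Complex.I := by
  rw [logΓ, argΓ_eq_of_polar hr h1 h2, norm_mul, Complex.norm_exp_ofReal_mul_I, mul_one,
    Complex.norm_real, Real.norm_of_nonneg hr.le]

theorem log_polar {r θ : ℝ} (hr : 0 < r) (h1 : -Real.pi < θ) (h2 : θ ≤ Real.pi) :
    Complex.log (r * Complex.exp (θ * Complex.I)) = Real.log r + θ * Complex.I := by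
  rw [Complex.log, Complex.exp_mul_I, Complex.arg_mul_cos_add_sin_mul_I hr ⟨h1, h2⟩,
    ← Complex.exp_mul_I, norm_mul, Complex.norm_exp_ofReal_mul_I, mul_one,
    Complex.norm_real, Real.norm_of_nonneg hr.le]

theorem exists_polar_of_formV_pos {η : ℂ} (h : 0 < formV η) : ∃ r θ : ℝ, 0 < r ∧
    -(Real.pi / 6) < θ ∧ θ < 5 * Real.pi / 6 ∧ η = r * Complex.exp (θ * Complex.I) := by
  have hpi := Real.pi_pos
  rcases mem_cases η with h' | h' | h' | h' | h' | h' | h' | h' | h'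
  · rw [h', formV_zero] at h; linarith
  · obtain ⟨r, hr, h3⟩ := h'
    exact ⟨r, Real.pi / 6, hr, by linarith, by linarith, h3⟩
  · linarith [(forms_of_mem_Γ₂ h').2]
  · linarith [(forms_of_mem_Γ₃ h').2]
  · linarith [(forms_of_mem_Γ₄ h').2]
  · obtain ⟨r, θ, hr, h1, h2, h3⟩ := h'
    exact ⟨r, θ, hr, by linarith, by linarith, h3⟩
  · obtain ⟨r, θ, hr, h1, h2, h3⟩ := h'
    exact ⟨r, θ, hr, by linarith, by linarith, h3⟩
  · linarith [(forms_of_mem_Ω₃ h').2]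
  · linarith [(forms_of_mem_Ω₄ h').2]

theorem logΓ_eq_log {η : ℂ} (h : 0 < formV η) : logΓ η = Complex.log η := by
  have hpi := Real.pi_pos
  obtain ⟨r, θ, hr, h1, h2, rfl⟩ := exists_polar_of_formV_pos h
  rw [logΓ_polar hr (by linarith) h2, log_polar hr (by linarith) (by linarith)]

/-- Shifting an argument in `(-π/6, 5π/6)` by `-π` stays within the branch `[-7π/6, 5π/6)`, whereas
`+π` would leave it. -/
theorem logΓ_neg_eq {η : ℂ} (h : 0 < formV η) :
    logΓ (-η) = Complex.log η - Real.pi * Complex.I := by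
  have hpi := Real.pi_pos
  obtain ⟨r, θ, hr, h1, h2, rfl⟩ := exists_polar_of_formV_pos h
  have h3 : -((r : ℂ) * Complex.exp (θ * Complex.I)) =
      r * Complex.exp (((θ - Real.pi : ℝ) : ℂ) * Complex.I) := by
    push_cast
    rw [sub_mul, Complex.exp_sub, Complex.exp_pi_mul_I]
    ring
  rw [h3, logΓ_polar hr (by linarith) (by linarith), log_polar hr (by linarith) (by linarith)]
  push_cast
  ring

theorem ne_zero_of_formV_pos {η : ℂ} (h : 0 < formV η) : η ≠ 0 := by
  rintro rfl
  rw [formV_zero] at h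
  exact h.false

theorem powΓ_eq_cpow {η : ℂ} (h : 0 < formV η) (c : ℂ) : powΓ η c = η ^ c := by
  rw [powΓ, logΓ_eq_log h, Complex.cpow_def_of_ne_zero (ne_zero_of_formV_pos h), mul_comm]

theorem powΓ_neg_eq_cpow {η : ℂ} (h : 0 < formV η) (c : ℂ) :
    powΓ (-η) c = Complex.exp (-(c * (Real.pi * Complex.I))) * η ^ c := by
  rw [powΓ, logΓ_neg_eq h, Complex.cpow_def_of_ne_zero (ne_zero_of_formV_pos h), ← Complex.exp_add]
  congr 1
  ring

/-- The closed half-plane is needed: the jump on `Γ₂` uses continuity of the principal functions at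
the boundary points `ζ` and `-ζ`. -/
theorem mem_hankelRegion_of_formV {η : ℂ} (h : 0 ≤ formV η) (h0 : η ≠ 0) : η ∈ hankelRegion 1 := by
  rw [formV] at h
  by_contra hcon
  simp only [hankelRegion, mem_ofPred_eq, one_mul, not_or, not_lt] at hcon
  have h4 : 0 < √3 := by positivity
  have h5 : √3 * η.im ≤ 0 := mul_nonpos_of_nonneg_of_nonpos h4.le hcon.2
  have h6 : η.re = 0 := by linarith [hcon.1]
  have h7 : √3 * η.im = 0 := by linarith [hcon.1]
  exact h0 (Complex.ext h6 ((mul_eq_zero.1 h7).resolve_left h4.ne'))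

/-! ### The symmetry of the problem -/

/-- Conjugation by `!![0, 1; -1, 0]`, that is, the transpose of the adjugate. -/
def conjW (A : Mat) : Mat := !![A 1 1, -A 1 0; -A 0 1, A 0 0]

theorem conjW_mul (A B : Mat) : conjW (A * B) = conjW A * conjW B := by
  ext i j
  fin_cases i <;> fin_cases j <;> simp [conjW, Matrix.mul_apply, Fin.sum_univ_two] <;> ring

theorem conjW_upper (a : ℂ) : conjW (upper a) = lower (-a) := by
  simp [conjW, upper, lower]

theorem conjW_one : conjW 1 = 1 := by
  ext i j
  fin_cases i <;> fin_cases j <;> simp [conjW]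

theorem conjW_sub (A B : Mat) : conjW (A - B) = conjW A - conjW B := by
  ext i j
  fin_cases i <;> fin_cases j <;> simp [conjW] <;> ring

theorem conjW_expσ₃ (c : ℂ) : conjW (expσ₃ c) = expσ₃ (-c) := by
  simp [conjW, expσ₃]

theorem conjW_conjW (A : Mat) : conjW (conjW A) = A := by
  ext i j
  fin_cases i <;> fin_cases j <;> simp [conjW]

theorem continuous_conjW : Continuous conjW := by
  refine continuous_matrix fun i j => ?_
  fin_cases i <;> fin_cases j <;> simp [conjW] <;> fun_prop

/-! ### The explicit solution in principal branches -/

/-- `z^{1/2} H^{(1)}_ν(z)`, principal branches. -/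
def sqrtHankel1 (ν z : ℂ) : ℂ := z ^ (1 / 2 : ℂ) * hankel1 ν z

/-- `z^{1/2} H^{(2)}_ν(z)`, principal branches. -/
def sqrtHankel2 (ν z : ℂ) : ℂ := z ^ (1 / 2 : ℂ) * hankel2 ν z

/-- `M₁` in principal branches. -/
def principalM (α : ℝ) (z : ℂ) : Mat :=
  ((Real.sqrt Real.pi / (2 * Real.sqrt 2) : ℝ) : ℂ) •
    !![Complex.exp (α / 2 * (Real.pi * Complex.I)) *
          (Complex.I * sqrtHankel1 (α + 1 / 2) z + sqrtHankel1 (α - 1 / 2) z),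
        Complex.exp (-(α / 2 * (Real.pi * Complex.I))) *
          (-sqrtHankel2 (α + 1 / 2) z + Complex.I * sqrtHankel2 (α - 1 / 2) z);
        -(Complex.exp (α / 2 * (Real.pi * Complex.I)) *
          (sqrtHankel1 (α + 1 / 2) z + Complex.I * sqrtHankel1 (α - 1 / 2) z)),
        Complex.exp (-(α / 2 * (Real.pi * Complex.I))) *
          (-(Complex.I * sqrtHankel2 (α + 1 / 2) z) + sqrtHankel2 (α - 1 / 2) z)]

theorem M₁_eq_principalM {η : ℂ} (h : 0 < formV η) (α : ℝ) : M₁ α η = principalM α η := by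
  rw [M₁, principalM, powΓ_eq_cpow h]
  congr 1
  ext i j
  fin_cases i <;> fin_cases j <;>
    simp [Matrix.mul_apply, Fin.sum_univ_two, expσ₃, sqrtHankel1, sqrtHankel2] <;>
    ring_nf <;> simp <;> ring

theorem exp_half_mul_pi_mul_I : Complex.exp (1 / 2 * (Real.pi * Complex.I)) = Complex.I := by
  rw [show (1 / 2 * (Real.pi * Complex.I) : ℂ) = Real.pi / 2 * Complex.I by ring,
    Complex.exp_pi_div_two_mul_I]

theorem exp_neg_half_mul_pi_mul_I :
    Complex.exp (-(1 / 2 * (Real.pi * Complex.I))) = -Complex.I := by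
  rw [Complex.exp_neg, exp_half_mul_pi_mul_I, Complex.inv_I]

/-- Both the square root and the extra half in `(α+1)/2` contribute factors `±i` at `-η`; combined
they turn `M₂` into the conjugate of `M₁`. -/
theorem M₂_neg_eq_conjW {η : ℂ} (h : 0 < formV η) (α : ℝ) :
    M₂ α (-η) = conjW (principalM α η) := by
  rw [M₂, principalM, powΓ_neg_eq_cpow h, neg_neg, exp_neg_half_mul_pi_mul_I]
  have h1 : Complex.exp (-((α + 1) / 2 * (Real.pi * Complex.I))) =
      -Complex.I * Complex.exp (-(α / 2 * (Real.pi * Complex.I))) := by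
    rw [← exp_neg_half_mul_pi_mul_I, ← Complex.exp_add]
    congr 1
    ring
  have h2 : Complex.exp ((α + 1) / 2 * (Real.pi * Complex.I)) =
      Complex.I * Complex.exp (α / 2 * (Real.pi * Complex.I)) := by
    rw [show ((α + 1) / 2 * (Real.pi * Complex.I) : ℂ) =
      1 / 2 * (Real.pi * Complex.I) + α / 2 * (Real.pi * Complex.I) by ring, Complex.exp_add,
      exp_half_mul_pi_mul_I]
  ext i j
  fin_cases i <;> fin_cases j <;>
    simp [expσ₃, conjW, sqrtHankel1, sqrtHankel2, h1, h2] <;>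
    ring_nf <;> simp [Complex.I_pow_three] <;> first | ring1 | exact Or.inl (by ring1)

theorem solution_of_mem_Ω₁ {η : ℂ} (h : η ∈ Ω₁) (α : ℝ) (s₃ : ℂ) :
    solution α s₃ η = principalM α η := by
  rw [solution, if_pos h, M₁_eq_principalM (mem_Ω₁_iff.1 h).2]

theorem solution_of_mem_Ω₂ {η : ℂ} (h : η ∈ Ω₂) (α : ℝ) (s₃ : ℂ) :
    solution α s₃ η = principalM α η * upper (-s₃) := by
  have h' := mem_Ω₂_iff.1 h
  rw [solution, if_neg fun h1 => h'.1.not_gt (mem_Ω₁_iff.1 h1).1, if_pos h,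
    M₁_eq_principalM h'.2]

theorem solution_of_mem_Ω₃ {η : ℂ} (h : η ∈ Ω₃) (α : ℝ) (s₃ : ℂ) :
    solution α s₃ η = conjW (principalM α (-η)) := by
  have h' := mem_Ω₃_iff.1 h
  rw [solution, if_neg fun h1 => h'.1.not_gt (mem_Ω₁_iff.1 h1).1,
    if_neg fun h1 => h'.2.not_gt (mem_Ω₂_iff.1 h1).2, if_pos h,
    ← M₂_neg_eq_conjW (by rw [formV_neg]; linarith [h'.2]), neg_neg]

theorem solution_of_mem_Ω₄ {η : ℂ} (h : η ∈ Ω₄) (α : ℝ) (s₃ : ℂ) :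
    solution α s₃ η = conjW (principalM α (-η)) * lower s₃ := by
  have h' := mem_Ω₄_iff.1 h
  rw [solution, if_neg fun h1 => h'.2.not_gt (mem_Ω₁_iff.1 h1).2,
    if_neg fun h1 => h'.2.not_gt (mem_Ω₂_iff.1 h1).2,
    if_neg fun h1 => h'.1.not_gt (mem_Ω₃_iff.1 h1).1, if_pos h,
    ← M₂_neg_eq_conjW (by rw [formV_neg]; linarith [h'.2]), neg_neg]

theorem solution_of_neg_mem_Ω₁ {η : ℂ} (h : -η ∈ Ω₁) (α : ℝ) (s₃ : ℂ) :
    solution α s₃ η = conjW (solution α s₃ (-η)) := by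
  rw [solution_of_mem_Ω₃ (neg_mem_Ω₁_iff.1 h), solution_of_mem_Ω₁ h]

theorem solution_of_neg_mem_Ω₂ {η : ℂ} (h : -η ∈ Ω₂) (α : ℝ) (s₃ : ℂ) :
    solution α s₃ η = conjW (solution α s₃ (-η)) := by
  rw [solution_of_mem_Ω₄ (neg_mem_Ω₂_iff.1 h), solution_of_mem_Ω₂ h, conjW_mul, conjW_upper,
    neg_neg]

/-- This symmetry is the device that transfers every property from the `Ω₁`, `Ω₂` side to the `Ω₃`,
`Ω₄` side. -/
theorem solution_eq_conjW {η : ℂ} (h : η ∉ contour) (α : ℝ) (s₃ : ℂ) :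
    solution α s₃ η = conjW (solution α s₃ (-η)) := by
  have h' : η ∈ Ω₁ ∪ Ω₂ ∪ Ω₃ ∪ Ω₄ := compl_contour_eq ▸ h
  rcases h' with ((h1 | h1) | h1) | h1
  · rw [solution_of_neg_mem_Ω₁ (η := -η) (by rwa [neg_neg]), neg_neg, conjW_conjW]
  · rw [solution_of_neg_mem_Ω₂ (η := -η) (by rwa [neg_neg]), neg_neg, conjW_conjW]
  · exact solution_of_neg_mem_Ω₁ (neg_mem_Ω₁_iff.2 h1) α s₃
  · exact solution_of_neg_mem_Ω₂ (neg_mem_Ω₂_iff.2 h1) α s₃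

theorem differentiableOn_sqrtHankel1 {ν : ℝ} (hν : -(1 / 2) ≤ ν) :
    DifferentiableOn ℂ (sqrtHankel1 ν) (hankelRegion 1) :=
  DifferentiableOn.mul (fun _ hz => (differentiableAt_id.cpow_const
    (mem_slitPlane_of_mem_hankelRegion hz)).differentiableWithinAt) (differentiableOn_hankel1 hν)

theorem differentiableOn_sqrtHankel2 {ν : ℝ} (hν : -(1 / 2) ≤ ν) :
    DifferentiableOn ℂ (sqrtHankel2 ν) (hankelRegion 1) :=
  DifferentiableOn.mul (fun _ hz => (differentiableAt_id.cpow_const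
    (mem_slitPlane_of_mem_hankelRegion hz)).differentiableWithinAt) (differentiableOn_hankel2 hν)

theorem differentiableOn_principalM {α : ℝ} (hα : 0 ≤ α) (i j : Fin 2) :
    DifferentiableOn ℂ (fun z => principalM α z i j) (hankelRegion 1) := by
  have h1 := differentiableOn_sqrtHankel1 (ν := α + 1 / 2) (by linarith)
  have h2 := differentiableOn_sqrtHankel1 (ν := α - 1 / 2) (by linarith)
  have h3 := differentiableOn_sqrtHankel2 (ν := α + 1 / 2) (by linarith)
  have h4 := differentiableOn_sqrtHankel2 (ν := α - 1 / 2) (by linarith)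
  push_cast [one_div] at h1 h2 h3 h4
  fin_cases i <;> fin_cases j <;> simp only [principalM] <;> simp <;> fun_prop

theorem analyticAt_principalM {α : ℝ} (hα : 0 ≤ α) {z : ℂ} (hz : z ∈ hankelRegion 1)
    (i j : Fin 2) : AnalyticAt ℂ (fun z => principalM α z i j) z :=
  (differentiableOn_principalM hα i j).analyticAt ((isOpen_hankelRegion 1).mem_nhds hz)

theorem continuousAt_principalM {α : ℝ} (hα : 0 ≤ α) {z : ℂ} (hz : z ∈ hankelRegion 1) :
    ContinuousAt (principalM α) z :=
  tendsto_pi_nhds.2 fun i => tendsto_pi_nhds.2 fun j =>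
    (analyticAt_principalM hα hz i j).continuousAt

/-! ### The jumps of the explicit solution -/

theorem HasJump.conjW {M : ℂ → Mat} {Γ Ωl Ωr Γ' Ωl' Ωr' : Set ℂ} {J : Mat}
    (h : HasJump M Γ Ωl Ωr J) (hΓ : ∀ η ∈ Γ', -η ∈ Γ)
    (hl : ∀ η ∈ Ωl', -η ∈ Ωl) (hr : ∀ η ∈ Ωr', -η ∈ Ωr) :
    HasJump (fun η => ModelRH.conjW (M (-η))) Γ' Ωl' Ωr' (ModelRH.conjW J) := by
  intro ζ hζ
  obtain ⟨A, B, hA, hB, hAB⟩ := h (-ζ) (hΓ ζ hζ)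
  have key : ∀ {Ω Ω' : Set ℂ}, (∀ η ∈ Ω', -η ∈ Ω) →
      Tendsto (fun η : ℂ => -η) (𝓝[Ω'] ζ) (𝓝[Ω] (-ζ)) := fun h =>
    tendsto_nhdsWithin_of_tendsto_nhds_of_eventually_within _
      (continuous_neg.tendsto ζ |>.mono_left nhdsWithin_le_nhds)
      (eventually_nhdsWithin_of_forall h)
  refine ⟨ModelRH.conjW A, ModelRH.conjW B,
    (continuous_conjW.tendsto _).comp (hA.comp (key hl)),
    (continuous_conjW.tendsto _).comp (hB.comp (key hr)), ?_⟩
  rw [hAB, conjW_mul]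

theorem HasJump.congr {M N : ℂ → Mat} {Γ Ωl Ωr : Set ℂ} {J : Mat} (h : HasJump M Γ Ωl Ωr J)
    (hl : ∀ η ∈ Ωl, N η = M η) (hr : ∀ η ∈ Ωr, N η = M η) : HasJump N Γ Ωl Ωr J := by
  intro ζ hζ
  obtain ⟨A, B, hA, hB, hAB⟩ := h ζ hζ
  exact ⟨A, B, hA.congr' (eventually_nhdsWithin_of_forall fun η hη => (hl η hη).symm),
    hB.congr' (eventually_nhdsWithin_of_forall fun η hη => (hr η hη).symm), hAB⟩

theorem neg_mem_Γ₁ {η : ℂ} (h : η ∈ Γ₃) : -η ∈ Γ₁ := by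
  obtain ⟨r, hr, rfl⟩ := h
  refine ⟨r, hr, ?_⟩
  rw [show ((Real.pi / 6 : ℝ) : ℂ) * Complex.I =
    ((-(5 * Real.pi / 6) : ℝ) : ℂ) * Complex.I + Real.pi * Complex.I by push_cast; ring,
    Complex.exp_add, Complex.exp_pi_mul_I]
  ring

theorem neg_mem_Γ₂ {η : ℂ} (h : η ∈ Γ₄) : -η ∈ Γ₂ := by
  obtain ⟨r, hr, rfl⟩ := h
  refine ⟨r, hr, ?_⟩
  rw [show ((-(Real.pi / 6) : ℝ) : ℂ) * Complex.I =
    ((-(7 * Real.pi / 6) : ℝ) : ℂ) * Complex.I + Real.pi * Complex.I by push_cast; ring,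
    Complex.exp_add, Complex.exp_pi_mul_I]
  ring

theorem hasJump_Γ₁ {α : ℝ} (hα : 0 ≤ α) (s₃ : ℂ) :
    HasJump (solution α s₃) Γ₁ Ω₂ Ω₁ (upper (-s₃)) := by
  intro ζ hζ
  have hV := (forms_of_mem_Γ₁ hζ).2
  have hc := (continuousAt_principalM hα
    (mem_hankelRegion_of_formV hV.le (ne_zero_of_formV_pos hV))).tendsto
  refine ⟨principalM α ζ * upper (-s₃), principalM α ζ, ?_, ?_, rfl⟩
  · exact ((hc.mul_const _).mono_left nhdsWithin_le_nhds).congr'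
      (eventually_nhdsWithin_of_forall fun η hη => (solution_of_mem_Ω₂ hη α s₃).symm)
  · exact (hc.mono_left nhdsWithin_le_nhds).congr'
      (eventually_nhdsWithin_of_forall fun η hη => (solution_of_mem_Ω₁ hη α s₃).symm)

theorem sqrt_eq_I_mul_sqrt_neg {z : ℂ} (hz : 0 < z.im) :
    z ^ (1 / 2 : ℂ) = Complex.I * (-z) ^ (1 / 2 : ℂ) := by
  rw [cpow_eq_cpow_neg hz, exp_half_mul_pi_mul_I]

/-- Continuation of the fundamental solution by a half-turn. -/
theorem conjW_principalM_neg {α : ℝ} (hα : 0 ≤ α) {z : ℂ} (hz : 0 < z.im) :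
    conjW (principalM α (-z)) = principalM α z * upper (2 * Complex.sin (Real.pi * α)) := by
  -- The half-turn factors `e^{±iπ(α±1/2)}` are `±i` times `E²` or `F²`, so the identity becomes
  -- polynomial in `E`, `F`, `i` and the four Hankel values at `-z`, modulo `EF = 1` and `i² = -1`.
  set E := Complex.exp (α / 2 * (Real.pi * Complex.I)) with hE
  set F := Complex.exp (-(α / 2 * (Real.pi * Complex.I))) with hF
  have hEF : E * F = 1 := by rw [hE, hF, ← Complex.exp_add, add_neg_cancel, Complex.exp_zero]
  have hEE : E ^ 2 = Complex.exp (α * (Real.pi * Complex.I)) := by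
    rw [hE, ← Complex.exp_nat_mul]; congr 1; push_cast; ring
  have hFF : F ^ 2 = Complex.exp (-(α * (Real.pi * Complex.I))) := by
    rw [hF, ← Complex.exp_nat_mul]; congr 1; push_cast; ring
  have e1 : Complex.exp (((α + 1 / 2 : ℝ) : ℂ) * (Real.pi * Complex.I)) = Complex.I * E ^ 2 := by
    have h : ((α + 1 / 2 : ℝ) : ℂ) * (Real.pi * Complex.I) =
        1 / 2 * (Real.pi * Complex.I) + α * (Real.pi * Complex.I) := by push_cast; ring
    rw [hEE, h, Complex.exp_add, exp_half_mul_pi_mul_I]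
  have e2 : Complex.exp (-(((α + 1 / 2 : ℝ) : ℂ) * (Real.pi * Complex.I))) =
      -Complex.I * F ^ 2 := by
    rw [hFF, ← exp_neg_half_mul_pi_mul_I, ← Complex.exp_add]; congr 1; push_cast; ring
  have e3 : Complex.exp (((α - 1 / 2 : ℝ) : ℂ) * (Real.pi * Complex.I)) = -Complex.I * E ^ 2 := by
    rw [hEE, ← exp_neg_half_mul_pi_mul_I, ← Complex.exp_add]; congr 1; push_cast; ring
  have e4 : Complex.exp (-(((α - 1 / 2 : ℝ) : ℂ) * (Real.pi * Complex.I))) =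
      Complex.I * F ^ 2 := by
    have h : -(((α - 1 / 2 : ℝ) : ℂ) * (Real.pi * Complex.I)) =
        1 / 2 * (Real.pi * Complex.I) + -(α * (Real.pi * Complex.I)) := by push_cast; ring
    rw [hFF, h, Complex.exp_add, exp_half_mul_pi_mul_I]
  have hsin : 2 * Complex.sin (Real.pi * α) = -Complex.I * (E ^ 2 - F ^ 2) := by
    rw [Complex.sin, hEE, hFF]
    ring_nf
  have p1 : sqrtHankel1 (α + 1 / 2) z = -F ^ 2 * sqrtHankel2 (α + 1 / 2) (-z) := by
    have h := hankel1_eq_hankel2_neg (ν := α + 1 / 2) (by linarith) hz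
    rw [e2] at h
    push_cast at h
    rw [sqrtHankel1, sqrtHankel2, h, sqrt_eq_I_mul_sqrt_neg hz]
    linear_combination F ^ 2 * (-z) ^ (1 / 2 : ℂ) * hankel2 (α + 1 / 2) (-z) * Complex.I_sq
  have p2 : sqrtHankel1 (α - 1 / 2) z = F ^ 2 * sqrtHankel2 (α - 1 / 2) (-z) := by
    have h := hankel1_eq_hankel2_neg (ν := α - 1 / 2) (by linarith) hz
    rw [e4] at h
    push_cast at h
    rw [sqrtHankel1, sqrtHankel2, h, sqrt_eq_I_mul_sqrt_neg hz]
    linear_combination -F ^ 2 * (-z) ^ (1 / 2 : ℂ) * hankel2 (α - 1 / 2) (-z) * Complex.I_sq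
  have p3 : sqrtHankel2 (α + 1 / 2) z = -E ^ 2 * sqrtHankel1 (α + 1 / 2) (-z) -
      (E ^ 2 - F ^ 2) * sqrtHankel2 (α + 1 / 2) (-z) := by
    have h := hankel2_eq_hankel_neg (ν := α + 1 / 2) (by linarith) hz
    rw [e1, e2] at h
    push_cast at h
    rw [sqrtHankel1, sqrtHankel2, sqrtHankel2, h, sqrt_eq_I_mul_sqrt_neg hz]
    linear_combination (-z) ^ (1 / 2 : ℂ) * (E ^ 2 * hankel1 (α + 1 / 2) (-z) +
      (E ^ 2 - F ^ 2) * hankel2 (α + 1 / 2) (-z)) * Complex.I_sq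
  have p4 : sqrtHankel2 (α - 1 / 2) z = E ^ 2 * sqrtHankel1 (α - 1 / 2) (-z) +
      (E ^ 2 - F ^ 2) * sqrtHankel2 (α - 1 / 2) (-z) := by
    have h := hankel2_eq_hankel_neg (ν := α - 1 / 2) (by linarith) hz
    rw [e3, e4] at h
    push_cast at h
    rw [sqrtHankel1, sqrtHankel2, sqrtHankel2, h, sqrt_eq_I_mul_sqrt_neg hz]
    linear_combination -(-z) ^ (1 / 2 : ℂ) * (E ^ 2 * hankel1 (α - 1 / 2) (-z) +
      (E ^ 2 - F ^ 2) * hankel2 (α - 1 / 2) (-z)) * Complex.I_sq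
  have hF3 : E * F ^ 2 = F := by linear_combination F * hEF
  have hE3 : F * E ^ 2 = E := by linear_combination E * hEF
  rw [hsin, principalM, principalM, p1, p2, p3, p4, ← hE, ← hF]
  generalize sqrtHankel1 (α + 1 / 2) (-z) = a
  generalize sqrtHankel1 (α - 1 / 2) (-z) = b
  generalize sqrtHankel2 (α + 1 / 2) (-z) = c
  generalize sqrtHankel2 (α - 1 / 2) (-z) = d
  generalize ((√Real.pi / (2 * √2) : ℝ) : ℂ) = k
  clear_value E F
  have hI := Complex.I_sq
  ext i j
  fin_cases i <;> fin_cases j <;>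
    simp [Matrix.mul_apply, Fin.sum_univ_two, conjW, upper]
  · left
    linear_combination -(-(Complex.I * c) + d) * hF3
  · linear_combination -k * (a + Complex.I * b) * hE3 +
      k * (-(Complex.I * c) + d) * Complex.I * (E ^ 2 - F ^ 2) * hF3 -
      k * F * (E ^ 2 - F ^ 2) * c * hI
  · left
    linear_combination -(-c + Complex.I * d) * hF3
  · linear_combination -k * (Complex.I * a + b) * hE3 -
      k * (-c + Complex.I * d) * Complex.I * (E ^ 2 - F ^ 2) * hF3 -
      k * F * (E ^ 2 - F ^ 2) * d * hI

theorem upper_mul_upper (a b : ℂ) : upper a * upper b = upper (b + a) := by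
  simp [upper]

theorem hasJump_Γ₂ {α : ℝ} (hα : 0 ≤ α) {s₁ s₃ : ℂ}
    (hs : s₁ + s₃ = -2 * Complex.sin (Real.pi * α)) :
    HasJump (solution α s₃) Γ₂ Ω₃ Ω₂ (upper (-s₁)) := by
  intro ζ hζ
  have hf := forms_of_mem_Γ₂ hζ
  have hζ0 : ζ ≠ 0 := by
    rintro rfl
    rw [formU_zero] at hf
    exact hf.1.false
  have him : 0 < ζ.im := by
    have h1 : 0 < √3 * ζ.im := by
      have := hf.1
      have := hf.2
      rw [formU] at *
      rw [formV] at *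
      linarith
    exact pos_of_mul_pos_right h1 (by positivity)
  have hc := (continuousAt_principalM hα (mem_hankelRegion_of_formV hf.2.ge hζ0)).tendsto
  have hc' := (continuousAt_principalM hα (mem_hankelRegion_of_formV (η := -ζ)
    (by rw [formV_neg, hf.2, neg_zero]) (neg_ne_zero.2 hζ0))).tendsto
  refine ⟨conjW (principalM α (-ζ)), principalM α ζ * upper (-s₃), ?_, ?_, ?_⟩
  · exact (((continuous_conjW.tendsto _).comp (hc'.comp (continuous_neg.tendsto ζ))).mono_left
      nhdsWithin_le_nhds).congr'
      (eventually_nhdsWithin_of_forall fun η hη => (solution_of_mem_Ω₃ hη α s₃).symm)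
  · exact ((hc.mul_const _).mono_left nhdsWithin_le_nhds).congr'
      (eventually_nhdsWithin_of_forall fun η hη => (solution_of_mem_Ω₂ hη α s₃).symm)
  -- The product of the factors with entries `-s₃` and `-s₁` must be the half-turn factor with entry
  -- `2 sin πα`: this is the constraint on `s₁ + s₃`.
  · rw [conjW_principalM_neg hα him, mul_assoc, upper_mul_upper]
    congr 2
    linear_combination hs

theorem analyticOnNhd_solution {α : ℝ} (hα : 0 ≤ α) (s₃ : ℂ) (i j : Fin 2) :
    AnalyticOnNhd ℂ (fun η => solution α s₃ η i j) contourᶜ := by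
  have key : ∀ η ∈ Ω₁ ∪ Ω₂, ∀ i j, AnalyticAt ℂ (fun η => solution α s₃ η i j) η := by
    rintro η (hη | hη) i j
    · refine (analyticAt_principalM hα (mem_hankelRegion_of_formV (mem_Ω₁_iff.1 hη).2.le
        (ne_zero_of_formV_pos (mem_Ω₁_iff.1 hη).2)) i j).congr ?_
      filter_upwards [isOpen_Ω₁.mem_nhds hη] with w hw
      rw [solution_of_mem_Ω₁ hw]
    · have h := analyticAt_principalM hα (mem_hankelRegion_of_formV (mem_Ω₂_iff.1 hη).2.le
        (ne_zero_of_formV_pos (mem_Ω₂_iff.1 hη).2))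
      have h' : AnalyticAt ℂ (fun η => principalM α η i 0 * upper (-s₃) 0 j +
          principalM α η i 1 * upper (-s₃) 1 j) η :=
        ((h i 0).mul analyticAt_const).add ((h i 1).mul analyticAt_const)
      refine h'.congr ?_
      filter_upwards [isOpen_Ω₂.mem_nhds hη] with w hw
      rw [solution_of_mem_Ω₂ hw, Matrix.mul_apply, Fin.sum_univ_two]
  have key' : ∀ η, -η ∈ Ω₁ ∪ Ω₂ → ∀ i j, AnalyticAt ℂ (fun η => solution α s₃ (-η) i j) η :=
    fun η hη i j => (key (-η) hη i j).comp_of_eq analyticAt_id.neg rfl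
  intro η hη
  have hη' : η ∈ Ω₁ ∪ Ω₂ ∪ Ω₃ ∪ Ω₄ := compl_contour_eq ▸ hη
  have h34 : -η ∈ Ω₁ ∪ Ω₂ → AnalyticAt ℂ (fun η => solution α s₃ η i j) η := by
    intro h
    have h' : AnalyticAt ℂ (fun η => conjW (solution α s₃ (-η)) i j) η := by
      fin_cases i <;> fin_cases j <;> simp only [conjW]
      · exact key' η h 1 1
      · exact (key' η h 1 0).neg
      · exact (key' η h 0 1).neg
      · exact key' η h 0 0
    refine h'.congr ?_
    filter_upwards [isOpen_compl_contour.mem_nhds hη] with w hw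
    rw [← solution_eq_conjW hw]
  rcases hη' with ((h | h) | h) | h
  · exact key η (Or.inl h) i j
  · exact key η (Or.inr h) i j
  · exact h34 (Or.inl (neg_mem_Ω₁_iff.2 h))
  · exact h34 (Or.inr (neg_mem_Ω₂_iff.2 h))

theorem hasJump_Γ₃ {α : ℝ} (hα : 0 ≤ α) (s₃ : ℂ) :
    HasJump (solution α s₃) Γ₃ Ω₄ Ω₃ (lower s₃) := by
  have h := (hasJump_Γ₁ hα s₃).conjW (Γ' := Γ₃) (Ωl' := Ω₄) (Ωr' := Ω₃) (fun _ => neg_mem_Γ₁)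
    (fun _ => neg_mem_Ω₂_iff.2) (fun _ => neg_mem_Ω₁_iff.2)
  rw [conjW_upper, neg_neg] at h
  exact h.congr (fun η hη => solution_of_neg_mem_Ω₂ (neg_mem_Ω₂_iff.2 hη) α s₃)
    (fun η hη => solution_of_neg_mem_Ω₁ (neg_mem_Ω₁_iff.2 hη) α s₃)

theorem hasJump_Γ₄ {α : ℝ} (hα : 0 ≤ α) {s₁ s₃ : ℂ}
    (hs : s₁ + s₃ = -2 * Complex.sin (Real.pi * α)) :
    HasJump (solution α s₃) Γ₄ Ω₁ Ω₄ (lower s₁) := by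
  have h := (hasJump_Γ₂ hα hs).conjW (Γ' := Γ₄) (Ωl' := Ω₁) (Ωr' := Ω₄) (fun _ => neg_mem_Γ₂)
    (fun _ => neg_mem_Ω₃_iff.2) (fun _ => neg_mem_Ω₂_iff.2)
  rw [conjW_upper, neg_neg] at h
  have hc : ∀ η, η ∈ Ω₁ ∪ Ω₂ ∪ Ω₃ ∪ Ω₄ → η ∉ contour := fun η h => by
    rwa [← compl_contour_eq] at h
  exact h.congr (fun η hη => solution_eq_conjW (hc η (Or.inl (Or.inl (Or.inl hη)))) α s₃)
    (fun η hη => solution_eq_conjW (hc η (Or.inr hη)) α s₃)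

/-! ### The explicit solution at infinity -/

theorem sqrtHankel1_eq_hankelRatio1 (ν : ℝ) (z : ℂ) :
    (√(Real.pi / 2) : ℂ) * sqrtHankel1 ν z =
      hankelRatio1 ν z * Complex.exp (Complex.I * (z - ν * Real.pi / 2 - Real.pi / 4)) := by
  rw [hankelRatio1, sqrtHankel1]
  linear_combination -((√(Real.pi / 2) : ℂ) * z ^ (1 / 2 : ℂ) * hankel1 ν z) *
    exp_mul_exp_neg (Complex.I * (z - ν * Real.pi / 2 - Real.pi / 4))

theorem sqrtHankel2_eq_hankelRatio2 (ν : ℝ) (z : ℂ) :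
    (√(Real.pi / 2) : ℂ) * sqrtHankel2 ν z =
      hankelRatio2 ν z * Complex.exp (-(Complex.I * (z - ν * Real.pi / 2 - Real.pi / 4))) := by
  rw [hankelRatio2, sqrtHankel2]
  linear_combination -((√(Real.pi / 2) : ℂ) * z ^ (1 / 2 : ℂ) * hankel2 ν z) *
    exp_mul_exp_neg (Complex.I * (z - ν * Real.pi / 2 - Real.pi / 4))

theorem sqrt_pi_div_eq : Real.sqrt Real.pi / (2 * Real.sqrt 2) = √(Real.pi / 2) / 2 := by
  rw [Real.sqrt_div Real.pi_pos.le]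
  field_simp

/-- The constants `e^{±iπα/2}` cancel the order-dependent Hankel phases, leaving `1` for order
`α-1/2` and `∓i` for `α+1/2`. Diagonal entries become half-sums and off-diagonal ones
half-differences of ratios tending to `1`, which is the required form at infinity. -/
theorem principalM_mul_expσ₃ (α : ℝ) (z : ℂ) :
    principalM α z * expσ₃ (-(Complex.I * z)) =
      !![(hankelRatio1 (α + 1 / 2) z + hankelRatio1 (α - 1 / 2) z) / 2,
        Complex.I * (hankelRatio2 (α - 1 / 2) z - hankelRatio2 (α + 1 / 2) z) / 2;
        Complex.I * (hankelRatio1 (α + 1 / 2) z - hankelRatio1 (α - 1 / 2) z) / 2,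
        (hankelRatio2 (α + 1 / 2) z + hankelRatio2 (α - 1 / 2) z) / 2] := by
  have e1 : Complex.exp (α / 2 * (Real.pi * Complex.I)) * Complex.exp (Complex.I *
      (z - ((α + 1 / 2 : ℝ) : ℂ) * Real.pi / 2 - Real.pi / 4)) * Complex.exp (-(Complex.I * z)) =
      -Complex.I := by
    rw [← exp_neg_half_mul_pi_mul_I, ← Complex.exp_add, ← Complex.exp_add]
    congr 1; push_cast; ring
  have e2 : Complex.exp (α / 2 * (Real.pi * Complex.I)) * Complex.exp (Complex.I *
      (z - ((α - 1 / 2 : ℝ) : ℂ) * Real.pi / 2 - Real.pi / 4)) * Complex.exp (-(Complex.I * z)) =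
      1 := by
    rw [← Complex.exp_zero, ← Complex.exp_add, ← Complex.exp_add]
    congr 1; push_cast; ring
  have e3 : Complex.exp (-(α / 2 * (Real.pi * Complex.I))) * Complex.exp (-(Complex.I *
      (z - ((α + 1 / 2 : ℝ) : ℂ) * Real.pi / 2 - Real.pi / 4))) * Complex.exp (Complex.I * z) =
      Complex.I := by
    rw [← exp_half_mul_pi_mul_I, ← Complex.exp_add, ← Complex.exp_add, exp_half_mul_pi_mul_I]
    rw [show (-(α / 2 * (Real.pi * Complex.I)) + -(Complex.I * (z - ((α + 1 / 2 : ℝ) : ℂ) *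
      Real.pi / 2 - Real.pi / 4)) + Complex.I * z : ℂ) = 1 / 2 * (Real.pi * Complex.I) by
      push_cast; ring, exp_half_mul_pi_mul_I]
  have e4 : Complex.exp (-(α / 2 * (Real.pi * Complex.I))) * Complex.exp (-(Complex.I *
      (z - ((α - 1 / 2 : ℝ) : ℂ) * Real.pi / 2 - Real.pi / 4))) * Complex.exp (Complex.I * z) =
      1 := by
    rw [← Complex.exp_zero, ← Complex.exp_add, ← Complex.exp_add]
    congr 1; push_cast; ring
  have h1 := sqrtHankel1_eq_hankelRatio1 (α + 1 / 2) z
  have h2 := sqrtHankel1_eq_hankelRatio1 (α - 1 / 2) z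
  have h3 := sqrtHankel2_eq_hankelRatio2 (α + 1 / 2) z
  have h4 := sqrtHankel2_eq_hankelRatio2 (α - 1 / 2) z
  rw [principalM, sqrt_pi_div_eq]
  generalize Complex.exp (Complex.I *
      (z - ((α + 1 / 2 : ℝ) : ℂ) * Real.pi / 2 - Real.pi / 4)) = x1 at *
  generalize Complex.exp (Complex.I *
      (z - ((α - 1 / 2 : ℝ) : ℂ) * Real.pi / 2 - Real.pi / 4)) = x2 at *
  generalize Complex.exp (-(Complex.I *
      (z - ((α + 1 / 2 : ℝ) : ℂ) * Real.pi / 2 - Real.pi / 4))) = x3 at *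
  generalize Complex.exp (-(Complex.I *
      (z - ((α - 1 / 2 : ℝ) : ℂ) * Real.pi / 2 - Real.pi / 4))) = x4 at *
  push_cast at h1 h2 h3 h4 ⊢
  rw [expσ₃, neg_neg]
  generalize sqrtHankel1 (α + 1 / 2) z = a at *
  generalize sqrtHankel1 (α - 1 / 2) z = b at *
  generalize sqrtHankel2 (α + 1 / 2) z = c at *
  generalize sqrtHankel2 (α - 1 / 2) z = d at *
  generalize hankelRatio1 (α + 1 / 2) z = a' at *
  generalize hankelRatio1 (α - 1 / 2) z = b' at *
  generalize hankelRatio2 (α + 1 / 2) z = c' at *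
  generalize hankelRatio2 (α - 1 / 2) z = d' at *
  generalize Complex.exp (α / 2 * (Real.pi * Complex.I)) = E at *
  generalize Complex.exp (-(α / 2 * (Real.pi * Complex.I))) = F at *
  generalize Complex.exp (-(Complex.I * z)) = X at *
  generalize Complex.exp (Complex.I * z) = Y at *
  generalize (√(Real.pi / 2) : ℂ) = k at *
  have hI := Complex.I_sq
  ext i j
  fin_cases i <;> fin_cases j <;> simp [Matrix.mul_apply, Fin.sum_univ_two]
  · linear_combination (1 / 2) * E * X * (Complex.I * h1 + h2) +
      (1 / 2) * (Complex.I * a' * e1 + b' * e2) - (1 / 2) * a' * hI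
  · linear_combination (1 / 2) * F * Y * (-h3 + Complex.I * h4) +
      (1 / 2) * (-c' * e3 + Complex.I * d' * e4)
  · linear_combination -(1 / 2) * E * X * (h1 + Complex.I * h2) -
      (1 / 2) * (a' * e1 + Complex.I * b' * e2)
  · linear_combination (1 / 2) * F * Y * (-Complex.I * h3 + h4) +
      (1 / 2) * (-Complex.I * c' * e3 + d' * e4) - (1 / 2) * c' * hI

theorem exists_norm_principalM_mul_expσ₃_sub_one_le {α : ℝ} (hα : 0 ≤ α) :
    ∃ C > 0, ∀ η ∈ Ω₁ ∪ Ω₂, 20 ≤ ‖η‖ → ∀ i j,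
      ‖(principalM α η * expσ₃ (-(Complex.I * η)) - 1) i j‖ ≤ C / ‖η‖ := by
  obtain ⟨C1, hC1, h1⟩ := exists_norm_hankelRatio1_sub_one_le (ν := α + 1 / 2) (by linarith)
  obtain ⟨C2, hC2, h2⟩ := exists_norm_hankelRatio1_sub_one_le (ν := α - 1 / 2) (by linarith)
  obtain ⟨C3, hC3, h3⟩ := exists_norm_hankelRatio2_sub_one_le (ν := α + 1 / 2) (by linarith)
  obtain ⟨C4, hC4, h4⟩ := exists_norm_hankelRatio2_sub_one_le (ν := α - 1 / 2) (by linarith)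
  refine ⟨C1 + C2 + C3 + C4, by positivity, fun η hη hn => ?_⟩
  have hn0 : 0 < ‖η‖ := by linarith
  have hreg : η ∈ hankelRegion 1 ∧ -(3 / 4) * ‖η‖ ≤ η.im ∧
      ((0 < η.re ∧ |η.im| ≤ ‖η‖ / 2) ∨ ‖η‖ / 2 ≤ η.im) := by
    rcases hη with h | h
    · have h' := abs_im_le_of_mem_Ω₁ h
      exact ⟨Or.inl (re_pos_of_mem_Ω₁ h), by linarith [(abs_le.1 h').1],
        Or.inl ⟨re_pos_of_mem_Ω₁ h, h'⟩⟩
    · have h' := norm_div_two_le_im_of_mem_Ω₂ h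
      exact ⟨Or.inr (by linarith), by linarith, Or.inr h'⟩
  replace h1 := h1 η hreg.1 hreg.2.1 (by linarith)
  replace h2 := h2 η hreg.1 hreg.2.1 (by linarith)
  replace h3 := h3 η hreg.2.2 hn
  replace h4 := h4 η hreg.2.2 hn
  rw [principalM_mul_expσ₃]
  generalize hankelRatio1 (α + 1 / 2) η = a at *
  generalize hankelRatio1 (α - 1 / 2) η = b at *
  generalize hankelRatio2 (α + 1 / 2) η = c at *
  generalize hankelRatio2 (α - 1 / 2) η = d at *
  have hab : ‖(a - 1) / 2‖ + ‖(b - 1) / 2‖ ≤ (C1 + C2) / ‖η‖ := by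
    rw [norm_div, norm_div, add_div]
    simp only [Complex.norm_ofNat]
    linarith [norm_nonneg (a - 1), norm_nonneg (b - 1)]
  have hcd : ‖(c - 1) / 2‖ + ‖(d - 1) / 2‖ ≤ (C3 + C4) / ‖η‖ := by
    rw [norm_div, norm_div, add_div]
    simp only [Complex.norm_ofNat]
    linarith [norm_nonneg (c - 1), norm_nonneg (d - 1)]
  have k1 : (C1 + C2) / ‖η‖ ≤ (C1 + C2 + C3 + C4) / ‖η‖ := 
    div_le_div_of_nonneg_right (by linarith) hn0.le
  have k2 : (C3 + C4) / ‖η‖ ≤ (C1 + C2 + C3 + C4) / ‖η‖ := 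
    div_le_div_of_nonneg_right (by linarith) hn0.le
  intro i j
  fin_cases i <;> fin_cases j <;> simp only [Matrix.sub_apply] <;> simp
  · rw [show (a + b) / 2 - 1 = (a - 1) / 2 + (b - 1) / 2 by ring]
    exact (norm_add_le _ _).trans (hab.trans k1)
  · rw [show ‖d - c‖ / 2 = ‖(d - 1) / 2 - (c - 1) / 2‖ by
      rw [← sub_div, norm_div, Complex.norm_ofNat]; congr 2; ring]
    exact (norm_sub_le _ _).trans ((add_comm _ _).trans_le (hcd.trans k2))
  · rw [show ‖a - b‖ / 2 = ‖(a - 1) / 2 - (b - 1) / 2‖ by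
      rw [← sub_div, norm_div, Complex.norm_ofNat]; congr 2; ring]
    exact (norm_sub_le _ _).trans (hab.trans k1)
  · rw [show (c + d) / 2 - 1 = (c - 1) / 2 + (d - 1) / 2 by ring]
    exact (norm_add_le _ _).trans (hcd.trans k2)

/-- In `Ω₂` the extra factor, moved past `e^{-iησ₃}`, acquires the entry `-s₃ e^{2iη}`, and
`|e^{2iη}| ≤ e^{-|η|} ≤ 1/|η|` because `2 Im η ≥ |η|`. -/
theorem exists_norm_solution_mul_expσ₃_sub_one_le {α : ℝ} (hα : 0 ≤ α) (s₃ : ℂ) :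
    ∃ C > 0, ∀ η ∈ Ω₁ ∪ Ω₂, 20 ≤ ‖η‖ → ∀ i j,
      ‖(solution α s₃ η * expσ₃ (-(Complex.I * η)) - 1) i j‖ ≤ C / ‖η‖ := by
  obtain ⟨C, hC, h⟩ := exists_norm_principalM_mul_expσ₃_sub_one_le hα
  refine ⟨C + (C + 1) * ‖s₃‖, by positivity, fun η hη hn i j => ?_⟩
  have hn0 : 0 < ‖η‖ := by linarith
  have h0 := h η hη hn
  have hle : C / ‖η‖ ≤ (C + (C + 1) * ‖s₃‖) / ‖η‖ := by
    gcongr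
    have : 0 ≤ (C + 1) * ‖s₃‖ := by positivity
    linarith
  rcases hη with hη | hη
  · rw [solution_of_mem_Ω₁ hη]
    exact (h0 i j).trans hle
  · have hcomm : upper (-s₃) * expσ₃ (-(Complex.I * η)) =
        expσ₃ (-(Complex.I * η)) * upper (-s₃ * Complex.exp (2 * (Complex.I * η))) := by
      have : Complex.exp (-(Complex.I * η)) * Complex.exp (2 * (Complex.I * η)) =
          Complex.exp (Complex.I * η) := by rw [← Complex.exp_add]; congr 1; ring
      ext i j
      fin_cases i <;> fin_cases j <;>
        simp [Matrix.mul_apply, Fin.sum_univ_two, upper, expσ₃]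
      linear_combination -s₃ * this
    rw [solution_of_mem_Ω₂ hη, mul_assoc, hcomm, ← mul_assoc]
    set N := principalM α η * expσ₃ (-(Complex.I * η)) with hN
    have hexp : ‖Complex.exp (2 * (Complex.I * η))‖ ≤ 1 / ‖η‖ := by
      rw [Complex.norm_exp, le_div_iff₀ hn0]
      have him := norm_div_two_le_im_of_mem_Ω₂ hη
      have h2 : (2 * (Complex.I * η)).re ≤ -‖η‖ := by simp; linarith
      calc Real.exp (2 * (Complex.I * η)).re * ‖η‖ ≤ Real.exp (-‖η‖) * Real.exp ‖η‖ := by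
            gcongr
            linarith [Real.add_one_le_exp ‖η‖]
        _ = 1 := by rw [← Real.exp_add, neg_add_cancel, Real.exp_zero]
    have hcol : ∀ i, ‖N i 0‖ ≤ C + 1 := by
      intro i
      have h3 := h0 i 0
      have h4 : C / ‖η‖ ≤ C := div_le_self hC.le (by linarith)
      have h5 : ‖(1 : Mat) i 0‖ ≤ 1 := by rw [Matrix.one_apply]; split_ifs <;> simp
      calc ‖N i 0‖ = ‖(N - 1) i 0 + (1 : Mat) i 0‖ := by rw [Matrix.sub_apply, sub_add_cancel]
        _ ≤ ‖(N - 1) i 0‖ + ‖(1 : Mat) i 0‖ := norm_add_le _ _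
        _ ≤ C + 1 := by linarith
    have e0 : ∀ i, (N * upper (-s₃ * Complex.exp (2 * (Complex.I * η))) - 1) i 0 = (N - 1) i 0 := by
      intro i
      simp [Matrix.mul_apply, Fin.sum_univ_two, upper]
    have e1 : ∀ i, (N * upper (-s₃ * Complex.exp (2 * (Complex.I * η))) - 1) i 1 =
        (N - 1) i 1 + N i 0 * (-s₃ * Complex.exp (2 * (Complex.I * η))) := by
      intro i
      simp [Matrix.mul_apply, Fin.sum_univ_two, upper]
      ring
    fin_cases j
    · exact (e0 i ▸ h0 i 0).trans hle
    · refine (congrArg norm (e1 i)).trans_le ((norm_add_le _ _).trans ?_)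
      rw [add_div, norm_mul, norm_mul, norm_neg]
      refine add_le_add (h0 i 1) ?_
      calc ‖N i 0‖ * (‖s₃‖ * ‖Complex.exp (2 * (Complex.I * η))‖) ≤
          (C + 1) * (‖s₃‖ * (1 / ‖η‖)) := by gcongr; exact hcol i
        _ = (C + 1) * ‖s₃‖ / ‖η‖ := by ring

theorem norm_conjW_le {A : Mat} {c : ℝ} (h : ∀ i j, ‖A i j‖ ≤ c) (i j : Fin 2) :
    ‖conjW A i j‖ ≤ c := by
  fin_cases i <;> fin_cases j <;> simp [conjW, h]

theorem solution_atInfinity {α : ℝ} (hα : 0 ≤ α) (s₃ : ℂ) (i j : Fin 2) :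
    (fun η => (solution α s₃ η * expσ₃ (-(Complex.I * η)) - 1) i j)
      =O[Bornology.cobounded ℂ ⊓ 𝓟 contourᶜ] (fun η => η⁻¹) := by
  obtain ⟨C, hC, h⟩ := exists_norm_solution_mul_expσ₃_sub_one_le hα s₃
  refine IsBigO.of_bound C (eventually_inf_principal.2 ?_)
  filter_upwards [tendsto_norm_cobounded_atTop.eventually_ge_atTop 20] with η hη hc
  rw [norm_inv, ← div_eq_mul_inv]
  have hneg : -η ∈ Ω₁ ∪ Ω₂ →
      ‖(solution α s₃ η * expσ₃ (-(Complex.I * η)) - 1) i j‖ ≤ C / ‖η‖ := by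
    intro h'
    have h1 : solution α s₃ η * expσ₃ (-(Complex.I * η)) - 1 =
        conjW (solution α s₃ (-η) * expσ₃ (-(Complex.I * -η)) - 1) := by
      rw [conjW_sub, conjW_mul, conjW_one, conjW_expσ₃, ← solution_eq_conjW hc]
      congr 3
      ring
    rw [h1]
    refine norm_conjW_le (fun i j => ?_) i j
    have h2 := h (-η) h' (by rwa [norm_neg]) i j
    rwa [norm_neg] at h2
  have hc' : η ∈ Ω₁ ∪ Ω₂ ∪ Ω₃ ∪ Ω₄ := compl_contour_eq ▸ hc
  rcases hc' with (h' | h') | h'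
  · exact h η h' hη i j
  · exact hneg (Or.inl (neg_mem_Ω₁_iff.2 h'))
  · exact hneg (Or.inr (neg_mem_Ω₂_iff.2 h'))

/-! ### The explicit solution at the origin -/

/-- `z^{1/2} J_ν(z)`, principal branches. -/
def sqrtBesselJ (ν z : ℂ) : ℂ := z ^ (1 / 2 : ℂ) * besselJ ν z

theorem sqrtHankel1_add_sqrtHankel2 (ν z : ℂ) :
    sqrtHankel1 ν z + sqrtHankel2 ν z = 2 * sqrtBesselJ ν z := by
  rw [sqrtHankel1, sqrtHankel2, sqrtBesselJ]
  linear_combination z ^ (1 / 2 : ℂ) * hankel1_add_hankel2 ν z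

theorem zero_notMem_Ω₁_union_Ω₂ {z : ℂ} (hz : z ∈ Ω₁ ∪ Ω₂) : z ≠ 0 := by
  rcases hz with h | h
  · exact ne_zero_of_formV_pos (mem_Ω₁_iff.1 h).2
  · exact ne_zero_of_formV_pos (mem_Ω₂_iff.1 h).2

theorem eventually_norm_le_one (S : Set ℂ) : ∀ᶠ z in 𝓝[S] (0 : ℂ), ‖z‖ ≤ 1 := by
  filter_upwards [nhdsWithin_le_nhds (Metric.closedBall_mem_nhds (0 : ℂ) one_pos)] with z hz
  exact mem_closedBall_zero_iff.1 hz

theorem isBigO_rpow_of_le {a b : ℝ} (h : b ≤ a) {S : Set ℂ} (hS : ∀ z ∈ S, z ≠ 0) :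
    (fun z : ℂ => ‖z‖ ^ a) =O[𝓝[S] 0] fun z => ‖z‖ ^ b := by
  refine IsBigO.of_bound 1 ?_
  filter_upwards [eventually_norm_le_one S, self_mem_nhdsWithin] with z hz hzS
  rw [one_mul, Real.norm_of_nonneg (by positivity), Real.norm_of_nonneg (by positivity)]
  exact Real.rpow_le_rpow_of_exponent_ge (norm_pos_iff.2 (hS z hzS)) hz h

theorem isBigO_sqrtBesselJ {ν : ℝ} (hν : -(1 / 2) ≤ ν) {S : Set ℂ} (hS : ∀ z ∈ S, z ≠ 0) :
    sqrtBesselJ ν =O[𝓝[S] 0] fun z => ‖z‖ ^ (ν + 1 / 2) := by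
  obtain ⟨C, hC, h⟩ := exists_norm_besselE_le hν
  refine IsBigO.of_bound ((1 / 2) ^ ν * (C * Real.exp 2)) ?_
  filter_upwards [eventually_norm_le_one S, self_mem_nhdsWithin] with z hz hzS
  have hz0 := norm_pos_iff.2 (hS z hzS)
  have h1 : ‖z ^ (1 / 2 : ℂ)‖ = ‖z‖ ^ (1 / 2 : ℝ) := by
    rw [← Complex.norm_cpow_real]; push_cast; rfl
  rw [sqrtBesselJ, besselJ_eq, norm_mul, norm_mul, h1, Complex.norm_cpow_real,
    Real.norm_of_nonneg (by positivity), Real.rpow_add hz0, norm_div, Complex.norm_ofNat,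
    div_eq_mul_one_div ‖z‖ 2, Real.mul_rpow hz0.le (by norm_num)]
  have h2 : ‖besselE ν z‖ ≤ C * Real.exp 2 := (h z).trans (by gcongr; linarith)
  calc ‖z‖ ^ (1 / 2 : ℝ) * (‖z‖ ^ ν * (1 / 2) ^ ν * ‖besselE ν z‖)
      ≤ ‖z‖ ^ (1 / 2 : ℝ) * (‖z‖ ^ ν * (1 / 2) ^ ν * (C * Real.exp 2)) := by gcongr
    _ = _ := by ring

/-- In the Laplace representation the square root cancels, leaving a bounded exponential times
`G_{ν-1/2}(-iz)`, whose growth at `0` is known in the cone. Order `-1/2` is reduced to order `1/2`.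
-/
theorem isBigO_sqrtHankel1 {ν : ℝ} (hν : -(1 / 2) ≤ ν) :
    sqrtHankel1 ν =O[𝓝[Ω₁ ∪ Ω₂] 0] fun z => ‖z‖ ^ (-max (ν - 1 / 2) 0) := by
  have key : ∀ ν : ℝ, -(1 / 2) < ν →
      sqrtHankel1 ν =O[𝓝[Ω₁ ∪ Ω₂] 0] fun z => ‖z‖ ^ (-max (ν - 1 / 2) 0) := by
    intro ν hν
    obtain ⟨C, hC, h⟩ := exists_norm_laplaceG_le (κ := 3 / 4) (μ := ν - 1 / 2)
      (by norm_num) (by norm_num) (by linarith)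
    have hk : 0 < √(Real.pi / 2) := Real.sqrt_pos.2 (by positivity)
    have hkn : ‖(√(Real.pi / 2) : ℂ)‖ = √(Real.pi / 2) := by
      rw [Complex.norm_real, Real.norm_of_nonneg hk.le]
    refine IsBigO.of_bound (Real.exp 1 * (C / ‖Complex.Gamma (ν + 1 / 2)‖) / √(Real.pi / 2)) ?_
    filter_upwards [eventually_norm_le_one _, self_mem_nhdsWithin] with z hz hzS
    have hz0 := zero_notMem_Ω₁_union_Ω₂ hzS
    have hreg : z ∈ hankelRegion 1 ∧ -(3 / 4) * ‖z‖ ≤ z.im := by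
      rcases hzS with h | h
      · have h' := abs_im_le_of_mem_Ω₁ h
        exact ⟨Or.inl (re_pos_of_mem_Ω₁ h), by linarith [(abs_le.1 h').1, norm_nonneg z]⟩
      · have h' := norm_div_two_le_im_of_mem_Ω₂ h
        exact ⟨Or.inr (by linarith [norm_pos_iff.2 hz0]), by linarith [norm_nonneg z]⟩
    have hn : ‖-(((1 : ℝ) : ℂ) * (Complex.I * z))‖ = ‖z‖ := by simp
    have h1 := h (-(((1 : ℝ) : ℂ) * (Complex.I * z))) (by rw [InCone, hn]; simpa using hreg.2)
      (by simpa using hz0) (by rwa [hn])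
    rw [hn] at h1
    push_cast at h1
    have h2 := sqrt_mul_cpow_mul_hankelLaplace (ε := 1) (ν := ν) hz0
    rw [← hankel1_eq (neg_half_lt_re hν) hreg.1, mul_assoc] at h2
    have h3 := congrArg norm h2
    rw [norm_mul, hkn, norm_mul _ (laplaceG _ _ / _), norm_div, Complex.norm_exp] at h3
    have h4 : (((1 : ℝ) : ℂ) * (Complex.I * (z - ν * Real.pi / 2 - Real.pi / 4))).re ≤ 1 := by
      have : (((1 : ℝ) : ℂ) * (Complex.I * (z - ν * Real.pi / 2 - Real.pi / 4))) =
        ((-(ν * Real.pi / 2) - Real.pi / 4 : ℝ) : ℂ) * Complex.I + Complex.I * z := by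
        push_cast; ring
      rw [this, Complex.add_re, Complex.re_ofReal_mul]
      simp only [Complex.I_re, Complex.I_mul_re, mul_zero, zero_add]
      exact (neg_le_abs _).trans ((Complex.abs_im_le_norm z).trans hz)
    rw [Real.norm_of_nonneg (by positivity), div_mul_eq_mul_div, le_div_iff₀ hk, mul_comm,
      sqrtHankel1, h3, mul_assoc]
    gcongr
    rw [div_mul_eq_mul_div]
    push_cast
    gcongr
  rcases hν.eq_or_lt with rfl | hν
  · have h1 := (key (1 / 2) (by norm_num)).const_mul_left Complex.I
    have h2 : sqrtHankel1 ((-(1 / 2) : ℝ) : ℂ) =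
        fun z => Complex.I * sqrtHankel1 ((1 / 2 : ℝ) : ℂ) z := by
      funext z
      push_cast
      rw [sqrtHankel1, sqrtHankel1, hankel1_neg_half]
      ring
    rw [h2]
    rwa [show (1 / 2 : ℝ) - 1 / 2 = 0 by norm_num, max_self,
      ← max_eq_right (show -(1 / 2) - 1 / 2 ≤ (0 : ℝ) by norm_num)] at h1
  · exact key ν hν

theorem isBigO_sqrtHankel {α : ℝ} (hα : 0 ≤ α) {ν : ℝ} (h : ν = α + 1 / 2 ∨ ν = α - 1 / 2) :
    sqrtHankel1 ν =O[𝓝[Ω₁ ∪ Ω₂] 0] (fun z => ‖z‖ ^ (-α)) ∧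
    sqrtHankel2 ν =O[𝓝[Ω₁ ∪ Ω₂] 0] (fun z => ‖z‖ ^ (-α)) ∧
    sqrtBesselJ ν =O[𝓝[Ω₁ ∪ Ω₂] 0] (fun z => ‖z‖ ^ α) := by
  have hS : ∀ z ∈ Ω₁ ∪ Ω₂, z ≠ 0 := fun z => zero_notMem_Ω₁_union_Ω₂
  have hν : -(1 / 2) ≤ ν := by rcases h with h | h <;> linarith
  have hmax : -α ≤ -max (ν - 1 / 2) 0 :=
    neg_le_neg (max_le (by rcases h with h | h <;> linarith) hα)
  have h1 := (isBigO_sqrtHankel1 hν).trans (isBigO_rpow_of_le hmax hS)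
  have h2 := isBigO_sqrtBesselJ hν hS
  have h3 := h2.trans (isBigO_rpow_of_le (b := -α) (by rcases h with h | h <;> linarith) hS)
  refine ⟨h1, ?_, h2.trans (isBigO_rpow_of_le (by rcases h with h | h <;> linarith) hS)⟩
  have h4 : sqrtHankel2 ν = fun z => 2 * sqrtBesselJ ν z - sqrtHankel1 ν z := by
    funext z
    rw [← sqrtHankel1_add_sqrtHankel2]
    ring
  rw [h4]
  exact (h3.const_mul_left 2).sub h1

theorem isBigO_principalM {α : ℝ} (hα : 0 ≤ α) (i j : Fin 2) :
    (fun z => principalM α z i j) =O[𝓝[Ω₁ ∪ Ω₂] 0] (fun z => ‖z‖ ^ (-α)) := by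
  have h1 := isBigO_sqrtHankel hα (ν := α + 1 / 2) (Or.inl rfl)
  have h2 := isBigO_sqrtHankel hα (ν := α - 1 / 2) (Or.inr rfl)
  push_cast at h1 h2
  fin_cases i <;> fin_cases j
  · exact (((h1.1.const_mul_left _).add h2.1).const_mul_left _).const_mul_left _
  · exact ((h1.2.1.neg_left.add (h2.2.1.const_mul_left _)).const_mul_left _).const_mul_left _
  · exact ((h1.1.add (h2.1.const_mul_left _)).const_mul_left _).neg_left.const_mul_left _
  · exact (((h1.2.1.const_mul_left _).neg_left.add h2.2.1).const_mul_left _).const_mul_left _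

/-- The second column of `M₁` combines to Bessel functions of the first kind. -/
theorem principalM_mul_upper (α : ℝ) (z : ℂ) :
    principalM α z * upper (Complex.I * Complex.exp (-(Real.pi * Complex.I * α))) =
      !![principalM α z 0 0, ((Real.sqrt Real.pi / (2 * Real.sqrt 2) : ℝ) : ℂ) *
          (2 * Complex.exp (-(α / 2 * (Real.pi * Complex.I))) *
            (-sqrtBesselJ (α + 1 / 2) z + Complex.I * sqrtBesselJ (α - 1 / 2) z));
        principalM α z 1 0, ((Real.sqrt Real.pi / (2 * Real.sqrt 2) : ℝ) : ℂ) *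
          (2 * Complex.exp (-(α / 2 * (Real.pi * Complex.I))) *
            (-(Complex.I * sqrtBesselJ (α + 1 / 2) z) + sqrtBesselJ (α - 1 / 2) z))] := by
  have hEF : Complex.exp (α / 2 * (Real.pi * Complex.I)) *
      Complex.exp (-(Real.pi * Complex.I * α)) =
      Complex.exp (-(α / 2 * (Real.pi * Complex.I))) := by
    rw [← Complex.exp_add]; congr 1; ring
  have h1 := sqrtHankel1_add_sqrtHankel2 (α + 1 / 2) z
  have h2 := sqrtHankel1_add_sqrtHankel2 (α - 1 / 2) z
  rw [principalM]
  generalize sqrtBesselJ (α + 1 / 2) z = u at *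
  generalize sqrtBesselJ (α - 1 / 2) z = v at *
  generalize sqrtHankel1 (α + 1 / 2) z = a at *
  generalize sqrtHankel1 (α - 1 / 2) z = b at *
  generalize sqrtHankel2 (α + 1 / 2) z = c at *
  generalize sqrtHankel2 (α - 1 / 2) z = d at *
  generalize Complex.exp (α / 2 * (Real.pi * Complex.I)) = E at *
  generalize Complex.exp (-(α / 2 * (Real.pi * Complex.I))) = F at *
  generalize Complex.exp (-(Real.pi * Complex.I * α)) = G at *
  generalize ((Real.sqrt Real.pi / (2 * Real.sqrt 2) : ℝ) : ℂ) = k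
  have hI := Complex.I_sq
  ext i j
  fin_cases i <;> fin_cases j <;> simp [Matrix.mul_apply, Fin.sum_univ_two, upper]
  · linear_combination k * (Complex.I * a + b) * Complex.I * hEF + k * F * a * hI -
      k * F * h1 + k * F * Complex.I * h2
  · linear_combination -k * (a + Complex.I * b) * Complex.I * hEF - k * F * b * hI -
      k * F * Complex.I * h1 + k * F * h2

theorem isBigO_principalM_mul_upper {α : ℝ} (hα : 0 ≤ α) (i : Fin 2) :
    (fun z => (principalM α z *
      upper (Complex.I * Complex.exp (-(Real.pi * Complex.I * α)))) i 1)
      =O[𝓝[Ω₁ ∪ Ω₂] 0] (fun z => ‖z‖ ^ α) := by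
  have h1 := (isBigO_sqrtHankel hα (ν := α + 1 / 2) (Or.inl rfl)).2.2
  have h2 := (isBigO_sqrtHankel hα (ν := α - 1 / 2) (Or.inr rfl)).2.2
  push_cast at h1 h2
  simp only [principalM_mul_upper]
  fin_cases i
  · exact ((h1.neg_left.add (h2.const_mul_left _)).const_mul_left _).const_mul_left _
  · exact (((h1.const_mul_left _).neg_left.add h2).const_mul_left _).const_mul_left _

theorem solution_origin₁ {α : ℝ} (hα : 0 ≤ α) (s₃ : ℂ) :
    IsBigOAtZero (solution α s₃) Ω₁ !![-α, -α; -α, -α] := by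
  intro i j
  have h := (isBigO_principalM hα i j).mono (nhdsWithin_mono 0 (subset_union_left (t := Ω₂)))
  have h' : (fun η => solution α s₃ η i j) =O[𝓝[Ω₁] 0] (fun z => ‖z‖ ^ (-α)) :=
    h.congr' (eventually_nhdsWithin_of_forall fun z hz => by
      beta_reduce; rw [solution_of_mem_Ω₁ hz])
      EventuallyEq.rfl
  fin_cases i <;> fin_cases j <;> exact h'

/-- The `s₃` in the normalising constant cancels the factor defining the solution in `Ω₂`; what
remains, `i e^{-πiα}`, is the multiplier that combines the two columns into Bessel functions `J`. -/
theorem solution_origin₂ {α : ℝ} (hα : 0 ≤ α) (s₃ : ℂ) :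
    IsBigOAtZero (fun η => solution α s₃ η * upper (originConst α s₃)) Ω₂ !![-α, α; -α, α] := by
  have hsol : ∀ z ∈ Ω₂, solution α s₃ z * upper (originConst α s₃) = principalM α z *
      upper (Complex.I * Complex.exp (-(Real.pi * Complex.I * α))) := by
    intro z hz
    rw [solution_of_mem_Ω₂ hz, mul_assoc, upper_mul_upper, originConst]
    congr 2
    ring
  have h0 : ∀ i, (fun η => (solution α s₃ η * upper (originConst α s₃)) i 0) =O[𝓝[Ω₂] 0]
      (fun z => ‖z‖ ^ (-α)) := fun i =>
    ((isBigO_principalM hα i 0).mono (nhdsWithin_mono 0 subset_union_right)).congr'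
      (eventually_nhdsWithin_of_forall fun z hz => by
        beta_reduce; rw [hsol z hz]; simp [Matrix.mul_apply, Fin.sum_univ_two, upper]) EventuallyEq.rfl
  have h1 : ∀ i, (fun η => (solution α s₃ η * upper (originConst α s₃)) i 1) =O[𝓝[Ω₂] 0]
      (fun z => ‖z‖ ^ α) := fun i =>
    ((isBigO_principalM_mul_upper hα i).mono (nhdsWithin_mono 0 subset_union_right)).congr'
      (eventually_nhdsWithin_of_forall fun z hz => by
        beta_reduce; rw [hsol z hz]) EventuallyEq.rfl
  intro i j
  fin_cases i <;> fin_cases j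
  · exact h0 0
  · exact h1 0
  · exact h0 1
  · exact h1 1

theorem IsBigOAtZero.conjW {F : ℂ → Mat} {Ω Ω' : Set ℂ} {a b c d : ℝ}
    (h : IsBigOAtZero F Ω !![a, b; c, d]) (hΩ : ∀ η ∈ Ω', -η ∈ Ω) {G : ℂ → Mat}
    (hG : ∀ η ∈ Ω', G η = ModelRH.conjW (F (-η))) : IsBigOAtZero G Ω' !![d, c; b, a] := by
  have ht : Tendsto (fun η : ℂ => -η) (𝓝[Ω'] 0) (𝓝[Ω] 0) := by
    refine tendsto_nhdsWithin_of_tendsto_nhds_of_eventually_within _ ?_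
      (eventually_nhdsWithin_of_forall hΩ)
    simpa using (continuous_neg.tendsto (0 : ℂ)).mono_left nhdsWithin_le_nhds
  have key : ∀ i j, (fun η => F (-η) i j) =O[𝓝[Ω'] 0]
      (fun η => ‖η‖ ^ (!![a, b; c, d] i j)) := fun i j => by
    simpa [Function.comp_def] using (h i j).comp_tendsto ht
  intro i j
  refine IsBigO.congr' (f₁ := fun η => ModelRH.conjW (F (-η)) i j) ?_
    (eventually_nhdsWithin_of_forall fun η hη => by
      beta_reduce; rw [hG η hη]) EventuallyEq.rfl
  fin_cases i <;> fin_cases j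
  · exact key 1 1
  · exact (key 1 0).neg_left
  · exact (key 0 1).neg_left
  · exact key 0 0

theorem isSolution_solution {α : ℝ} (hα : 0 ≤ α) {s₁ s₃ : ℂ}
    (hs : s₁ + s₃ = -2 * Complex.sin (Real.pi * α)) :
    IsSolution α s₁ s₃ (solution α s₃) where
  analytic := analyticOnNhd_solution hα s₃
  jump₁ := hasJump_Γ₁ hα s₃
  jump₂ := hasJump_Γ₂ hα hs
  jump₃ := hasJump_Γ₃ hα s₃
  jump₄ := hasJump_Γ₄ hα hs
  atInfinity := solution_atInfinity hα s₃
  origin₁ := solution_origin₁ hα s₃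
  origin₃ := (solution_origin₁ hα s₃).conjW (fun _ => neg_mem_Ω₁_iff.2)
    fun _ hη => solution_of_neg_mem_Ω₁ (neg_mem_Ω₁_iff.2 hη) α s₃
  origin₂ := solution_origin₂ hα s₃
  origin₄ := (solution_origin₂ hα s₃).conjW (fun _ => neg_mem_Ω₂_iff.2) fun _ hη => by
    rw [conjW_mul, conjW_upper, ← solution_of_neg_mem_Ω₂ (neg_mem_Ω₂_iff.2 hη)]

/-! ### A Liouville theorem for functions without jumps on the contour -/

theorem eventually_ne_nhdsNE_zero (a : ℝ) : ∀ᶠ t in 𝓝[≠] (0 : ℝ), t ≠ a := by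
  rcases eq_or_ne a 0 with rfl | ha
  · exact self_mem_nhdsWithin
  · exact nhdsWithin_le_nhds (isOpen_ne.mem_nhds ha.symm)

/-- A horizontal line meets each of the two lines forming the contour in at most one point. -/
instance neBot_nhdsWithin_compl_contour (ζ : ℂ) : NeBot (𝓝[contourᶜ] ζ) := by
  have h : Tendsto (fun t : ℝ => ζ + t) (𝓝[≠] 0) (𝓝[contourᶜ] ζ) := by
    refine tendsto_nhdsWithin_of_tendsto_nhds_of_eventually_within _ ?_ ?_
    · have : Continuous fun t : ℝ => ζ + t := by fun_prop
      simpa using (this.tendsto 0).mono_left nhdsWithin_le_nhds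
    · filter_upwards [eventually_ne_nhdsNE_zero (-formU ζ), eventually_ne_nhdsNE_zero (-formV ζ)]
        with t h1 h2
      rw [mem_compl_iff, mem_contour_iff, not_or]
      constructor
      · intro h
        apply h1
        simp only [formU, Complex.add_re, Complex.add_im, Complex.ofReal_re,
          Complex.ofReal_im] at h ⊢
        linarith
      · intro h
        apply h2
        simp only [formV, Complex.add_re, Complex.add_im, Complex.ofReal_re,
          Complex.ofReal_im] at h ⊢
        linarith
  exact h.neBot

instance neBot_nhdsWithin_Ω₂ : NeBot (𝓝[Ω₂] (0 : ℂ)) := by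
  have h : Tendsto (fun t : ℝ => t * Complex.I) (𝓝[>] 0) (𝓝[Ω₂] 0) := by
    refine tendsto_nhdsWithin_of_tendsto_nhds_of_eventually_within _ ?_ ?_
    · have : Continuous fun t : ℝ => t * Complex.I := by fun_prop
      simpa using (this.tendsto 0).mono_left nhdsWithin_le_nhds
    · filter_upwards [self_mem_nhdsWithin] with t ht
      have h3 : 0 < √3 * t := mul_pos (by positivity) ht
      rw [mem_Ω₂_iff, formU, formV]
      simpa using h3
  exact h.neBot

theorem dense_compl_contour (ζ : ℂ) : ζ ∈ closure contourᶜ :=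
  mem_closure_iff_nhdsWithin_neBot.2 inferInstance

theorem zero_mem_contour : (0 : ℂ) ∈ contour := Or.inl rfl

theorem div_im_eq_zero_of_form_eq {s : ℝ} {z ζ : ℂ} (h : z.re = s * z.im) (h' : ζ.re = s * ζ.im) :
    (z / ζ).im = 0 := by
  rw [Complex.div_im, h, h']
  ring

/-- Near a point of the contour other than the origin, the contour is a line through the origin. -/
theorem exists_ball_div_im_eq_zero {ζ : ℂ} (h0 : ζ ≠ 0) (hζ : ζ ∈ contour) :
    ∃ r > 0, ∀ z ∈ Metric.ball ζ r, z ≠ 0 ∧ (z ∈ contour → (z / ζ).im = 0) := by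
  have hboth : ¬ (formU ζ = 0 ∧ formV ζ = 0) := by
    rintro ⟨h1, h2⟩
    rw [formU] at h1
    rw [formV] at h2
    have h3 : √3 * ζ.im = 0 := by linarith
    exact h0 (Complex.ext (by simp; linarith)
      ((mul_eq_zero.1 h3).resolve_left (by positivity)))
  rcases mem_contour_iff.1 hζ with hU | hV
  · have hV : formV ζ ≠ 0 := fun h => hboth ⟨hU, h⟩
    obtain ⟨r, hr, h⟩ := Metric.mem_nhds_iff.1
      ((isOpen_ne.preimage continuous_formV).mem_nhds (show ζ ∈ formV ⁻¹' {0}ᶜ from hV))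
    refine ⟨r, hr, fun z hz => ⟨?_, fun hzc => ?_⟩⟩
    · rintro rfl
      exact h hz formV_zero
    · have hU' := (mem_contour_iff.1 hzc).resolve_right (h hz)
      rw [formU, sub_eq_zero] at hU hU'
      exact div_im_eq_zero_of_form_eq hU' hU
  · have hU : formU ζ ≠ 0 := fun h => hboth ⟨h, hV⟩
    obtain ⟨r, hr, h⟩ := Metric.mem_nhds_iff.1
      ((isOpen_ne.preimage continuous_formU).mem_nhds (show ζ ∈ formU ⁻¹' {0}ᶜ from hU))
    refine ⟨r, hr, fun z hz => ⟨?_, fun hzc => ?_⟩⟩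
    · rintro rfl
      exact h hz formU_zero
    · have hV' := (mem_contour_iff.1 hzc).resolve_left (h hz)
      rw [formV] at hV hV'
      exact div_im_eq_zero_of_form_eq (s := -√3) (by linarith) (by linarith)

/-- With no jumps, `f` extends continuously across the open rays, and a continuous function
holomorphic off a line is holomorphic there. The power bound leaves at most a pole at `0`; a pole
would force `|f| → ∞` within `Ω₂` as well, against boundedness there. So the extension is entire
with a finite limit at infinity. -/
theorem eq_of_tendsto_of_no_jump {f : ℂ → ℂ} {l : ℂ} {K : ℝ} (ha : AnalyticOnNhd ℂ f contourᶜ)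
    (hj : ∀ ζ ∈ contour, ζ ≠ 0 → ∃ y, Tendsto f (𝓝[contourᶜ] ζ) (𝓝 y))
    (hinf : Tendsto f (Bornology.cobounded ℂ ⊓ 𝓟 contourᶜ) (𝓝 l))
    (h0 : f =O[𝓝[contourᶜ] 0] fun η => ‖η‖ ^ K) (hb : f =O[𝓝[Ω₂] 0] fun _ => (1 : ℝ))
    {η : ℂ} (hη : η ∉ contour) : f η = l := by
  set g := extendFrom contourᶜ f with hg
  have hlim : ∀ ζ, ζ ≠ 0 → ∃ y, Tendsto f (𝓝[contourᶜ] ζ) (𝓝 y) := by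
    intro ζ hζ
    by_cases hc : ζ ∈ contour
    · exact hj ζ hc hζ
    · exact ⟨f ζ, (ha ζ hc).continuousAt.tendsto.mono_left nhdsWithin_le_nhds⟩
  have hgt : ∀ ζ, ζ ≠ 0 → Tendsto f (𝓝[contourᶜ] ζ) (𝓝 (g ζ)) := fun ζ hζ =>
    tendsto_extendFrom (hlim ζ hζ)
  have hgf : ∀ ζ, ζ ∉ contour → g ζ = f ζ := fun ζ hζ =>
    extendFrom_eq (dense_compl_contour ζ)
      ((ha ζ hζ).continuousAt.tendsto.mono_left nhdsWithin_le_nhds)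
  have hgc : ContinuousOn g {0}ᶜ :=
    continuousOn_extendFrom (fun ζ _ => dense_compl_contour ζ) fun ζ hζ => hlim ζ hζ
  have hgan : ∀ ζ, ζ ∉ contour → AnalyticAt ℂ g ζ := fun ζ hζ =>
    (ha ζ hζ).congr (by
      filter_upwards [isOpen_compl_contour.mem_nhds hζ] with w hw using (hgf w hw).symm)
  have hga : ∀ ζ, ζ ≠ 0 → AnalyticAt ℂ g ζ := by
    intro ζ hζ
    by_cases hc : ζ ∈ contour
    · obtain ⟨r, hr, h⟩ := exists_ball_div_im_eq_zero hζ hc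
      exact analyticAt_of_continuous_of_off_line hζ hr (hgc.mono fun z hz => (h z hz).1)
        fun z hz him => (hgan z fun hzc => him ((h z hz).2 hzc)).differentiableAt
    · exact hgan ζ hc
  -- polynomial growth at the origin
  obtain ⟨C, hC⟩ := h0.bound
  obtain ⟨r, hr, hrC⟩ := Metric.mem_nhdsWithin_iff.1 hC
  have hgb : ∀ ζ, ζ ≠ 0 → ‖ζ‖ < r → ‖g ζ‖ ≤ C * ‖ζ‖ ^ K := by
    intro ζ hζ hζr
    have h1 : Tendsto (fun z : ℂ => C * ‖z‖ ^ K) (𝓝[contourᶜ] ζ) (𝓝 (C * ‖ζ‖ ^ K)) :=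
      (((continuous_norm.tendsto ζ).rpow_const (Or.inl (norm_ne_zero_iff.2 hζ))).const_mul
        C).mono_left nhdsWithin_le_nhds
    refine le_of_tendsto_of_tendsto (hgt ζ hζ).norm h1 ?_
    filter_upwards [self_mem_nhdsWithin, nhdsWithin_le_nhds
      (Metric.isOpen_ball.mem_nhds (mem_ball_zero_iff.2 hζr))] with w hw hw'
    have := hrC ⟨hw', hw⟩
    simp only [mem_ofPred_eq] at this
    rwa [Real.norm_of_nonneg (by positivity)] at this
  have hmer : MeromorphicAt g 0 := by
    -- This choice gives `N + 1 + K ≥ 1`, so `z^{N+1} g(z)` is `O(|z|)` and extends continuously by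
    -- `0`.
    obtain ⟨N, hN⟩ := exists_nat_ge (1 - K)
    refine ⟨N + 1, ?_⟩
    refine Complex.analyticAt_of_differentiable_on_punctured_nhds_of_continuousAt ?_ ?_
    · filter_upwards [self_mem_nhdsWithin] with z hz
      exact ((differentiableAt_id.sub_const 0).pow _).smul (hga z hz).differentiableAt
    · rw [ContinuousAt, sub_self, zero_pow N.succ_ne_zero, zero_smul,
        tendsto_zero_iff_norm_tendsto_zero]
      refine squeeze_zero' (g := fun z : ℂ => |C| * ‖z‖) (Eventually.of_forall fun _ => norm_nonneg _) ?_
        (by simpa using (continuous_norm.tendsto (0 : ℂ)).const_mul |C|)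
      filter_upwards [Metric.ball_mem_nhds (0 : ℂ) (lt_min hr one_pos)] with z hz
      rw [mem_ball_zero_iff, lt_min_iff] at hz
      rcases eq_or_ne z 0 with rfl | hz0
      · simp
      have hzn := norm_pos_iff.2 hz0
      rw [sub_zero, norm_smul, norm_pow]
      have h3 : ‖z‖ ^ (N + 1) * ‖z‖ ^ K ≤ ‖z‖ := by
        rw [← Real.rpow_natCast, ← Real.rpow_add hzn]
        conv_rhs => rw [← Real.rpow_one ‖z‖]
        exact Real.rpow_le_rpow_of_exponent_ge hzn hz.2.le (by push_cast; linarith)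
      calc ‖z‖ ^ (N + 1) * ‖g z‖ ≤ ‖z‖ ^ (N + 1) * (|C| * ‖z‖ ^ K) := by
            gcongr
            exact (hgb z hz0 hz.1).trans (by gcongr; exact le_abs_self C)
        _ = |C| * (‖z‖ ^ (N + 1) * ‖z‖ ^ K) := by ring
        _ ≤ |C| * ‖z‖ := by gcongr
  have hΩ : 𝓝[Ω₂] (0 : ℂ) ≤ 𝓝[≠] 0 := nhdsWithin_mono 0 fun z hz => ne_zero_of_mem_Ω₂ hz
  have hΩc : Ω₂ ⊆ contourᶜ := by
    rw [compl_contour_eq]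
    exact fun z hz => Or.inl (Or.inl (Or.inr hz))
  obtain ⟨c, hc⟩ : ∃ c, Tendsto g (𝓝[≠] 0) (𝓝 c) := by
    rw [tendsto_nhds_iff_meromorphicOrderAt_nonneg hmer]
    by_contra hneg
    have h1 := ((tendsto_cobounded_iff_meromorphicOrderAt_neg hmer).2 (not_le.1 hneg)).mono_left hΩ
    obtain ⟨B, hB⟩ := hb.bound
    have h2 := (tendsto_norm_cobounded_atTop.comp h1).eventually_gt_atTop B
    obtain ⟨z, hz1, hz2, hz3⟩ := (h2.and (hB.and self_mem_nhdsWithin)).exists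
    rw [Function.comp_apply, hgf z (hΩc hz3)] at hz1
    rw [norm_one, mul_one] at hz2
    linarith
  set G := Function.update g 0 c with hG
  have hGg : ∀ z, z ≠ 0 → G z = g z := fun z hz => Function.update_of_ne hz _ _
  have hGd : ∀ z, z ≠ 0 → DifferentiableAt ℂ G z := fun z hz =>
    (hga z hz).differentiableAt.congr_of_eventuallyEq (by
      filter_upwards [isOpen_ne.mem_nhds hz] with w hw using hGg w hw)
  have hGdiff : Differentiable ℂ G := by
    intro z
    rcases eq_or_ne z 0 with rfl | hz
    · refine (Complex.analyticAt_of_differentiable_on_punctured_nhds_of_continuousAt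
        (eventually_nhdsWithin_of_forall fun z hz => hGd z hz) ?_).differentiableAt
      exact continuousAt_update_same.2 hc
    · exact hGd z hz
  have hGinf : Tendsto G (cocompact ℂ) (𝓝 l) := by
    rw [← Metric.cobounded_eq_cocompact]
    refine (Metric.nhds_basis_closedBall.tendsto_right_iff).2 fun ε hε => ?_
    have h1 := eventually_inf_principal.1 (hinf.eventually (Metric.closedBall_mem_nhds l hε))
    obtain ⟨R, -, hR⟩ := hasBasis_cobounded_norm.eventually_iff.1 h1
    filter_upwards [tendsto_norm_cobounded_atTop.eventually_gt_atTop (max R 0)] with ζ hζ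
    have hζ0 : ζ ≠ 0 := norm_pos_iff.1 ((le_max_right _ _).trans_lt hζ)
    rw [hGg ζ hζ0]
    refine Metric.isClosed_closedBall.mem_of_tendsto (hgt ζ hζ0) ?_
    filter_upwards [self_mem_nhdsWithin, nhdsWithin_le_nhds ((isOpen_lt continuous_const
      -- The limit at infinity is assumed only off the contour; points on it are reached as limits,
      -- and a closed ball retains the bound.
      continuous_norm).mem_nhds ((le_max_left _ _).trans_lt hζ))] with w hw hw'
    exact hR (le_of_lt hw') hw
  have hη0 : η ≠ 0 := fun h => hη (h ▸ zero_mem_contour)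
  rw [← hgf η hη, ← hGg η hη0]
  exact hGdiff.apply_eq_of_tendsto_cocompact η hGinf

/-! ### Uniqueness -/

theorem nhdsWithin_compl_contour_le {ζ : ℂ} {U Ωl Ωr : Set ℂ} (hU : IsOpen U) (hζ : ζ ∈ U)
    (h : contourᶜ ∩ U ⊆ Ωl ∪ Ωr) : 𝓝[contourᶜ] ζ ≤ 𝓝[Ωl] ζ ⊔ 𝓝[Ωr] ζ := by
  rw [← nhdsWithin_union]
  exact nhdsWithin_le_of_mem (mem_of_superset
    (inter_mem self_mem_nhdsWithin (nhdsWithin_le_nhds (hU.mem_nhds hζ))) h)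

/-- `AJ · adj(BJ) = A (J adj J) adj B = A · adj B`, as `det J = 1`. With the adjugate in place of
the inverse, nothing need be known beforehand about invertibility of `S`. -/
theorem HasJump.exists_tendsto_mul_adjugate {M S : ℂ → Mat} {Γ Ωl Ωr : Set ℂ} {J : Mat}
    (hM : HasJump M Γ Ωl Ωr J) (hS : HasJump S Γ Ωl Ωr J) (hJ : J.det = 1) {ζ : ℂ} (hζ : ζ ∈ Γ)
    (hle : 𝓝[contourᶜ] ζ ≤ 𝓝[Ωl] ζ ⊔ 𝓝[Ωr] ζ) :
    ∃ Y, Tendsto (fun η => M η * (S η).adjugate) (𝓝[contourᶜ] ζ) (𝓝 Y) := by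
  obtain ⟨A, B, hA, hB, hAB⟩ := hM ζ hζ
  obtain ⟨C, D, hC, hD, hCD⟩ := hS ζ hζ
  have hadj : Continuous (fun X : Mat => X.adjugate) := continuous_id.matrix_adjugate
  have h1 := hA.mul ((hadj.tendsto C).comp hC)
  have h2 := hB.mul ((hadj.tendsto D).comp hD)
  have h3 : A * C.adjugate = B * D.adjugate := by
    rw [hAB, hCD, Matrix.adjugate_mul_distrib, mul_assoc, ← mul_assoc J, Matrix.mul_adjugate, hJ,
      one_smul, one_mul]
  refine ⟨B * D.adjugate, (Tendsto.sup ?_ h2).mono_left hle⟩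
  rw [← h3]
  exact h1

theorem det_upper (a : ℂ) : (upper a).det = 1 := by simp [upper, Matrix.det_fin_two]
theorem det_lower (a : ℂ) : (lower a).det = 1 := by simp [lower, Matrix.det_fin_two]
theorem det_expσ₃ (c : ℂ) : (expσ₃ c).det = 1 := by
  rw [expσ₃, Matrix.det_fin_two_of, ← Complex.exp_add]
  simp

theorem mul_mul_adjugate_mul {A B J : Mat} (hJ : J.det = 1) :
    (A * J) * (B * J).adjugate = A * B.adjugate := by
  rw [Matrix.adjugate_mul_distrib, mul_assoc, ← mul_assoc J, Matrix.mul_adjugate, hJ, one_smul,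
    one_mul]

/-- Every term of `M · adj S` pairs one column of `M` with the other column of `S`, so the exponents
add to `a + b`: this is `0` in `Ω₂` and `Ω₄`, and `-2α` in `Ω₁` and `Ω₃`. -/
theorem IsBigOAtZero.mul_adjugate {M S : ℂ → Mat} {Ω : Set ℂ} {a b : ℝ}
    (hM : IsBigOAtZero M Ω !![a, b; a, b]) (hS : IsBigOAtZero S Ω !![a, b; a, b])
    (hΩ : ∀ z ∈ Ω, z ≠ 0) (i j : Fin 2) :
    (fun η => (M η * (S η).adjugate) i j) =O[𝓝[Ω] 0] fun η => ‖η‖ ^ (a + b) := by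
  have h0 : ∀ {F : ℂ → Mat}, IsBigOAtZero F Ω !![a, b; a, b] → ∀ i,
      (fun η => F η i 0) =O[𝓝[Ω] 0] fun η => ‖η‖ ^ a := fun h i => by
    have := h i 0
    fin_cases i <;> exact this
  have h1 : ∀ {F : ℂ → Mat}, IsBigOAtZero F Ω !![a, b; a, b] → ∀ i,
      (fun η => F η i 1) =O[𝓝[Ω] 0] fun η => ‖η‖ ^ b := fun h i => by
    have := h i 1
    fin_cases i <;> exact this
  have hab : ∀ i k, (fun η => M η i 0 * S η k 1) =O[𝓝[Ω] 0] fun η => ‖η‖ ^ (a + b) := fun i k =>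
    ((h0 hM i).mul (h1 hS k)).congr' EventuallyEq.rfl
      (eventually_nhdsWithin_of_forall fun z hz => (Real.rpow_add (norm_pos_iff.2 (hΩ z hz)) a b).symm)
  have hba : ∀ i k, (fun η => M η i 1 * S η k 0) =O[𝓝[Ω] 0] fun η => ‖η‖ ^ (a + b) := fun i k =>
    ((h1 hM i).mul (h0 hS k)).congr' EventuallyEq.rfl
      (eventually_nhdsWithin_of_forall fun z hz => by
        rw [add_comm]; exact (Real.rpow_add (norm_pos_iff.2 (hΩ z hz)) b a).symm)
  simp only [Matrix.adjugate_fin_two, Matrix.mul_apply, Fin.sum_univ_two]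
  fin_cases j
  · simpa [sub_eq_add_neg] using (hab i 1).sub (hba i 1)
  · simpa [sub_eq_add_neg, add_comm] using (hba i 0).sub (hab i 0)

theorem IsSolution.tendsto_mul_expσ₃ {α : ℝ} {s₁ s₃ : ℂ} {M : ℂ → Mat}
    (h : IsSolution α s₁ s₃ M) :
    Tendsto (fun η => M η * expσ₃ (-(Complex.I * η))) (Bornology.cobounded ℂ ⊓ 𝓟 contourᶜ)
      (𝓝 1) := by
  refine tendsto_pi_nhds.2 fun i => tendsto_pi_nhds.2 fun j => ?_
  have h1 := (h.atInfinity i j).trans_tendsto (tendsto_inv₀_cobounded.mono_left inf_le_left)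
  simpa using h1.add_const ((1 : Mat) i j)

/-- The product of a solution with the adjugate of a solution is the identity matrix. -/
theorem IsSolution.mul_adjugate_eq_one {α : ℝ} (hα : 0 ≤ α) {s₁ s₃ : ℂ} {M S : ℂ → Mat}
    (hM : IsSolution α s₁ s₃ M) (hS : IsSolution α s₁ s₃ S) {η : ℂ} (hη : η ∉ contour) :
    M η * (S η).adjugate = 1 := by
  have hjump : ∀ ζ ∈ contour, ζ ≠ 0 →
      ∃ Y, Tendsto (fun η => M η * (S η).adjugate) (𝓝[contourᶜ] ζ) (𝓝 Y) := by
    have hU1 := isOpen_lt (continuous_const (y := (0 : ℝ))) continuous_formU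
    have hU2 := isOpen_lt continuous_formU (continuous_const (y := (0 : ℝ)))
    have hV1 := isOpen_lt (continuous_const (y := (0 : ℝ))) continuous_formV
    have hV2 := isOpen_lt continuous_formV (continuous_const (y := (0 : ℝ)))
    rintro ζ (h | ((h | h) | h) | h) h0
    · exact absurd h h0
    · refine hM.jump₁.exists_tendsto_mul_adjugate hS.jump₁ (det_upper _) h
        (nhdsWithin_compl_contour_le hV1 (forms_of_mem_Γ₁ h).2 ?_)
      rintro z ⟨hz, hz'⟩
      rw [compl_contour_eq] at hz
      rcases hz with ((hz | hz) | hz) | hz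
      · exact Or.inr hz
      · exact Or.inl hz
      · exact absurd hz' (mem_Ω₃_iff.1 hz).2.not_gt
      · exact absurd hz' (mem_Ω₄_iff.1 hz).2.not_gt
    · refine hM.jump₂.exists_tendsto_mul_adjugate hS.jump₂ (det_upper _) h
        (nhdsWithin_compl_contour_le hU2 (forms_of_mem_Γ₂ h).1 ?_)
      rintro z ⟨hz, hz'⟩
      rw [compl_contour_eq] at hz
      rcases hz with ((hz | hz) | hz) | hz
      · exact absurd hz' (mem_Ω₁_iff.1 hz).1.not_gt
      · exact Or.inr hz
      · exact Or.inl hz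
      · exact absurd hz' (mem_Ω₄_iff.1 hz).1.not_gt
    · refine hM.jump₃.exists_tendsto_mul_adjugate hS.jump₃ (det_lower _) h
        (nhdsWithin_compl_contour_le hV2 (forms_of_mem_Γ₃ h).2 ?_)
      rintro z ⟨hz, hz'⟩
      rw [compl_contour_eq] at hz
      rcases hz with ((hz | hz) | hz) | hz
      · exact absurd hz' (mem_Ω₁_iff.1 hz).2.not_gt
      · exact absurd hz' (mem_Ω₂_iff.1 hz).2.not_gt
      · exact Or.inr hz
      · exact Or.inl hz
    · refine hM.jump₄.exists_tendsto_mul_adjugate hS.jump₄ (det_lower _) h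
        (nhdsWithin_compl_contour_le hU1 (forms_of_mem_Γ₄ h).1 ?_)
      rintro z ⟨hz, hz'⟩
      rw [compl_contour_eq] at hz
      rcases hz with ((hz | hz) | hz) | hz
      · exact Or.inl hz
      · exact absurd hz' (mem_Ω₂_iff.1 hz).1.not_gt
      · exact absurd hz' (mem_Ω₃_iff.1 hz).1.not_gt
      · exact Or.inr hz
  have hinf : Tendsto (fun η => M η * (S η).adjugate) (Bornology.cobounded ℂ ⊓ 𝓟 contourᶜ)
      (𝓝 1) := by
    have hadj : Continuous (fun X : Mat => X.adjugate) := continuous_id.matrix_adjugate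
    have h := hM.tendsto_mul_expσ₃.mul ((hadj.tendsto 1).comp hS.tendsto_mul_expσ₃)
    simpa only [Function.comp_def, mul_mul_adjugate_mul (det_expσ₃ _), Matrix.adjugate_one,
      mul_one] using h
  have hne : ∀ {Ω : Set ℂ}, Ω ⊆ contourᶜ → ∀ z ∈ Ω, z ≠ 0 := fun hΩ z hz h0 =>
    hΩ hz (h0 ▸ zero_mem_contour)
  have hs1 : Ω₁ ⊆ contourᶜ := by rw [compl_contour_eq]; grind
  have hs2 : Ω₂ ⊆ contourᶜ := by rw [compl_contour_eq]; grind
  have hs3 : Ω₃ ⊆ contourᶜ := by rw [compl_contour_eq]; grind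
  have hs4 : Ω₄ ⊆ contourᶜ := by rw [compl_contour_eq]; grind
  have h2 : ∀ i j, (fun η => (M η * (S η).adjugate) i j) =O[𝓝[Ω₂] 0] fun η => ‖η‖ ^ (0 : ℝ) := by
    intro i j
    have h := hM.origin₂.mul_adjugate hS.origin₂ (hne hs2) i j
    -- The triangular normalisation at the origin has determinant `1` and cancels from the product,
    -- leaving the exponent `-α + α = 0`.
    simpa only [mul_mul_adjugate_mul (det_upper _), neg_add_cancel] using h
  have h4 : ∀ i j, (fun η => (M η * (S η).adjugate) i j) =O[𝓝[Ω₄] 0] fun η => ‖η‖ ^ (0 : ℝ) := by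
    intro i j
    have h := hM.origin₄.mul_adjugate hS.origin₄ (hne hs4) i j
    simpa only [mul_mul_adjugate_mul (det_lower _), add_neg_cancel] using h
  have h0 : ∀ i j, (fun η => (M η * (S η).adjugate) i j) =O[𝓝[contourᶜ] 0]
      fun η => ‖η‖ ^ (-α + -α) := by
    intro i j
    rw [compl_contour_eq, nhdsWithin_union, nhdsWithin_union, nhdsWithin_union]
    exact (((hM.origin₁.mul_adjugate hS.origin₁ (hne hs1) i j).sup
      ((h2 i j).trans (isBigO_rpow_of_le (by linarith) (hne hs2)))).sup
      (hM.origin₃.mul_adjugate hS.origin₃ (hne hs3) i j)).sup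
      ((h4 i j).trans (isBigO_rpow_of_le (by linarith) (hne hs4)))
  ext i j
  refine eq_of_tendsto_of_no_jump (f := fun η => (M η * (S η).adjugate) i j) (K := -α + -α)
    ?_ ?_ ?_ (h0 i j) ?_ hη
  · have hMa := hM.analytic
    have hSa := hS.analytic
    intro z hz
    simp only [Matrix.adjugate_fin_two, Matrix.mul_apply, Fin.sum_univ_two]
    fin_cases j
    · exact ((hMa i 0 z hz).mul (hSa 1 1 z hz)).add ((hMa i 1 z hz).mul (hSa 1 0 z hz).neg)
    · exact ((hMa i 0 z hz).mul (hSa 0 1 z hz).neg).add ((hMa i 1 z hz).mul (hSa 0 0 z hz))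
  · intro ζ hζ hζ0
    obtain ⟨Y, hY⟩ := hjump ζ hζ hζ0
    exact ⟨Y i j, (tendsto_pi_nhds.1 (tendsto_pi_nhds.1 hY i) j)⟩
  · exact tendsto_pi_nhds.1 (tendsto_pi_nhds.1 hinf i) j
  · simpa only [Real.rpow_zero] using h2 i j

/-- Applied to the pair `(S, S)`, the product identity says that `adj S` is the inverse of `S`;
applied to `(M, S)` it then gives `M = S`. -/
theorem IsSolution.unique {α : ℝ} (hα : 0 ≤ α) {s₁ s₃ : ℂ} {M S : ℂ → Mat}
    (hM : IsSolution α s₁ s₃ M) (hS : IsSolution α s₁ s₃ S) {η : ℂ} (hη : η ∉ contour) :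
    M η = S η := by
  have h1 := hM.mul_adjugate_eq_one hα hS hη
  have h2 := hS.mul_adjugate_eq_one hα hS hη
  rw [← mul_one (M η), ← mul_eq_one_comm.1 h2, ← mul_assoc, h1, one_mul]

/-! ### The logarithmic case -/

theorem sin_natCast_mul_pi (N : ℕ) : Complex.sin (N * Real.pi) = 0 := Complex.sin_nat_mul_pi N

theorem cos_natCast_mul_pi_sq (N : ℕ) : Complex.cos (N * Real.pi) ^ 2 = 1 := by
  have h := Complex.sin_sq_add_cos_sq (N * Real.pi)
  rw [sin_natCast_mul_pi] at h
  linear_combination h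

theorem hasDerivAt_besselJ_order {z : ℂ} (hz : z ≠ 0) (μ : ℂ) :
    HasDerivAt (fun ν => besselJ ν z) ((z / 2) ^ μ * Complex.log (z / 2) * besselE μ z +
      (z / 2) ^ μ * deriv (fun ν => besselE ν z) μ) μ := by
  have h1 := (hasDerivAt_id μ).const_cpow (c := z / 2) (Or.inl (div_ne_zero hz two_ne_zero))
  have h2 := (differentiable_besselE_order z μ).hasDerivAt
  have h := h1.mul h2
  simp only [id_eq, mul_one] at h
  exact h

/-- Unlike the defining quotient, this form holds at integer orders too: evaluated there it relates
`J_{-N}` to `J_N`, differentiated there it yields `Y_N`. -/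
theorem sin_mul_besselY {ν : ℂ} (hν : -(1 / 2) < ν.re) {z : ℂ} (hz : z ∈ hankelRegion 1) :
    Complex.sin (ν * Real.pi) * besselY ν z =
      besselJ ν z * Complex.cos (ν * Real.pi) - besselJ (-ν) z := by
  have h := sin_mul_hankelLaplace (Or.inl rfl) hν hz
  rw [exp_neg_eps_mul (Or.inl rfl)] at h
  rw [besselY_eq (Or.inl rfl) hν hz]
  linear_combination -h

theorem natCast_re_gt (N : ℕ) : -(1 / 2) < (N : ℂ).re := by
  have : (0 : ℝ) ≤ N := N.cast_nonneg
  simp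
  linarith

theorem besselJ_neg_natCast (N : ℕ) {z : ℂ} (hz : z ∈ hankelRegion 1) :
    besselJ (-N) z = besselJ N z * Complex.cos (N * Real.pi) := by
  have h := sin_mul_besselY (natCast_re_gt N) hz
  rw [sin_natCast_mul_pi] at h
  linear_combination h

/-- `Y_N` as a derivative with respect to the order. -/
theorem pi_mul_besselY_natCast (N : ℕ) {z : ℂ} (hz : z ∈ hankelRegion 1) :
    Real.pi * Complex.cos (N * Real.pi) * besselY N z =
      deriv (fun ν => besselJ ν z) N * Complex.cos (N * Real.pi) +
        deriv (fun ν => besselJ ν z) (-N) := by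
  have hz0 := Complex.slitPlane_ne_zero (mem_slitPlane_of_mem_hankelRegion hz)
  have hmem : {ν : ℂ | -(1 / 2) < ν.re} ∈ 𝓝 (N : ℂ) := (isOpen_lt_re _).mem_nhds (natCast_re_gt N)
  have hY : DifferentiableAt ℂ (fun ν => besselY ν z) N := by
    have h : DifferentiableAt ℂ
        (fun ν => -(((1 : ℝ) : ℂ) * Complex.I) * (hankelLaplace 1 ν z - besselJ ν z)) N :=
      (((differentiableOn_hankelLaplace_order (Or.inl rfl) hz).differentiableAt hmem).sub
        (differentiable_besselJ_order hz0 N)).const_mul _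
    refine h.congr_of_eventuallyEq ?_
    filter_upwards [hmem] with ν hν using besselY_eq (Or.inl rfl) hν hz
  have hpi : HasDerivAt (fun ν : ℂ => ν * Real.pi) (Real.pi : ℂ) N := by
    simpa using (hasDerivAt_id (N : ℂ)).mul_const (Real.pi : ℂ)
  have h1 := (hpi.csin).mul hY.hasDerivAt
  have hJ := (differentiable_besselJ_order hz0 N).hasDerivAt
  have hJ' : HasDerivAt (fun ν : ℂ => besselJ (-ν) z)
      (-deriv (fun ν => besselJ ν z) (-N)) N := by
    have := HasDerivAt.scomp (N : ℂ) ((differentiable_besselJ_order hz0 (-N)).hasDerivAt)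
      (hasDerivAt_neg (N : ℂ))
    simpa [Function.comp_def] using this
  have h2 := (hJ.mul hpi.ccos).sub hJ'
  have h3 := h1.congr_of_eventuallyEq (f₁ := fun ν => besselJ ν z * Complex.cos (ν * Real.pi) -
    besselJ (-ν) z) (by
      filter_upwards [hmem] with ν hν using (sin_mul_besselY hν hz).symm)
  have h4 := h3.unique h2
  rw [sin_natCast_mul_pi] at h4
  linear_combination h4

/-- `J_N` and `Y_N` at an integer order, with explicit singular part at the origin. -/
theorem exists_besselY_natCast_eq (N : ℕ) : ∃ a b j : ℂ → ℂ, Differentiable ℂ a ∧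
    Differentiable ℂ b ∧ Differentiable ℂ j ∧ b 0 ≠ 0 ∧ ∀ z ∈ hankelRegion 1,
      besselJ N z = z ^ N * j z ∧
      besselY N z = z ^ N * Complex.log z * b z + (z ^ N)⁻¹ * a z := by
  have hE := differentiable_besselE N
  have hD := differentiable_deriv_besselE N
  have hD' := differentiable_deriv_besselE (-N)
  set D : ℂ → ℂ := fun z => deriv (fun ν => besselE ν z) N with hDdef
  set D' : ℂ → ℂ := fun z => deriv (fun ν => besselE ν z) (-N) with hD'def
  set c := Complex.cos (N * Real.pi) with hc
  have hc2 : c ^ 2 = 1 := cos_natCast_mul_pi_sq N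
  have hπ : (Real.pi : ℂ) ≠ 0 := by exact_mod_cast Real.pi_ne_zero
  -- The order derivatives of `J` at `N` and `-N` each contain `log(z/2)`. By `J_{-N} = cos(Nπ) J_N`
  -- the two logarithms merge into `2 log(z/2)` times a multiple of `J_N`, whence `b`. The `-log 2`
  -- and the other terms carrying `z^N` go into `a`, written as `z^{-N} z^{2N}`.
  refine ⟨fun z => z ^ (2 * N) * ((Real.pi : ℂ)⁻¹ * (2 ^ N)⁻¹ *
      (D z - 2 * Real.log 2 * besselE N z)) + c * (Real.pi : ℂ)⁻¹ * 2 ^ N * D' z,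
    fun z => 2 * (Real.pi : ℂ)⁻¹ * (2 ^ N)⁻¹ * besselE N z, fun z => (2 ^ N)⁻¹ * besselE N z,
    by fun_prop, by fun_prop, by fun_prop, ?_, ?_⟩
  · have hG : Complex.Gamma (N + 1) ≠ 0 :=
      Complex.Gamma_ne_zero_of_re_pos (by linarith [natCast_re_gt N, Complex.add_re N 1, Complex.one_re])
    simp [besselE_zero, hG, hπ]
  · intro z hz
    have hz0 := Complex.slitPlane_ne_zero (mem_slitPlane_of_mem_hankelRegion hz)
    have hp : (z / 2) ^ (N : ℂ) = z ^ N * (2 ^ N)⁻¹ := by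
      rw [Complex.cpow_natCast, div_pow, div_eq_mul_inv]
    have hm : (z / 2) ^ (-(N : ℂ)) = (z ^ N)⁻¹ * 2 ^ N := by
      rw [Complex.cpow_neg, hp, mul_inv, inv_inv]
    refine ⟨by rw [besselJ_eq, hp]; ring, ?_⟩
    have h1 := pi_mul_besselY_natCast N hz
    rw [(hasDerivAt_besselJ_order hz0 N).deriv, (hasDerivAt_besselJ_order hz0 (-N)).deriv] at h1
    have h2 := besselJ_neg_natCast N hz
    rw [besselJ_eq, besselJ_eq, hm, hp] at h2
    have hlog : Complex.log (z / 2) = Complex.log z - Real.log 2 := by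
      have h3 := Complex.log_ofReal_mul (r := 1 / 2) (by norm_num) hz0
      rw [show (((1 / 2 : ℝ) : ℂ) * z) = z / 2 by push_cast; ring, one_div, Real.log_inv] at h3
      rw [h3]
      push_cast
      ring
    rw [hm, hp, hlog] at h1
    have hpow : (2 : ℂ) ^ N ≠ 0 := pow_ne_zero _ two_ne_zero
    have hzN : z ^ N ≠ 0 := pow_ne_zero _ hz0
    rw [← hc] at h1 h2
    have hπi : (Real.pi : ℂ) * (Real.pi : ℂ)⁻¹ = 1 := mul_inv_cancel₀ hπ
    have h3 : besselY N z = c * (Real.pi : ℂ)⁻¹ * (Real.pi * c * besselY N z) := by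
      linear_combination -besselY N z * hπi * c ^ 2 - besselY N z * hc2
    have hzz : (z ^ N)⁻¹ * z ^ (2 * N) = z ^ N := by
      rw [two_mul, pow_add, inv_mul_cancel_left₀ hzN]
    rw [h3, h1]
    change c * (Real.pi : ℂ)⁻¹ * ((z ^ N * (2 ^ N)⁻¹ * (Complex.log z - Real.log 2) * besselE N z +
      z ^ N * (2 ^ N)⁻¹ * D z) * c + ((z ^ N)⁻¹ * 2 ^ N * (Complex.log z - Real.log 2) *
        besselE (-N) z + (z ^ N)⁻¹ * 2 ^ N * D' z)) = _
    linear_combination c * (Real.pi : ℂ)⁻¹ * (Complex.log z - Real.log 2) * h2 +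
      (2 * z ^ N * (2 ^ N)⁻¹ * (Complex.log z - Real.log 2) * besselE N z + z ^ N * (2 ^ N)⁻¹ * D z) *
        (Real.pi : ℂ)⁻¹ * hc2 - (Real.pi : ℂ)⁻¹ * (2 ^ N)⁻¹ *
      (D z - 2 * Real.log 2 * besselE N z) * hzz

theorem HasLogSingularity.mul_upper {α : ℝ} {Ω : Set ℂ} {F : ℂ → Mat}
    (h : HasLogSingularity α Ω F) (s : ℂ) : HasLogSingularity α Ω (fun η => F η * upper s) := by
  obtain ⟨A, B, hA, hB, hB0, hF⟩ := h
  have key : ∀ {A : ℂ → Mat}, (∀ i j, AnalyticAt ℂ (fun η => A η i j) 0) →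
      ∀ i j, AnalyticAt ℂ (fun η => (A η * upper s) i j) 0 := by
    intro A hA i j
    simp only [Matrix.mul_apply, Fin.sum_univ_two]
    exact ((hA i 0).mul analyticAt_const).add ((hA i 1).mul analyticAt_const)
  refine ⟨fun η => A η * upper s, fun η => B η * upper s, key hA, key hB, fun h0 => hB0 ?_, ?_⟩
  · have h1 : upper s * upper (-s) = 1 := by
      rw [upper_mul_upper]
      simp [upper, Matrix.one_fin_two]
    have h2 : B 0 * upper s = 0 := h0
    rw [← mul_one (B 0), ← h1, ← mul_assoc, h2, zero_mul]
  · filter_upwards [hF] with η hη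
    rw [hη, add_mul, smul_mul_assoc, smul_mul_assoc]

theorem HasLogSingularity.congr {α : ℝ} {Ω : Set ℂ} {F G : ℂ → Mat}
    (h : HasLogSingularity α Ω F) (hG : ∀ η ∈ Ω, G η = F η) : HasLogSingularity α Ω G := by
  obtain ⟨A, B, hA, hB, hB0, hF⟩ := h
  refine ⟨A, B, hA, hB, hB0, ?_⟩
  filter_upwards [hF, self_mem_nhdsWithin] with η h1 h2
  rw [hG η h2, h1]

theorem conjW_add (A B : Mat) : conjW (A + B) = conjW A + conjW B := by
  ext i j
  fin_cases i <;> fin_cases j <;> simp [conjW] <;> ring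

theorem conjW_smul (c : ℂ) (A : Mat) : conjW (c • A) = c • conjW A := by
  ext i j
  fin_cases i <;> fin_cases j <;> simp [conjW]

theorem exp_logΓ {η : ℂ} (h : η ≠ 0) : Complex.exp (logΓ η) = η := by
  have h1 : Complex.exp (argΓ η * Complex.I) = Complex.exp (Complex.arg η * Complex.I) := by
    rw [argΓ]
    split_ifs
    · rfl
    · push_cast
      rw [sub_mul, Complex.exp_sub, Complex.exp_two_pi_mul_I, div_one]
  rw [logΓ, Complex.exp_add, h1, ← Complex.ofReal_exp, Real.exp_log (norm_pos_iff.2 h),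
    Complex.norm_mul_exp_arg_mul_I]

/-- Here `2α = 2n + 1` is an integer, so `η^{2α}` is single-valued. Terms `η^α` times an analytic
function can thus be absorbed into `η^{-α} A`. -/
theorem powΓ_eq_powΓ_neg_mul_pow {α : ℝ} {n : ℕ} (hn : α - 1 / 2 = n) {η : ℂ} (h : η ≠ 0) :
    powΓ η α = powΓ η (-α) * η ^ (2 * n + 1) := by
  have h1 : (α : ℂ) = n + 1 / 2 := by
    rw [show α = n + 1 / 2 by linarith]
    push_cast
    rfl
  conv_rhs => rw [← exp_logΓ h]
  rw [powΓ, powΓ, ← Complex.exp_nat_mul, ← Complex.exp_add, exp_logΓ h, h1]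
  congr 1
  push_cast
  ring

theorem HasLogSingularity.conjW {α : ℝ} {n : ℕ} (hn : α - 1 / 2 = n) {Ω Ω' : Set ℂ}
    {F G : ℂ → Mat} (h : HasLogSingularity α Ω F) (hΩ : ∀ η ∈ Ω', -η ∈ Ω)
    (hV : ∀ η ∈ Ω, 0 < formV η) (hG : ∀ η ∈ Ω', G η = ModelRH.conjW (F (-η))) :
    HasLogSingularity α Ω' G := by
  obtain ⟨A, B, hA, hB, hB0, hF⟩ := h
  set e := Complex.exp (α * (Real.pi * Complex.I)) with he
  set e' := Complex.exp (-(α * (Real.pi * Complex.I))) with he'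
  have key : ∀ {A : ℂ → Mat}, (∀ i j, AnalyticAt ℂ (fun η => A η i j) 0) →
      ∀ i j, AnalyticAt ℂ (fun η => ModelRH.conjW (A (-η)) i j) 0 := by
    intro A hA
    have hA' : ∀ i j, AnalyticAt ℂ (fun η => A (-η) i j) 0 := fun i j =>
      (hA i j).comp_of_eq analyticAt_id.neg neg_zero
    intro i j
    fin_cases i <;> fin_cases j
    · exact hA' 1 1
    · exact (hA' 1 0).neg
    · exact (hA' 0 1).neg
    · exact hA' 0 0
  -- Under `η ↦ -η` the logarithm gains `iπ`. The resulting non-logarithmic term `iπ η^α B` moves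
  -- into `A` with the factor `η^{2n+1}`.
  refine ⟨fun η => e' • ModelRH.conjW (A (-η)) +
      (η ^ (2 * n + 1) * (e * (Real.pi * Complex.I))) • ModelRH.conjW (B (-η)),
    fun η => e • ModelRH.conjW (B (-η)), fun i j => ?_, fun i j => analyticAt_const.mul (key hB i j),
    fun h0 => hB0 ?_, ?_⟩
  · exact (analyticAt_const.mul (key hA i j)).add
      (((analyticAt_id.pow _).mul analyticAt_const).mul (key hB i j))
  · simp only [neg_zero] at h0
    have h1 := (smul_eq_zero.1 h0).resolve_left (Complex.exp_ne_zero _)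
    rw [← conjW_conjW (B 0), h1]
    ext i j
    fin_cases i <;> fin_cases j <;> simp [ModelRH.conjW]
  · have ht : Tendsto (fun η : ℂ => -η) (𝓝[Ω'] 0) (𝓝[Ω] 0) := by
      refine tendsto_nhdsWithin_of_tendsto_nhds_of_eventually_within _ ?_
        (eventually_nhdsWithin_of_forall hΩ)
      simpa using (continuous_neg.tendsto (0 : ℂ)).mono_left nhdsWithin_le_nhds
    filter_upwards [ht.eventually hF, self_mem_nhdsWithin] with η h1 h2
    have hVη := hV _ (hΩ η h2)
    have hη0 : η ≠ 0 := neg_ne_zero.1 (ne_zero_of_formV_pos hVη)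
    have hl : logΓ (-η) = logΓ η + Real.pi * Complex.I := by
      have := logΓ_neg_eq hVη
      rw [neg_neg, ← logΓ_eq_log hVη] at this
      rw [this]
      ring
    have hp : powΓ (-η) α = e * powΓ η α := by
      rw [powΓ, powΓ, hl, he, ← Complex.exp_add]
      congr 1
      ring
    have hp' : powΓ (-η) (-α) = e' * powΓ η (-α) := by
      rw [powΓ, powΓ, hl, he', ← Complex.exp_add]
      congr 1
      ring
    rw [hG η h2, h1, conjW_add, conjW_smul, conjW_smul, hp, hp', hl]
    have hpow := powΓ_eq_powΓ_neg_mul_pow hn hη0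
    simp only [smul_add, smul_smul]
    rw [add_assoc, ← add_smul]
    congr 2
    · ring
    · linear_combination e * (Real.pi * Complex.I) * hpow

/-- The matrix `M₁` as a function of the four entries of its inner factor. -/
def hankelComb (α : ℝ) (a b c d : ℂ) : Mat :=
  ((Real.sqrt Real.pi / (2 * Real.sqrt 2) : ℝ) : ℂ) •
    !![Complex.exp (α / 2 * (Real.pi * Complex.I)) * (Complex.I * a + b),
        Complex.exp (-(α / 2 * (Real.pi * Complex.I))) * (-c + Complex.I * d);
        -(Complex.exp (α / 2 * (Real.pi * Complex.I)) * (a + Complex.I * b)),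
        Complex.exp (-(α / 2 * (Real.pi * Complex.I))) * (-(Complex.I * c) + d)]

theorem hankelComb_add_smul (α : ℝ) (x y a b c d a' b' c' d' : ℂ) :
    hankelComb α (x * a + y * a') (x * b + y * b') (x * c + y * c') (x * d + y * d') =
      x • hankelComb α a b c d + y • hankelComb α a' b' c' d' := by
  ext i j
  fin_cases i <;> fin_cases j <;> simp [hankelComb] <;> ring

theorem analyticAt_hankelComb (α : ℝ) {a b c d : ℂ → ℂ} (ha : Differentiable ℂ a)
    (hb : Differentiable ℂ b) (hc : Differentiable ℂ c) (hd : Differentiable ℂ d) (i j : Fin 2)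
    (z : ℂ) : AnalyticAt ℂ (fun η => hankelComb α (a η) (b η) (c η) (d η) i j) z := by
  refine Differentiable.analyticAt (f := fun η => hankelComb α (a η) (b η) (c η) (d η) i j) ?_ z
  fin_cases i <;> fin_cases j <;> simp only [hankelComb] <;> simp <;> fun_prop

theorem hasLogSingularity_principalM {α : ℝ} {n : ℕ} (hn : α - 1 / 2 = n) {Ω : Set ℂ}
    (hV : ∀ η ∈ Ω, 0 < formV η) : HasLogSingularity α Ω (principalM α) := by
  obtain ⟨a, b, j, ha, hb, hj, hb0, h⟩ := exists_besselY_natCast_eq n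
  obtain ⟨a', b', j', ha', hb', hj', -, h'⟩ := exists_besselY_natCast_eq (n + 1)
  have hα : (α : ℂ) = n + 1 / 2 := by
    rw [show α = n + 1 / 2 by linarith]
    push_cast
    rfl
  -- With `α = n + 1/2`, the orders `α ± 1/2` are `n + 1` and `n`. The powers follow from `z^{1/2}
  -- z^{n+1} = z^{-α} z^{2n+2}`, `z^{1/2} z^n = z^{-α} z^{2n+1}`, `z^{1/2} z^{-(n+1)} = z^{-α}` and
  -- `z^{1/2} z^{-n} = z^{-α} z`.
  refine ⟨fun z => hankelComb α
      (z ^ (2 * n + 2) * j' z + Complex.I * a' z) (z ^ (2 * n + 1) * j z + Complex.I * (z * a z))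
      (z ^ (2 * n + 2) * j' z - Complex.I * a' z) (z ^ (2 * n + 1) * j z - Complex.I * (z * a z)),
    fun z => hankelComb α (Complex.I * (z * b' z)) (Complex.I * b z)
      (-(Complex.I * (z * b' z))) (-(Complex.I * b z)),
    fun i k => analyticAt_hankelComb α (by fun_prop) (by fun_prop) (by fun_prop) (by fun_prop) i k 0,
    fun i k => analyticAt_hankelComb α (by fun_prop) (by fun_prop) (by fun_prop) (by fun_prop) i k 0,
    fun h0 => ?_, ?_⟩
  -- At `0` the order `n + 1` drops out of `B`, its logarithmic coefficient carrying an extra `z`;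
  -- the upper left entry is then a nonzero multiple of `b 0`.
  · have h1 := congrFun (congrFun h0 0) 0
    have hk : ((Real.sqrt Real.pi / (2 * Real.sqrt 2) : ℝ) : ℂ) ≠ 0 := by
      have := Real.pi_pos
      exact_mod_cast (by positivity : Real.sqrt Real.pi / (2 * Real.sqrt 2) ≠ 0)
    simp only [hankelComb, Matrix.smul_apply, Matrix.of_apply, Matrix.cons_val', Matrix.cons_val_zero,
      smul_eq_mul, Matrix.zero_apply, mul_eq_zero, hk, Complex.exp_ne_zero, false_or, zero_mul,
      mul_zero, zero_add, Complex.I_ne_zero, hb0] at h1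
  · filter_upwards [self_mem_nhdsWithin] with z hz
    have hVz := hV z hz
    have hz0 := ne_zero_of_formV_pos hVz
    have hreg := mem_hankelRegion_of_formV hVz.le hz0
    have h1 := h z hreg
    have h2 := h' z hreg
    push_cast at h2
    rw [powΓ_eq_cpow hVz, powΓ_eq_cpow hVz, logΓ_eq_log hVz, ← hankelComb_add_smul]
    set s := z ^ (1 / 2 : ℂ) with hs
    have hss : s * s = z := by
      rw [hs, ← Complex.cpow_add _ _ hz0]
      norm_num
    have hs0 : s ≠ 0 := fun h => hz0 (by rw [← hss, h, zero_mul])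
    have hzn : z ^ n ≠ 0 := pow_ne_zero _ hz0
    have hpα : z ^ (α : ℂ) = z ^ n * s := by
      rw [hα, Complex.cpow_add _ _ hz0, Complex.cpow_natCast]
    have hpα' : z ^ (-(α : ℂ)) = (z ^ n * s)⁻¹ := by rw [Complex.cpow_neg, hpα]
    have p1 : (z ^ n * s)⁻¹ * z ^ (2 * n + 2) = s * z ^ (n + 1) := by
      field_simp
      linear_combination -z ^ (2 * n + 1) * hss
    have p2 : (z ^ n * s)⁻¹ * z ^ (2 * n + 1) = s * z ^ n := by
      field_simp
      linear_combination -z ^ (2 * n) * hss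
    have p3 : (z ^ n * s)⁻¹ = s * (z ^ (n + 1))⁻¹ := by
      field_simp
      linear_combination -z ^ n * hss
    have p4 : (z ^ n * s)⁻¹ * z = s * (z ^ n)⁻¹ := by
      field_simp
      linear_combination -hss
    have q1 : (α : ℂ) + 1 / 2 = n + 1 := by rw [hα]; ring
    have q2 : (α : ℂ) - 1 / 2 = n := by rw [hα]; ring
    change hankelComb α (sqrtHankel1 (α + 1 / 2) z) (sqrtHankel1 (α - 1 / 2) z)
      (sqrtHankel2 (α + 1 / 2) z) (sqrtHankel2 (α - 1 / 2) z) = _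
    rw [hpα, hpα', q1, q2]
    simp only [sqrtHankel1, sqrtHankel2, hankel1, hankel2, h1.1, h1.2, h2.1, h2.2, ← hs]
    congr 1
    · linear_combination -j' z * p1 - Complex.I * a' z * p3
    · linear_combination -j z * p2 - Complex.I * a z * p4
    · linear_combination -j' z * p1 + Complex.I * a' z * p3
    · linear_combination -j z * p2 + Complex.I * a z * p4

theorem hasLogSingularity_solution {α : ℝ} {n : ℕ} (hn : α - 1 / 2 = n) (s₃ : ℂ) :
    HasLogSingularity α Ω₁ (solution α s₃) ∧ HasLogSingularity α Ω₂ (solution α s₃) ∧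
      HasLogSingularity α Ω₃ (solution α s₃) ∧ HasLogSingularity α Ω₄ (solution α s₃) := by
  have hV1 : ∀ η ∈ Ω₁, 0 < formV η := fun η hη => (mem_Ω₁_iff.1 hη).2
  have hV2 : ∀ η ∈ Ω₂, 0 < formV η := fun η hη => (mem_Ω₂_iff.1 hη).2
  have h1 := (hasLogSingularity_principalM hn hV1).congr
    fun η hη => solution_of_mem_Ω₁ hη α s₃
  have h2 := ((hasLogSingularity_principalM hn hV2).mul_upper (-s₃)).congr
    fun η hη => solution_of_mem_Ω₂ hη α s₃
  exact ⟨h1, h2,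
    h1.conjW hn (fun _ => neg_mem_Ω₁_iff.2) hV1
      fun η hη => solution_of_neg_mem_Ω₁ (neg_mem_Ω₁_iff.2 hη) α s₃,
    h2.conjW hn (fun _ => neg_mem_Ω₂_iff.2) hV2
      fun η hη => solution_of_neg_mem_Ω₂ (neg_mem_Ω₂_iff.2 hη) α s₃⟩

end

end ModelRH

theorem proposition2p1 (α : ℝ) (hα : 0 ≤ α) (s₁ s₃ : ℂ)
    (hs : s₁ + s₃ = -2 * Complex.sin (Real.pi * α)) :
    ModelRH.IsSolution α s₁ s₃ (ModelRH.solution α s₃) ∧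
    (∀ M : ℂ → ModelRH.Mat, ModelRH.IsSolution α s₁ s₃ M →
      ∀ η ∉ ModelRH.contour, M η = ModelRH.solution α s₃ η) ∧
    ((∃ n : ℕ, α - 1 / 2 = n) →
      ModelRH.HasLogSingularity α ModelRH.Ω₁ (ModelRH.solution α s₃) ∧
      ModelRH.HasLogSingularity α ModelRH.Ω₂ (ModelRH.solution α s₃) ∧
      ModelRH.HasLogSingularity α ModelRH.Ω₃ (ModelRH.solution α s₃) ∧
      ModelRH.HasLogSingularity α ModelRH.Ω₄ (ModelRH.solution α s₃)) := by
  have hsol := ModelRH.isSolution_solution hα hs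
  exact ⟨hsol, fun M hM η hη => hM.unique hα hsol hη,
    fun ⟨_, hn⟩ => ModelRH.hasLogSingularity_solution hn s₃⟩
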